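/- **Conventions.** $\mathbb N=\{0,1,2,\dots\}$ and $\underline N=\{1,\dots,N\}$. A pair-partition of a totally ordered set is a partition into sets of size two; two parts $\{a<b\}$, $\{c<d\}$ cross if $a<c<b<d$ or $c<a<d<b$. OP and OR mean order preserving and order reversing. For a graph $G$ and a set $U$ of vertices, the contraction $G/U$ is the graph on the vertices outside $U$ in which distinct $u,v$ are adjacent iff $G$ contains a path from $u$ to $v$ whose interior vertices (possibly none) all lie in $U$. $\mathcal C(G)$ is the set of connected components of $G$. **Chord data and frames.** A *twisted chord datum* of rank $N\ge 0$ is a pair $(P,s)$ of a pair-partition $P$ of the set of sites $\underline{2N}$ and a function $s:P\to\mathbb Z_2$. Its *boundary graph* has vertices $(i,\pm)$, $i\in\underline{2N}$, and edges $(i,+)-(i+1,-)$ for $1\le i<2N$, and for $\{i,j\}\in P$ the edges $(i,\pm)-(j,\mp)$ if $s(\{i,j\})=0$ and $(i,\pm)-(j,\pm)$ if $s(\{i,j\})=1$. A *frame* $F=(P,s,f)$ of rank $N$ consists of a twisted chord datum $(P,s)$ with connected boundary graph (no condition if $N=0$) and a function $f:P\cup\{\{0\},\{2N+1\}\}\to\mathbb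 N$. For a site $i\in\{0,\dots,2N+1\}$ write $f(i)$ and $s(i)$ for the values at the part containing $i$. Put $V_F=\{(i,a):0\le i\le 2N+1,\ 1\le a\le f(i)\}$, totally ordered by: $(i,a)\prec(j,b)$ if $i<j$, or $i=j\le 2N$ and $a<b$, or $i=j=2N+1$ and $a>b$. A vertex $(i,a)$ is internal if $1\le i\le 2N$. For $\{i,j\}\in P$ set $\iota_F(i,a)=(j,f(i)+1-a)$ if $s(i)=0$, and $\iota_F(i,a)=(j,a)$ if $s(i)=1$. **SWB data.** A *square with bands (SWB) datum* $\Theta=(F,E)$ of type $(n,m)$ is a frame $F$ with $f(0)=n$, $f(2N+1)=m$, with a crossingless pair-partition $E$ of $(V_F,\prec)$. Let $Sq(n,m)$ be the set of SWB data of type $(n,m)$ of all ranks. The *curve graph* $G(\Theta)$ has vertex set $V_F$, and edges the parts of $E$ and the pairs $\{v,\iota_F(v)\}$, $v$ internal. A component $\Gamma$ of $G(\Theta)$ is *internal* if all its vertices are. It is *twisted* if the number of its edges $\{v,\iota_F(v)\}$ which lie in parts with $s=1$ is odd, and *untwisted* otherwise. For a union $S$ of vertex sets of components, the *restriction* of $\Theta$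 to $S$ is the SWB datum with the same $(P,s)$, with $f'(i)=|\{a:(i,a)\in S\}|$, and with pairing $o(\{e\in E:e\subset S\})$ for the OP bijection $o:S\to V_{F'}$. Then $\Theta\smallsetminus\Gamma$ is the restriction to $V_F\smallsetminus V(\Gamma)$, and $\Theta_\Gamma$ the restriction to $V(\Gamma)$. The *complement graph* $\mathcal G(\Theta)$ has vertices $(i,a)$ with $0\le i\le 2N+1$, $a\in\{\tfrac12,\tfrac32,\dots,f(i)+\tfrac12\}$, and edges $v-\iota_F(v)$ for $v$ internal (same formula for $\iota_F$), and $u-v$ whenever $\{u,v\}$ crosses no part of $E$ (for the order defined by the same formulas). $\Gamma$ is *separating* if $\mathcal G(\Theta_\Gamma)$ has two components, *non-separating* if it has one. **Duals.** $\Theta^*$ has rank $N$; its $P$, $s$, $f$ are transported along $i\mapsto 2N+1-i$, and its pairing is the image of $E$ under the OR bijection $V_F\to V_{F^*}$. **Juxtaposition.** For $\Theta_1\in Sq(n,m)$, $\Theta_2\in Sq(m,l)$ of ranks $N_1,N_2$, let $V_{12}$ be obtained from $V_{F_1}\sqcup V_{F_2}$ by identifying $(2N_1+1,a)\in V_{F_1}$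 with $(0,a)\in V_{F_2}$ for $a\in\underline m$. Let $U\subset V_{12}$ be the set of identified vertices, and let $G(\Theta_1,\Theta_2)$ be the union of the two curve graphs, on $V_{12}$. The *linking number* is $L_{\Theta_1,\Theta_2}=|\mathcal C(G(\Theta_1,\Theta_2))|-|\mathcal C(G(\Theta_1,\Theta_2)/U)|$. The *vertical juxtaposition* $\Theta_2\#\Theta_1\in Sq(n,l)$ has rank $N_1+N_2$, the $P,s,f$ of $\Theta_1$ on the sites $1,\dots,2N_1$ and those of $\Theta_2$, shifted by $2N_1$, on the sites $2N_1+1,\dots,2N_1+2N_2$, and its pairing is the image of the edge set of $(V_{12},E_1\cup E_2)/U$ under the OP relabelling of $V_{12}\smallsetminus U$ (vertices of $\Theta_1$ before those of $\Theta_2$). **Isotopy.** Suppose $i\in\underline{2N}$, $e=\{(i,a),(i,a+1)\}\in E$ and $\iota_F(e)\notin E$. The *pull-through* of $\Theta$ at $e$ has the same $(P,s)$, the value $f$ decreased by $2$ on the part containing $i$ and unchanged elsewhere, and as pairing the OP relabelling of the pairing of $V_F\smallsetminus(e\cup\iota_F(e))$ obtained from $E$ by removing the parts meeting $e\cup\iota_F(e)$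 and joining the two former partners of the elements of $\iota_F(e)$. Isotopy is the equivalence relation on $Sq(n,m)$ generated by pull-throughs. **Handle slides.** Let $\epsilon=\pm1$, $i$ and $j=i+\epsilon$ in $\underline{2N}$, $\{i,j\}\notin P$, $i\in p\in P$, $q=\{j,i'\}\in P$. Let $\sigma$ be the permutation of $\{0,\dots,2N+1\}$ fixing $0$ and $2N+1$, OP on $\underline{2N}\smallsetminus\{i\}$, with $\sigma(i)=\sigma(i')+\epsilon(-1)^{s(q)}$. The *handle slide* of $\Theta$ at $(i,\epsilon)$ has chords $\sigma(P)$; its values of $s$ and $f$ at $\sigma(r)$, $r\in P\cup\{\{0\},\{2N+1\}\}$, are those of $\Theta$ at $r$, except that $s(q)$ is added to $s$ at $\sigma(p)$ and $f(p)$ is added to $f$ at $\sigma(q)$. Let $U$ be the set of the $f(p)$ vertices at site $\sigma(i)$ and the $f(p)$ vertices at site $\sigma(i')$ closest to them. The new pairing is the image of $E$ under the OP bijection from $V_F$ to the complement of $U$, together with the pairing of $U$ which joins its $k$-th smallest to its $k$-th largest element. *Handle slide equivalence* on $Sq(n,m)$: $\Theta\sim_{\mathrm{h.s.}}\Theta'$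 iff $\Theta$ is isotopic to a datum obtained from $\Theta'$ by a finite (possibly empty) sequence of handle slides. Let $Sq^{\mathrm{h.s.}}(n,m)$ be the set of classes $[\Theta]$. **Theorem (square with bands category).** Let $\mathbb K$ be a commutative unital ring and $\alpha,\beta,\gamma\in\mathbb K$. For $n,m\in\mathbb N$ let $A(n,m)$, $B(n,m)$, $C(n,m)$ be the submodules of the free module $\mathbb K\,Sq^{\mathrm{h.s.}}(n,m)$ spanned by the elements $[\Theta]-\alpha[\Theta\smallsetminus\Gamma]$, $[\Theta]-\beta[\Theta\smallsetminus\Gamma]$, $[\Theta]-\gamma[\Theta\smallsetminus\Gamma]$ respectively, where $\Theta\in Sq(n,m)$ and $\Gamma$ is an internal component of $G(\Theta)$ which is, respectively, separating; twisted; non-separating and untwisted. Put $$\mathcal{SQ}(n,m)=\mathbb K\,Sq^{\mathrm{h.s.}}(n,m)/(A(n,m)+B(n,m)+C(n,m)),$$ and let $\overline\Theta$ be the image of $[\Theta]$. Then vertical juxtapositions and duals of SWB data exist and are unique, and there is a small $\mathbb K$-linear category $\mathcal{SQ}=\mathcal{SQ}(\alpha,\beta,\gamma)$ with set of objects $\mathbb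 N$, modules of morphisms $\mathcal{SQ}(n,m)$ from $n$ to $m$, and $\mathbb K$-bilinear composition determined by $$\overline{\Theta_2}\circ\overline{\Theta_1}=\alpha^{L_{\Theta_1,\Theta_2}}\,\overline{\Theta_2\#\Theta_1}\qquad(\Theta_1\in Sq(n,m),\ \Theta_2\in Sq(m,l)).$$ Furthermore, $\mathcal{SQ}$ has a contravariant duality: the assignment $n^*=n$ on objects and $\overline\Theta^*=\overline{\Theta^*}$ on morphisms extends to well-defined $\mathbb K$-linear maps $\mathcal{SQ}(n,m)\to\mathcal{SQ}(m,n)$ that preserve identities, reverse composition, and satisfy $(x^*)^*=x$. -/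

import Mathlib

universe u

namespace SWB

/-! ### Generalities on orders, pairings and graphs

A pair-partition of a set is encoded by the fixed-point-free involution exchanging the two
elements of every part; it is extended by the identity outside of the set. -/

/-- The pairs `{a, b}` and `{c, d}` of elements of a linear order cross. -/
def Crosses {L : Type*} [LinearOrder L] (a b c d : L) : Prop :=
  (min a b < min c d ∧ min c d < max a b ∧ max a b < max c d) ∨
    (min c d < min a b ∧ min a b < max c d ∧ max c d < max a b)

/-- The contraction of `G` on the vertex subset `U`: two distinct vertices outside `U` are joined
if there is a path between them whose interior vertices all lie in `U` (this includes the edges of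
`G` between them). The vertices of the contraction are the vertices of `G` outside `U`. -/
def contract {V : Type*} (G : SimpleGraph V) (U : Set V) : SimpleGraph V where
  Adj u v := u ≠ v ∧ u ∉ U ∧ v ∉ U ∧ ∃ p : G.Walk u v, ∀ w ∈ p.support, w = u ∨ w = v ∨ w ∈ U
  symm := ⟨fun u v ⟨h, hu, hv, p, hp⟩ => ⟨h.symm, hv, hu, p.reverse, fun w hw => by
    rw [SimpleGraph.Walk.support_reverse, List.mem_reverse] at hw
    rcases hp w hw with h | h | h
    · exact Or.inr (Or.inl h)
    · exact Or.inl h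
    · exact Or.inr (Or.inr h)⟩⟩
  loopless := ⟨fun _ h => h.1 rfl⟩

/-- The number of components of the graph with vertex set `W` and the edges of `G`. (All our
graphs live on an ambient type, with no edges leaving their vertex set `W`.) -/
noncomputable def numComponents {V : Type*} (G : SimpleGraph V) (W : Set V) : ℕ :=
  (G.connectedComponentMk '' W).ncard

/-! ### Twisted chord data -/

/-- A twisted chord datum of rank `N`: a pair-partition `P` of the set of sites `{1, …, 2N}`,
together with a function `s` from the arcs (the parts of `P`) to `ℤ/2`, given as a function of
sites which agrees on the two ends of each arc. Arcs with `s = 1` are twisted. -/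
structure ChordDatum where
  N : ℕ
  P : ℕ → ℕ
  s : ℕ → ZMod 2
  P_P : ∀ i, P (P i) = i
  P_ne : ∀ i, P i ≠ i ↔ 1 ≤ i ∧ i ≤ 2 * N
  s_P : ∀ i, s (P i) = s i
  s_out : ∀ i, ¬(1 ≤ i ∧ i ≤ 2 * N) → s i = 0

/-- The boundary graph of a twisted chord datum; `(i, true)` is the vertex just above the site `i`
and `(i, false)` is the vertex just below it. -/
def ChordDatum.boundaryGraph (c : ChordDatum) :
    SimpleGraph {x : ℕ × Bool // 1 ≤ x.1 ∧ x.1 ≤ 2 * c.N} :=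
  SimpleGraph.fromRel fun x y =>
    (x.1.2 = true ∧ y.1.2 = false ∧ y.1.1 = x.1.1 + 1) ∨
    (y.1.1 = c.P x.1.1 ∧ y.1.2 = if c.s x.1.1 = 0 then !x.1.2 else x.1.2)

/-! ### Frames and square with bands data -/

/-- A frame: a twisted chord datum whose surface has exactly one boundary component, with a
function `f` giving the number of points on the bottom edge (site `0`), the top edge
(site `2N+1`) and on each of the two ends of every band.

For `N > 0` the boundary condition says that the boundary graph has exactly one component; for
`N = 0` (the square without bands) the boundary graph is empty and there is no condition. -/
structure Frame extends ChordDatum where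
  f : ℕ → ℕ
  f_P : ∀ i, f (P i) = f i
  f_out : ∀ i, 2 * N + 1 < i → f i = 0
  oneBoundary : toChordDatum.boundaryGraph.Preconnected

/-- The vertices `(i, a)` with `0 ≤ i ≤ 2N+1` and `1 ≤ a ≤ f i`. -/
def Frame.V (F : Frame) : Set (ℕ × ℕ) := {v | 1 ≤ v.2 ∧ v.2 ≤ F.f v.1}

/-- Internal vertices are those on the ends of the bands. -/
def Frame.Internal (F : Frame) (v : ℕ × ℕ) : Prop := 1 ≤ v.1 ∧ v.1 ≤ 2 * F.N

/-- The total (anticlockwise) order of points: `u` precedes `v` if and only if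
`key N u < key N v`. Points are ordered by site, then by height, with the order on the top edge
(site `2N+1`) reversed. -/
def key (N : ℕ) (v : ℕ × ℕ) : ℕ ×ₗ ℤ :=
  toLex (v.1, if v.1 ≤ 2 * N then (v.2 : ℤ) else -(v.2 : ℤ))

/-- The involution of the internal vertices exchanging the two ends of each of the parallel arcs
in the bands. -/
def Frame.iota (F : Frame) (v : ℕ × ℕ) : ℕ × ℕ :=
  (F.P v.1, if F.s v.1 = 0 then F.f v.1 + 1 - v.2 else v.2)

/-- A square with bands datum: a frame together with a crossingless pair-partition `E` of the
vertices. -/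
structure Datum extends Frame where
  E : ℕ × ℕ → ℕ × ℕ
  E_E : ∀ v, E (E v) = v
  E_ne : ∀ v, E v ≠ v ↔ v ∈ toFrame.V
  noncrossing : ∀ u ∈ toFrame.V, ∀ v ∈ toFrame.V,
    ¬ Crosses (key N u) (key N (E u)) (key N v) (key N (E v))

/-- Square with bands data of type `(n, m)`, of arbitrary rank. -/
def Sq (n m : ℕ) : Type :=
  {Θ : Datum // Θ.f 0 = n ∧ Θ.f (2 * Θ.N + 1) = m}

/-! ### The curve graph and its components -/

/-- The graph formed by the arcs inside the square. -/
def Datum.arcGraph (Θ : Datum) : SimpleGraph (ℕ × ℕ) :=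
  SimpleGraph.fromRel fun u v => Θ.E u = v

/-- The graph formed by the parallel arcs in the bands. -/
def Datum.bandGraph (Θ : Datum) : SimpleGraph (ℕ × ℕ) :=
  SimpleGraph.fromRel fun u v => u ∈ Θ.V ∧ Θ.Internal u ∧ Θ.iota u = v

/-- The curve graph; its vertex set is `Θ.V`. -/
def Datum.curveGraph (Θ : Datum) : SimpleGraph (ℕ × ℕ) := Θ.arcGraph ⊔ Θ.bandGraph

/-- `Γ` is the vertex set of a component of the curve graph. -/
def Datum.IsComponent (Θ : Datum) (Γ : Set (ℕ × ℕ)) : Prop :=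
  ∃ v ∈ Θ.V, Γ = {w | Θ.curveGraph.Reachable v w}

/-- A component is internal if it has no vertex on the bottom or top edge. -/
def Datum.IsInternalComponent (Θ : Datum) (Γ : Set (ℕ × ℕ)) : Prop :=
  Θ.IsComponent Γ ∧ ∀ v ∈ Γ, Θ.Internal v

/-- The twist of a component: the number modulo two of its arcs passing through twisted bands.
Each arc is counted once, at its end at the lower site. -/
noncomputable def Datum.twist (Θ : Datum) (Γ : Set (ℕ × ℕ)) : ZMod 2 :=
  ({v | v ∈ Γ ∧ v.1 < Θ.P v.1 ∧ Θ.s v.1 = 1}.ncard : ZMod 2)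

/-- `o` is an order-preserving bijection from `W` to `W'`, both sets of vertices of data of
rank `N`. -/
def IsOP (N : ℕ) (W W' : Set (ℕ × ℕ)) (o : ℕ × ℕ → ℕ × ℕ) : Prop :=
  Set.BijOn o W W' ∧ ∀ u ∈ W, ∀ v ∈ W, key N u < key N v → key N (o u) < key N (o v)

/-- `Θ'` is obtained from `Θ` by keeping only the vertices in `S`, and the arcs between them; here
`S` is a union of components. -/
def IsRestriction (Θ : Datum) (S : Set (ℕ × ℕ)) (Θ' : Datum) : Prop :=
  Θ'.toChordDatum = Θ.toChordDatum ∧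
  (∀ i, Θ'.f i = {v | v ∈ S ∧ v.1 = i}.ncard) ∧
  ∃ o, IsOP Θ.N S Θ'.V o ∧ ∀ v ∈ S, Θ'.E (o v) = o (Θ.E v)

/-- `Θ'` is `Θ` with the component `Γ` deleted. -/
def IsDeletion (Θ : Datum) (Γ : Set (ℕ × ℕ)) (Θ' : Datum) : Prop :=
  IsRestriction Θ (Θ.V \ Γ) Θ'

/-! ### The complement graph, separating components -/

/-- The vertices of the complement graph: `(i, k)` with `0 ≤ k ≤ f i` stands for the point
`(i, k + 1/2)`. -/
def Frame.regions (F : Frame) : Set (ℕ × ℕ) := {x | x.1 ≤ 2 * F.N + 1 ∧ x.2 ≤ F.f x.1}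

/-- The complement graph, with vertex set `Θ.regions`. The second coordinates are doubled to
compare the vertices `(i, k + 1/2)` of the complement graph with the vertices `(j, a)` of the curve
graph. -/
def Datum.complementGraph (Θ : Datum) : SimpleGraph (ℕ × ℕ) :=
  SimpleGraph.fromRel fun x y =>
    (x ∈ Θ.regions ∧ Θ.Internal x ∧
      y = (Θ.P x.1, if Θ.s x.1 = 0 then Θ.f x.1 - x.2 else x.2)) ∨
    (x ∈ Θ.regions ∧ y ∈ Θ.regions ∧ ∀ v ∈ Θ.V,
      ¬ Crosses (key Θ.N (x.1, 2 * x.2 + 1)) (key Θ.N (y.1, 2 * y.2 + 1))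
        (key Θ.N (v.1, 2 * v.2)) (key Θ.N ((Θ.E v).1, 2 * (Θ.E v).2)))

/-- `Γ` is separating: after deletion of all the other components, the complement graph has two
components. -/
def Datum.IsSeparating (Θ : Datum) (Γ : Set (ℕ × ℕ)) : Prop :=
  ∃ Θ', IsRestriction Θ Γ Θ' ∧ numComponents Θ'.complementGraph Θ'.regions = 2

/-- `Γ` is non-separating: after deletion of all the other components, the complement graph has
one component. -/
def Datum.IsNonSeparating (Θ : Datum) (Γ : Set (ℕ × ℕ)) : Prop :=
  ∃ Θ', IsRestriction Θ Γ Θ' ∧ numComponents Θ'.complementGraph Θ'.regions = 1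

/-! ### Duality -/

/-- The order-reversing permutation of the sites `0, …, 2N+1`, extended by the identity. -/
def flip (N i : ℕ) : ℕ := if i ≤ 2 * N + 1 then 2 * N + 1 - i else i

/-- `Θ'` is the dual `Θ*` of `Θ`, the image of `Θ` under the order-reversing bijection of the
vertices. Its diagram is the vertical reflection of a diagram for `Θ`. -/
def IsDual (Θ Θ' : Datum) : Prop :=
  Θ'.N = Θ.N ∧
  (∀ i, Θ'.P i = flip Θ.N (Θ.P (flip Θ.N i))) ∧
  (∀ i, Θ'.s i = Θ.s (flip Θ.N i)) ∧
  (∀ i, Θ'.f i = Θ.f (flip Θ.N i)) ∧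
  ∃ o : ℕ × ℕ → ℕ × ℕ, Set.BijOn o Θ.V Θ'.V ∧
    (∀ u ∈ Θ.V, ∀ v ∈ Θ.V, key Θ.N u < key Θ.N v → key Θ.N (o v) < key Θ.N (o u)) ∧
    ∀ v ∈ Θ.V, Θ'.E (o v) = o (Θ.E v)

/-! ### Vertical juxtaposition

The data `Θ₁` and `Θ₂` are stacked by moving the sites of `Θ₂` up by `2 * N₁ + 1`, which identifies
the points `(2 * N₁ + 1, a)` on the top edge of `Θ₁` with the points `(0, a)` on the bottom edge
of `Θ₂`. -/

/-- Move the sites up by `k`. -/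
def shift (k : ℕ) : ℕ × ℕ ↪ ℕ × ℕ :=
  ⟨fun v => (v.1 + k, v.2), fun u v h => by
    simp only [Prod.mk.injEq, Nat.add_right_cancel_iff] at h
    exact Prod.ext h.1 h.2⟩

/-- The vertices of the composite graph of `(Θ₁, Θ₂)`. -/
def stackV (Θ₁ Θ₂ : Datum) : Set (ℕ × ℕ) := Θ₁.V ∪ shift (2 * Θ₁.N + 1) '' Θ₂.V

/-- The vertices of the composite graph which lie on the glued edges. -/
def stackMid (Θ₁ Θ₂ : Datum) : Set (ℕ × ℕ) :=
  {v | v ∈ stackV Θ₁ Θ₂ ∧ v.1 = 2 * Θ₁.N + 1}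

/-- The composite graph of `(Θ₁, Θ₂)`. -/
def stackGraph (Θ₁ Θ₂ : Datum) : SimpleGraph (ℕ × ℕ) :=
  Θ₁.curveGraph ⊔ Θ₂.curveGraph.map (shift (2 * Θ₁.N + 1))

/-- The part of the composite graph formed by the arcs inside the two squares. -/
def stackArcGraph (Θ₁ Θ₂ : Datum) : SimpleGraph (ℕ × ℕ) :=
  Θ₁.arcGraph ⊔ Θ₂.arcGraph.map (shift (2 * Θ₁.N + 1))

/-- The linking number: the number of components of the composite graph, minus the number of
components of its contraction on the set of glued vertices. (Contraction never increases the
number of components, so the subtraction is not truncated.) -/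
noncomputable def linking (Θ₁ Θ₂ : Datum) : ℕ :=
  numComponents (stackGraph Θ₁ Θ₂) (stackV Θ₁ Θ₂) -
    numComponents (contract (stackGraph Θ₁ Θ₂) (stackMid Θ₁ Θ₂))
      (stackV Θ₁ Θ₂ \ stackMid Θ₁ Θ₂)

/-- Relabelling of the sites after removal of the site `2 * N₁ + 1`; it is order preserving from
the vertices of the composite graph off the glued edges to those of the juxtaposition. -/
def unstack (N₁ : ℕ) (v : ℕ × ℕ) : ℕ × ℕ := if v.1 ≤ 2 * N₁ then v else (v.1 - 1, v.2)

/-- `Θ` is the vertical juxtaposition `Θ₂ # Θ₁`, with `Θ₂` on top of `Θ₁`. Its twisted chord datum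
is the concatenation of those of `Θ₁` and `Θ₂`, and its arcs inside the square are obtained from
the arcs in the two squares by contraction on the set of glued vertices. -/
def IsJuxtaposition (Θ₁ Θ₂ Θ : Datum) : Prop :=
  Θ.N = Θ₁.N + Θ₂.N ∧
  (∀ i, Θ.P i = if i ≤ 2 * Θ₁.N then Θ₁.P i else Θ₂.P (i - 2 * Θ₁.N) + 2 * Θ₁.N) ∧
  (∀ i, Θ.s i = if i ≤ 2 * Θ₁.N then Θ₁.s i else Θ₂.s (i - 2 * Θ₁.N)) ∧
  (∀ i, Θ.f i = if i ≤ 2 * Θ₁.N then Θ₁.f i else Θ₂.f (i - 2 * Θ₁.N)) ∧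
  ∀ v ∈ stackV Θ₁ Θ₂ \ stackMid Θ₁ Θ₂, ∀ w ∈ stackV Θ₁ Θ₂ \ stackMid Θ₁ Θ₂,
    Θ.E (unstack Θ₁.N v) = unstack Θ₁.N w ↔
      (contract (stackArcGraph Θ₁ Θ₂) (stackMid Θ₁ Θ₂)).Adj v w

/-! ### Isotopy -/

/-- The four vertices removed by the pull-through of the turn-back `{(i, a), (i, a+1)}`. -/
def Frame.pullSet (F : Frame) (i a : ℕ) : Set (ℕ × ℕ) :=
  {(i, a), (i, a + 1), F.iota (i, a), F.iota (i, a + 1)}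

/-- `Θ'` is obtained from `Θ` by pulling the turn-back `{(i, a), (i, a+1)}` through the band at the
site `i`. This is possible if `{(i, a), (i, a+1)}` is an arc of `Θ` whereas its image under `iota`
is not. The four vertices of the turn-back and its image are removed, and the vertices joined by
arcs to the two image vertices become joined to each other. -/
def IsPullThrough (Θ : Datum) (i a : ℕ) (Θ' : Datum) : Prop :=
  (1 ≤ i ∧ i ≤ 2 * Θ.N) ∧ (i, a) ∈ Θ.V ∧
  Θ.E (i, a) = (i, a + 1) ∧ Θ.E (Θ.iota (i, a)) ≠ Θ.iota (i, a + 1) ∧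
  Θ'.toChordDatum = Θ.toChordDatum ∧
  (∀ j, Θ'.f j = if j = i ∨ j = Θ.P i then Θ.f j - 2 else Θ.f j) ∧
  ∃ o, IsOP Θ.N (Θ.V \ Θ.pullSet i a) Θ'.V o ∧
    (∀ v ∈ Θ.V \ Θ.pullSet i a, Θ.E v ∉ Θ.pullSet i a → Θ'.E (o v) = o (Θ.E v)) ∧
    Θ'.E (o (Θ.E (Θ.iota (i, a)))) = o (Θ.E (Θ.iota (i, a + 1)))

/-- Isotopy is the equivalence relation generated by pull-throughs. -/
def Isotopic {n m : ℕ} : Sq n m → Sq n m → Prop :=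
  Relation.EqvGen fun Θ Θ' => ∃ i a, IsPullThrough Θ.1 i a Θ'.1

/-! ### Handle slides -/

/-- The vertices created by a handle slide, see `IsHandleSlide`. In the new frame, the slid end of
the band is at the site `k` and carries `c` points, and it is next to the site `l`, which carries
`d + c` points; the new vertices are those at `k` and the `c` vertices at `l` nearest to `k`. They
are paired by the nested pairing `newArc`. -/
def newVertices (k l c d : ℕ) : Set (ℕ × ℕ) :=
  {v | (v.1 = k ∧ 1 ≤ v.2 ∧ v.2 ≤ c) ∨
    (v.1 = l ∧ if l < k then d + 1 ≤ v.2 ∧ v.2 ≤ d + c else 1 ≤ v.2 ∧ v.2 ≤ c)}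

/-- The partner at the site `l` of the vertex `(k, c + 1 - b)`, for `1 ≤ b ≤ c`. -/
def newArc (k l d b : ℕ) : ℕ × ℕ := if l < k then (l, d + b) else (l, b)

/-- `Θ'` is obtained from `Θ` by sliding the end of a band at the site `i` in the direction
`ε = 1` (up) or `ε = -1` (down), over the band whose end is at the adjacent site `j = i + ε`. The
pair `(i, ε)` has to be admissible: `j` is a site, and is not the other end of the band at `i`.

The permutation `σ` of the sites moves the site `i` next to the other end `P j` of the band at `j`
and preserves the order of the other sites. If the band at `j` is twisted then the band at `i`
acquires a half-twist. The `f i` curves in the slid band now also run along the band at `j`.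
All the arcs of `Θ` are kept, and the new vertices are joined by parallel arcs. -/
def IsHandleSlide (Θ : Datum) (i : ℕ) (ε : ℤ) (Θ' : Datum) : Prop :=
  ∃ (j : ℕ) (σ : Equiv.Perm ℕ),
    (ε = 1 ∨ ε = -1) ∧ (j : ℤ) = i + ε ∧
    (1 ≤ i ∧ i ≤ 2 * Θ.N) ∧ (1 ≤ j ∧ j ≤ 2 * Θ.N) ∧ Θ.P i ≠ j ∧
    (∀ k, ¬(1 ≤ k ∧ k ≤ 2 * Θ.N) → σ k = k) ∧
    StrictMonoOn σ (Set.Icc 1 (2 * Θ.N) \ {i}) ∧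
    (σ i : ℤ) = σ (Θ.P j) + ε * (if Θ.s j = 0 then 1 else -1) ∧
    Θ'.N = Θ.N ∧
    (∀ k, Θ'.P (σ k) = σ (Θ.P k)) ∧
    (∀ k, Θ'.s (σ k) = Θ.s k + if k = i ∨ k = Θ.P i then Θ.s j else 0) ∧
    (∀ k, Θ'.f (σ k) = Θ.f k + if k = j ∨ k = Θ.P j then Θ.f i else 0) ∧
    (∃ o, IsOP Θ.N Θ.V (Θ'.V \ newVertices (σ i) (σ (Θ.P j)) (Θ.f i) (Θ.f j)) o ∧
      ∀ v ∈ Θ.V, Θ'.E (o v) = o (Θ.E v)) ∧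
    ∀ b, 1 ≤ b → b ≤ Θ.f i →
      Θ'.E (σ i, Θ.f i + 1 - b) = newArc (σ i) (σ (Θ.P j)) (Θ.f j) b

/-- Handle slide equivalence: `Θ` is isotopic to the result of applying a finite (possibly empty)
sequence of handle slides to `Θ'`. -/
def HandleSlideEquiv {n m : ℕ} (Θ Θ' : Sq n m) : Prop :=
  ∃ Θ'' : Sq n m,
    Relation.ReflTransGen (fun A B : Sq n m => ∃ i ε, IsHandleSlide A.1 i ε B.1) Θ' Θ'' ∧
    Isotopic Θ Θ''

/-- The set of handle slide equivalence classes of data of type `(n, m)`. -/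
def SqHS (n m : ℕ) : Type := Quot (@HandleSlideEquiv n m)

/-! ### The modules of morphisms -/

section

variable {K : Type u} [CommRing K]

/-- The basis vector of the free module on `SqHS n m` given by the class of `Θ`. -/
noncomputable def cls (K : Type u) [CommRing K] {n m : ℕ} (Θ : Sq n m) : SqHS n m →₀ K :=
  Finsupp.single (Quot.mk _ Θ) 1

/-- The relations deleting an internal separating component with factor `α`. -/
noncomputable def relA (α : K) (n m : ℕ) : Submodule K (SqHS n m →₀ K) :=
  Submodule.span K {x | ∃ (Θ Θ' : Sq n m) (Γ : Set (ℕ × ℕ)), Θ.1.IsInternalComponent Γ ∧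
    Θ.1.IsSeparating Γ ∧ IsDeletion Θ.1 Γ Θ'.1 ∧ x = cls K Θ - α • cls K Θ'}

/-- The relations deleting an internal twisted component with factor `β`. -/
noncomputable def relB (β : K) (n m : ℕ) : Submodule K (SqHS n m →₀ K) :=
  Submodule.span K {x | ∃ (Θ Θ' : Sq n m) (Γ : Set (ℕ × ℕ)), Θ.1.IsInternalComponent Γ ∧
    Θ.1.twist Γ = 1 ∧ IsDeletion Θ.1 Γ Θ'.1 ∧ x = cls K Θ - β • cls K Θ'}

/-- The relations deleting an internal non-separating untwisted component with factor `γ`. -/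
noncomputable def relC (γ : K) (n m : ℕ) : Submodule K (SqHS n m →₀ K) :=
  Submodule.span K {x | ∃ (Θ Θ' : Sq n m) (Γ : Set (ℕ × ℕ)), Θ.1.IsInternalComponent Γ ∧
    Θ.1.IsNonSeparating Γ ∧ Θ.1.twist Γ = 0 ∧ IsDeletion Θ.1 Γ Θ'.1 ∧
    x = cls K Θ - γ • cls K Θ'}

/-- The `K`-module of morphisms from `n` to `m`. -/
abbrev Hom (α β γ : K) (n m : ℕ) : Type u :=
  (SqHS n m →₀ K) ⧸ (relA α n m ⊔ relB β n m ⊔ relC γ n m)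

/-- The homogeneous morphism given by a square with bands datum. -/
noncomputable def bar (α β γ : K) {n m : ℕ} (Θ : Sq n m) : Hom α β γ n m :=
  Submodule.Quotient.mk (cls K Θ)

end

/-! ### Linear categories with prescribed modules of morphisms -/

/-- The structure of a `K`-linear category with set of objects `Ob` and modules of
morphisms `H a b`. -/
structure LinearCategoryOn (K : Type u) [CommRing K] {Ob : Type} (H : Ob → Ob → Type u)
    [∀ a b, AddCommGroup (H a b)] [∀ a b, Module K (H a b)] where
  id : ∀ a, H a a
  comp : ∀ {a b c}, H a b →ₗ[K] H b c →ₗ[K] H a c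
  id_comp : ∀ {a b} (x : H a b), comp (id a) x = x
  comp_id : ∀ {a b} (x : H a b), comp x (id b) = x
  assoc : ∀ {a b c d} (x : H a b) (y : H b c) (z : H c d),
    comp (comp x y) z = comp x (comp y z)

namespace LinearCategoryOn

variable {K : Type u} [CommRing K] {Ob : Type} {H : Ob → Ob → Type u}
  [hA : ∀ a b, AddCommGroup (H a b)] [hM : ∀ a b, Module K (H a b)]

/-- The objects of the category. -/
def Obj (_C : LinearCategoryOn K H) : Type := Ob

theorem add_comp (C : LinearCategoryOn K H) {a b c : Ob} (x x' : H a b) (y : H b c) :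
    C.comp (x + x') y = C.comp x y + C.comp x' y := by simp

theorem comp_add (C : LinearCategoryOn K H) {a b c : Ob} (x : H a b) (y y' : H b c) :
    C.comp x (y + y') = C.comp x y + C.comp x y' := by simp

theorem smul_comp (C : LinearCategoryOn K H) {a b c : Ob} (r : K) (x : H a b) (y : H b c) :
    C.comp (r • x) y = r • C.comp x y := by simp

theorem comp_smul (C : LinearCategoryOn K H) {a b c : Ob} (x : H a b) (r : K) (y : H b c) :
    C.comp x (r • y) = r • C.comp x y := by simp

/-- The category, in the sense of Mathlib. -/
instance (C : LinearCategoryOn K H) : CategoryTheory.Category.{u} C.Obj where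
  Hom a b := H a b
  id a := C.id a
  comp x y := C.comp x y
  id_comp x := C.id_comp x
  comp_id x := C.comp_id x
  assoc x y z := C.assoc x y z

instance (C : LinearCategoryOn K H) : CategoryTheory.Preadditive C.Obj where
  homGroup a b := hA a b
  add_comp _ _ _ x x' y := C.add_comp x x' y
  comp_add _ _ _ x y y' := C.comp_add x y y'

instance (C : LinearCategoryOn K H) : CategoryTheory.Linear K C.Obj where
  homModule a b := hM a b
  smul_comp _ _ _ r x y := C.smul_comp r x y
  comp_smul _ _ _ x r y := C.comp_smul x r y

end LinearCategoryOn

end SWB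

namespace SWB

/-! ### Joins of equivalence relations -/

section Setoid

variable {α β : Type*}

/-! Every pairing is replaced by the equivalence relation whose classes are its parts. Stacking two
squares becomes the join of two such relations (`stackS`). The juxtaposition is the pullback of this
join along the injection `re`, which skips the glued site (`isJuxtaposition_iff`). The linking
number is the number of classes of the join that consist of glued vertices (`linking_eq`), since
band edges never touch the glued site. Arguments about paths thus become identities for joins and
pullbacks, the basic one being `comap_sup`.

Existence of juxtapositions. A class of the join is a path or a cycle alternating between two
pairings. A parity count (`exists_other_end`) and an edge count (`ends_le_two`) show that a path has
exactly two ends, so the ends are paired. This pairing is crossingless by a computation modulo two: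
not crossing is the vanishing of a sum of four order comparisons (`not_crosses_iff`), and summed
over two whole paths these comparisons reduce to the crossings inside each square plus an even
number (`otherEnd_noncrossing`).

Category axioms. Both bracketings of a triple juxtaposition are pullbacks of one relation on three
stacked squares, and both sums of linking numbers count its classes inside the two glued sites
(`linking_assoc`), so the powers of `α` agree. The identity consists of parallel strands, which can
be absorbed without creating closed curves.

Composition is well defined. A linear map out of the module of morphisms is a function on data that
is unchanged by pull-throughs and handle slides and is scaled correctly by deletions (`Invariant`).
A move in the lower square is carried to the juxtaposition by extending its order preserving
bijection by the identity above the lower square (`Transport`). Handle slides and deletions persist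
with the same linking number, and internal components keep their type (`exists_restriction_juxt`,
`Datum.twist_juxt`). The delicate case is a pull-through (`IsPullThrough.juxt`): the image of the
turn-back may become an arc only after gluing. The pull-through is then not available in the
juxtaposition. Instead its four vertices form a closed component bounding an annulus, which is
separating. The new juxtaposition is the deletion of this component, while one more closed curve
appears on the glued edge. The factor `α` from the deletion matches the extra power of `α`; this is
why loops lost in gluing are weighted by `α`.

Moves in the upper square need no separate treatment. Reversing the order exchanges the two squares
(`stackS_dual`) and respects every move and every type of component, so the duality exists on
morphisms and invariance in the upper argument follows from invariance in the lower one
(`barComp_invariant_right`). -/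

theorem sup_rel_induction {R S : Setoid α} {P : α → Prop} {x z : α} (h : (R ⊔ S) x z) (hx : P x)
    (hR : ∀ y z, R y z → P y → P z) (hS : ∀ y z, S y z → P y → P z) : P z := by
  have key : R ⊔ S ≤ Setoid.ker P := by
    -- Agreement of truth values of `P` is an equivalence relation; it contains `R` and `S`, hence
    -- their join.
    refine sup_le (fun y z h => ?_) (fun y z h => ?_)
    · exact propext ⟨hR y z h, hR z y (R.symm' h)⟩
    · exact propext ⟨hS y z h, hS z y (S.symm' h)⟩
  have : P x = P z := key h
  exact this ▸ hx

theorem sup_left {R S : Setoid α} {x y : α} (h : R x y) : (R ⊔ S) x y :=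
  (le_sup_left : R ≤ R ⊔ S) h

theorem sup_right {R S : Setoid α} {x y : α} (h : S x y) : (R ⊔ S) x y :=
  (le_sup_right : S ≤ R ⊔ S) h

/-- The set of points whose class is not a singleton. -/
def supp (R : Setoid α) : Set α := {z | ∃ y, R z y ∧ y ≠ z}

theorem eq_of_notMem_supp {R : Setoid α} {x y : α} (h : R x y) (hx : x ∉ supp R) : y = x := by
  by_contra hne
  exact hx ⟨y, h, hne⟩

theorem mem_supp_left {R : Setoid α} {x y : α} (h : R x y) (hne : x ≠ y) : x ∈ supp R :=
  ⟨y, h, hne.symm⟩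

theorem mem_supp_right {R : Setoid α} {x y : α} (h : R x y) (hne : x ≠ y) : y ∈ supp R :=
  ⟨x, R.symm' h, hne⟩

theorem supp_sup_subset (R S : Setoid α) : supp (R ⊔ S) ⊆ supp R ∪ supp S := by
  rintro z ⟨y, h, hne⟩
  by_contra hz
  simp only [Set.mem_union, not_or] at hz
  refine hne (sup_rel_induction (P := fun y => y = z) h rfl ?_ ?_)
  · rintro a b hab rfl
    exact eq_of_notMem_supp hab hz.1
  · rintro a b hab rfl
    exact eq_of_notMem_supp hab hz.2

/-- A chain of `R`- and `S`-steps between points of the range may leave the range. Once consecutive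
steps of the same relation are merged, every intermediate point is moved by both relations and so
lies in the range. Injectivity of `φ` plays no role. -/
theorem comap_sup (φ : β → α) (R S : Setoid α) (h : supp R ∩ supp S ⊆ Set.range φ) :
    Setoid.comap φ (R ⊔ S) = Setoid.comap φ R ⊔ Setoid.comap φ S := by
  apply le_antisymm
  · intro x y hxy
    set T := Setoid.comap φ R ⊔ Setoid.comap φ S with hT
    -- The induction remembers a point `a` already reached within the range and one pending step
    -- from it, tagged by the relation it belongs to.
    have key : (∃ a, T x a ∧ R (φ a) (φ y)) ∨ (∃ a, T x a ∧ S (φ a) (φ y)) := by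
      refine sup_rel_induction
        (P := fun z => (∃ a, T x a ∧ R (φ a) z) ∨ (∃ a, T x a ∧ S (φ a) z)) hxy
        (Or.inl ⟨x, T.refl' _, R.refl' _⟩) ?_ ?_
      · rintro z w hzw (⟨a, hxa, ha⟩ | ⟨a, hxa, ha⟩)
        · exact Or.inl ⟨a, hxa, R.trans' ha hzw⟩
        · by_cases h1 : z = w
          · exact Or.inr ⟨a, hxa, h1 ▸ ha⟩
          by_cases h2 : φ a = z
          · exact Or.inl ⟨a, hxa, h2 ▸ hzw⟩
          obtain ⟨c, rfl⟩ := h ⟨mem_supp_left hzw h1, mem_supp_right ha h2⟩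
          exact Or.inl ⟨c, T.trans' hxa (sup_right ha), hzw⟩
      · rintro z w hzw (⟨a, hxa, ha⟩ | ⟨a, hxa, ha⟩)
        · by_cases h1 : z = w
          · exact Or.inl ⟨a, hxa, h1 ▸ ha⟩
          by_cases h2 : φ a = z
          · exact Or.inr ⟨a, hxa, h2 ▸ hzw⟩
          obtain ⟨c, rfl⟩ := h ⟨mem_supp_right ha h2, mem_supp_left hzw h1⟩
          exact Or.inr ⟨c, T.trans' hxa (sup_left ha), hzw⟩
        · exact Or.inr ⟨a, hxa, S.trans' ha hzw⟩
    rcases key with ⟨a, hxa, ha⟩ | ⟨a, hxa, ha⟩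
    · exact T.trans' hxa (sup_left ha)
    · exact T.trans' hxa (sup_right ha)
  · refine sup_le (fun x y h => ?_) (fun x y h => ?_)
    · exact sup_left (S := S) (show R (φ x) (φ y) from h)
    · exact sup_right (R := R) (show S (φ x) (φ y) from h)

/-! ### Counting classes -/

/-- The number of classes of `S` contained in `W`. -/
noncomputable def loops (S : Setoid α) (W : Set α) : ℕ :=
  {C : Set α | ∃ v ∈ W, C = {w | S v w} ∧ C ⊆ W}.ncard

theorem finite_classes (S : Setoid α) {W : Set α} (hW : W.Finite) :
    {C : Set α | ∃ v ∈ W, C = {w | S v w} ∧ C ⊆ W}.Finite :=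
  (hW.image fun v => {w | S v w}).subset (by rintro _ ⟨v, hv, rfl, -⟩; exact ⟨v, hv, rfl⟩)

theorem class_eq {S : Setoid α} {v w : α} (h : S v w) : {x | S v x} = {x | S w x} := by
  ext x
  exact ⟨fun hx => S.trans' (S.symm' h) hx, fun hx => S.trans' h hx⟩

/-- Classes inside the union are sorted by whether they meet `φ '' W₂`. Those that do not are inside
`W₁`. The others correspond under preimage to classes of the pulled back relation, because they
leave the range only into `W₁`. This is what makes linking numbers of successive gluings additive.
-/
theorem loops_add (φ : β → α) (hφ : Function.Injective φ) (S : Setoid α) (W₁ : Set α) (W₂ : Set β)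
    (h₁ : W₁.Finite) (h₂ : W₂.Finite) (hd : Disjoint W₁ (Set.range φ))
    (h : ∀ v ∈ W₂, ∀ w, S (φ v) w → w ∈ W₁ ∨ w ∈ Set.range φ) :
    loops S W₁ + loops (Setoid.comap φ S) W₂ = loops S (W₁ ∪ φ '' W₂) := by
  have e : {C : Set α | ∃ v ∈ W₁ ∪ φ '' W₂, C = {w | S v w} ∧ C ⊆ W₁ ∪ φ '' W₂} =
      {C : Set α | ∃ v ∈ W₁, C = {w | S v w} ∧ C ⊆ W₁} ∪
      {C : Set α | ∃ v ∈ W₂, C = {w | S (φ v) w} ∧ C ⊆ W₁ ∪ φ '' W₂} := by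
    ext C
    constructor
    · rintro ⟨v, hv, rfl, hC⟩
      by_cases hh : ∃ u ∈ W₂, S v (φ u)
      · obtain ⟨u, hu, huv⟩ := hh
        exact Or.inr ⟨u, hu, class_eq huv, hC⟩
      · have hsub : {w | S v w} ⊆ W₁ := by
          intro w hw
          rcases hC hw with h' | ⟨u, hu, rfl⟩
          · exact h'
          · exact absurd ⟨u, hu, hw⟩ hh
        exact Or.inl ⟨v, hsub (S.refl' v), rfl, hsub⟩
    · rintro (⟨v, hv, rfl, hC⟩ | ⟨v, hv, rfl, hC⟩)
      · exact ⟨v, Or.inl hv, rfl, fun w hw => Or.inl (hC hw)⟩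
      · exact ⟨φ v, Or.inr ⟨v, hv, rfl⟩, rfl, hC⟩
  have hdisj : Disjoint {C : Set α | ∃ v ∈ W₁, C = {w | S v w} ∧ C ⊆ W₁}
      {C : Set α | ∃ v ∈ W₂, C = {w | S (φ v) w} ∧ C ⊆ W₁ ∪ φ '' W₂} := by
    rw [Set.disjoint_left]
    rintro C ⟨v, -, -, hC⟩ ⟨u, -, rfl, -⟩
    exact Set.disjoint_left.1 hd (hC (S.refl' (φ u))) ⟨u, rfl⟩
  have hfin : {C : Set α | ∃ v ∈ W₂, C = {w | S (φ v) w} ∧ C ⊆ W₁ ∪ φ '' W₂}.Finite :=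
    (h₂.image fun v => {w | S (φ v) w}).subset (by rintro _ ⟨v, hv, rfl, -⟩; exact ⟨v, hv, rfl⟩)
  unfold loops
  rw [e, Set.ncard_union_eq hdisj (finite_classes S h₁) hfin]
  congr 1
  have hinj : Set.InjOn (fun C : Set α => φ ⁻¹' C)
      {C : Set α | ∃ v ∈ W₂, C = {w | S (φ v) w} ∧ C ⊆ W₁ ∪ φ '' W₂} := by
    rintro _ ⟨v, -, rfl, -⟩ _ ⟨u, -, rfl, -⟩ huv
    have : v ∈ φ ⁻¹' {w | S (φ u) w} := by
      rw [← show φ ⁻¹' {w | S (φ v) w} = φ ⁻¹' {w | S (φ u) w} from huv]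
      exact S.refl' _
    exact (class_eq this).symm
  rw [← hinj.ncard_image]
  congr 1
  ext D
  constructor
  · rintro ⟨v, hv, rfl, hD⟩
    refine ⟨{w | S (φ v) w}, ⟨v, hv, rfl, fun w hw => ?_⟩, rfl⟩
    rcases h v hv w hw with h' | ⟨u, rfl⟩
    · exact Or.inl h'
    · exact Or.inr ⟨u, hD hw, rfl⟩
  · rintro ⟨_, ⟨v, hv, rfl, hC⟩, rfl⟩
    refine ⟨v, hv, rfl, fun u hu => ?_⟩
    rcases hC hu with h' | ⟨u', hu', he⟩
    · exact absurd ⟨u, rfl⟩ (Set.disjoint_left.1 hd h')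
    · exact hφ he ▸ hu'

theorem loops_comap (φ : β → α) (hφ : Function.Injective φ) (S : Setoid α) (W : Set β)
    (hW : W.Finite) (h : ∀ v ∈ W, ∀ w, S (φ v) w → w ∈ Set.range φ) :
    loops (Setoid.comap φ S) W = loops S (φ '' W) := by
  have := loops_add φ hφ S ∅ W Set.finite_empty hW (Set.empty_disjoint _)
    (fun v hv w hw => Or.inr (h v hv w hw))
  rw [Set.empty_union] at this
  rw [← this]
  simp [loops]

/-- `T` moves no point of `W`, so it cannot enlarge a class that stays in `W`. -/
theorem loops_sup (S T : Setoid α) (W : Set α) (h : Disjoint (supp T) W) :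
    loops (S ⊔ T) W = loops S W := by
  have key : ∀ v, {w | S v w} ⊆ W → {w | (S ⊔ T) v w} = {w | S v w} := by
    intro v hv
    ext w
    refine ⟨fun hw => ?_, fun hw => sup_left hw⟩
    refine sup_rel_induction (P := fun w => S v w) hw (S.refl' v) ?_ ?_
    · exact fun y z h1 h2 => S.trans' h2 h1
    · intro y z h1 h2
      have := eq_of_notMem_supp h1 (fun hy => Set.disjoint_left.1 h hy (hv h2))
      exact this ▸ h2
  unfold loops
  congr 1
  ext C
  constructor
  · rintro ⟨v, hv, rfl, hC⟩
    have hs : {w | S v w} ⊆ W := fun w hw => hC (sup_left hw)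
    rw [key v hs] at hC ⊢
    exact ⟨v, hv, rfl, hC⟩
  · rintro ⟨v, hv, rfl, hC⟩
    exact ⟨v, hv, (key v hC).symm, hC⟩

/-! ### Joins of two pairings -/

/-- The equivalence relation with classes `{v, E v}`. -/
@[reducible] def invS (E : α → α) (hE : Function.Involutive E) : Setoid α where
  r u v := u = v ∨ E u = v
  iseqv := ⟨fun _ => Or.inl rfl, by
    rintro u v (rfl | rfl)
    · exact Or.inl rfl
    · exact Or.inr (hE u), by
    rintro u v w (rfl | rfl) (rfl | rfl)
    · exact Or.inl rfl
    · exact Or.inr rfl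
    · exact Or.inr rfl
    · exact Or.inl (hE u).symm⟩

theorem invS_iff {E : α → α} {hE : Function.Involutive E} {u v : α} :
    invS E hE u v ↔ u = v ∨ E u = v := Iff.rfl

theorem supp_invS (E : α → α) (hE : Function.Involutive E) : supp (invS E hE) = {v | E v ≠ v} := by
  ext v
  constructor
  · rintro ⟨y, rfl | rfl, hne⟩
    · exact absurd rfl hne
    · exact hne
  · exact fun h => ⟨E v, Or.inr rfl, h⟩

theorem even_card_of_involution (E : α → α) (hE : Function.Involutive E) (s : Finset α)
    (h : ∀ v ∈ s, E v ∈ s) (hne : ∀ v ∈ s, E v ≠ v) : ((s.card : ℕ) : ZMod 2) = 0 := by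
  have : ∑ _v ∈ s, (1 : ZMod 2) = 0 :=
    Finset.sum_involution (fun v _ => E v) (fun _ _ => by decide) (fun v hv _ => hne v hv)
      h (fun v _ => hE v)
  simpa using this

variable {E₁ E₂ : α → α} (h₁ : Function.Involutive E₁) (h₂ : Function.Involutive E₂)

-- A parity argument. Were `x` the only point of its class fixed by either involution, one
-- involution would act freely on the class and the other on the class without `x`, so the class
-- would have both even and odd size.
include h₁ h₂ in
theorem exists_other_end {x : α} (hfin : {w | (invS E₁ h₁ ⊔ invS E₂ h₂) x w}.Finite)
    (hx : (E₁ x = x) ≠ (E₂ x = x)) :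
    ∃ y, y ≠ x ∧ (invS E₁ h₁ ⊔ invS E₂ h₂) x y ∧ (E₁ y = y ∨ E₂ y = y) := by
  classical
  by_contra hcon
  push Not at hcon
  set R := invS E₁ h₁ ⊔ invS E₂ h₂ with hR
  set C := hfin.toFinset
  have hC : ∀ w, w ∈ C ↔ R x w := fun w => by simp [C]
  have c1 : ∀ v, R x v → R x (E₁ v) := fun v hv => R.trans' hv (sup_left (Or.inr rfl))
  have c2 : ∀ v, R x v → R x (E₂ v) := fun v hv => R.trans' hv (sup_right (Or.inr rfl))
  have e1 := even_card_of_involution E₁ h₁ (C.filter fun v => E₁ v ≠ v)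
    (fun v hv => by
      simp only [Finset.mem_filter, hC] at hv ⊢
      exact ⟨c1 v hv.1, fun h => hv.2 (by rw [h₁ v] at h; exact h.symm)⟩)
    (fun v hv => (Finset.mem_filter.1 hv).2)
  have e2 := even_card_of_involution E₂ h₂ (C.filter fun v => E₂ v ≠ v)
    (fun v hv => by
      simp only [Finset.mem_filter, hC] at hv ⊢
      exact ⟨c2 v hv.1, fun h => hv.2 (by rw [h₂ v] at h; exact h.symm)⟩)
    (fun v hv => (Finset.mem_filter.1 hv).2)
  have hxC : x ∈ C := (hC x).2 (R.refl' x)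
  have hcard : ((C.card : ℕ) : ZMod 2) = (((C.erase x).card + 1 : ℕ) : ZMod 2) := by
    rw [Finset.card_erase_add_one hxC]
  by_cases hx1 : E₁ x = x
  · have hx2 : E₂ x ≠ x := by
      intro h
      simp [hx1, h] at hx
    have f1 : (C.filter fun v => E₁ v ≠ v) = C.erase x := by
      ext v
      simp only [Finset.mem_filter, Finset.mem_erase, hC]
      exact ⟨fun h => ⟨fun hv => h.2 (hv ▸ hx1), h.1⟩, fun h => ⟨h.2, (hcon v h.1 h.2).1⟩⟩
    have f2 : (C.filter fun v => E₂ v ≠ v) = C := by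
      refine Finset.filter_true_of_mem fun v hv => ?_
      by_cases hvx : v = x
      · exact hvx ▸ hx2
      · exact (hcon v hvx ((hC v).1 hv)).2
    rw [f1] at e1
    rw [f2] at e2
    rw [e2, Nat.cast_add, e1] at hcard
    exact absurd hcard (by decide)
  · have hx2 : E₂ x = x := by
      by_contra h
      simp [hx1, h] at hx
    have f1 : (C.filter fun v => E₂ v ≠ v) = C.erase x := by
      ext v
      simp only [Finset.mem_filter, Finset.mem_erase, hC]
      exact ⟨fun h => ⟨fun hv => h.2 (hv ▸ hx2), h.1⟩, fun h => ⟨h.2, (hcon v h.1 h.2).2⟩⟩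
    have f2 : (C.filter fun v => E₁ v ≠ v) = C := by
      refine Finset.filter_true_of_mem fun v hv => ?_
      by_cases hvx : v = x
      · exact hvx ▸ hx1
      · exact (hcon v hvx ((hC v).1 hv)).1
    rw [f1] at e2
    rw [f2] at e1
    rw [e1, Nat.cast_add, e2] at hcard
    exact absurd hcard (by decide)

-- An Euler characteristic count. The class carries a connected graph, so with `n` vertices it has
-- at least `n - 1` edges. Vertices have degree at most two, and those fixed by one of the
-- involutions at most one, so the degree sum leaves room for at most two ends.
include h₁ h₂ in
theorem ends_le_two {x y z : α} (hfin : {w | (invS E₁ h₁ ⊔ invS E₂ h₂) x w}.Finite)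
    (hxy : x ≠ y) (hxz : x ≠ z) (hyz : y ≠ z) (hx : E₁ x = x ∨ E₂ x = x)
    (hy : E₁ y = y ∨ E₂ y = y) (hz : E₁ z = z ∨ E₂ z = z)
    (ry : (invS E₁ h₁ ⊔ invS E₂ h₂) x y) (rz : (invS E₁ h₁ ⊔ invS E₂ h₂) x z) : False := by
  classical
  set R := invS E₁ h₁ ⊔ invS E₂ h₂ with hR
  let C : Set α := {w | R x w}
  have : Fintype C := hfin.fintype
  have c1 : ∀ v, R x v → R x (E₁ v) := fun v hv => R.trans' hv (sup_left (Or.inr rfl))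
  have c2 : ∀ v, R x v → R x (E₂ v) := fun v hv => R.trans' hv (sup_right (Or.inr rfl))
  let G : SimpleGraph C := SimpleGraph.fromRel fun u v => E₁ u.1 = v.1 ∨ E₂ u.1 = v.1
  have hadj : ∀ u v : C, G.Adj u v → v.1 ≠ u.1 ∧ (v.1 = E₁ u.1 ∨ v.1 = E₂ u.1) := by
    intro u v h
    rw [SimpleGraph.fromRel_adj] at h
    refine ⟨fun e => h.1 (Subtype.ext e.symm), ?_⟩
    rcases h.2 with (h | h) | (h | h)
    · exact Or.inl h.symm
    · exact Or.inr h.symm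
    · left; rw [← h, h₁]
    · right; rw [← h, h₂]
  have hconn : G.Connected := by
    have hbase : ∀ w : α, R x w → ∀ hw : w ∈ C, G.Reachable ⟨x, R.refl' x⟩ ⟨w, hw⟩ := by
      intro w hw
      have := sup_rel_induction (P := fun w => ∃ hw : w ∈ C, G.Reachable ⟨x, R.refl' x⟩ ⟨w, hw⟩)
        hw ⟨R.refl' x, SimpleGraph.Reachable.refl _⟩ ?_ ?_
      · exact fun _ => this.2
      · rintro u v huv ⟨hu, hr⟩
        refine ⟨R.trans' hu (sup_left huv), ?_⟩
        rcases huv with rfl | rfl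
        · exact hr
        · by_cases he : E₁ u = u
          · convert hr
          · exact hr.trans (SimpleGraph.Adj.reachable (by
              rw [SimpleGraph.fromRel_adj]
              exact ⟨fun e => he (congrArg Subtype.val e).symm, Or.inl (Or.inl rfl)⟩))
      · rintro u v huv ⟨hu, hr⟩
        refine ⟨R.trans' hu (sup_right huv), ?_⟩
        rcases huv with rfl | rfl
        · exact hr
        · by_cases he : E₂ u = u
          · convert hr
          · exact hr.trans (SimpleGraph.Adj.reachable (by
              rw [SimpleGraph.fromRel_adj]
              exact ⟨fun e => he (congrArg Subtype.val e).symm, Or.inl (Or.inr rfl)⟩))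
    have : Nonempty C := ⟨⟨x, R.refl' x⟩⟩
    exact ⟨fun u v => (hbase u.1 u.2 u.2).symm.trans (hbase v.1 v.2 v.2)⟩
  have h1 := hconn.card_vert_le_card_edgeSet_add_one
  have h2 := G.sum_degrees_eq_twice_card_edges
  have hdeg : ∀ v : C, G.degree v + (if E₁ v.1 = v.1 ∨ E₂ v.1 = v.1 then 1 else 0) ≤ 2 := by
    intro v
    rw [← SimpleGraph.card_neighborFinset_eq_degree]
    split_ifs with hv
    · have : G.neighborFinset v ⊆ ({⟨if E₁ v.1 = v.1 then E₂ v.1 else E₁ v.1, by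
          split_ifs
          · exact c2 _ v.2
          · exact c1 _ v.2⟩} : Finset C) := by
        intro w hw
        have hw' := hadj v w ((G.mem_neighborFinset v w).1 hw)
        rw [Finset.mem_singleton]
        apply Subtype.ext
        split_ifs with he
        · rcases hw'.2 with h | h
          · exact absurd (h.trans he) hw'.1
          · exact h
        · rcases hw'.2 with h | h
          · exact h
          · exact absurd (h.trans (hv.resolve_left he)) hw'.1
      have := Finset.card_le_card this
      rw [Finset.card_singleton] at this
      omega
    · have : G.neighborFinset v ⊆ ({⟨E₁ v.1, c1 _ v.2⟩, ⟨E₂ v.1, c2 _ v.2⟩} : Finset C) := by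
        intro w hw
        have hw' := hadj v w ((G.mem_neighborFinset v w).1 hw)
        rw [Finset.mem_insert, Finset.mem_singleton]
        exact hw'.2.imp (fun h => Subtype.ext h) (fun h => Subtype.ext h)
      have := (Finset.card_le_card this).trans Finset.card_le_two
      omega
  have hsum : ∑ v : C, (G.degree v + (if E₁ v.1 = v.1 ∨ E₂ v.1 = v.1 then 1 else 0)) ≤
      ∑ _v : C, 2 := Finset.sum_le_sum fun v _ => hdeg v
  rw [Finset.sum_add_distrib, h2] at hsum
  have hends : 3 ≤ ∑ v : C, (if E₁ v.1 = v.1 ∨ E₂ v.1 = v.1 then 1 else 0) := by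
    rw [← Finset.card_filter]
    have hsub : ({⟨x, R.refl' x⟩, ⟨y, ry⟩, ⟨z, rz⟩} : Finset C) ⊆
        Finset.univ.filter fun v : C => E₁ v.1 = v.1 ∨ E₂ v.1 = v.1 := by
      intro w hw
      simp only [Finset.mem_insert, Finset.mem_singleton] at hw
      simp only [Finset.mem_filter, Finset.mem_univ, true_and]
      rcases hw with rfl | rfl | rfl
      · exact hx
      · exact hy
      · exact hz
    have := Finset.card_le_card hsub
    rw [Finset.card_eq_three.2 ⟨_, _, _, ?_, ?_, ?_, rfl⟩] at this
    · exact this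
    · exact fun e => hxy (congrArg Subtype.val e)
    · exact fun e => hxz (congrArg Subtype.val e)
    · exact fun e => hyz (congrArg Subtype.val e)
  simp only [Finset.sum_const, Finset.card_univ, smul_eq_mul] at hsum
  rw [Nat.card_eq_fintype_card, Nat.card_eq_fintype_card, ← SimpleGraph.edgeFinset_card] at h1
  omega

end Setoid

end SWB

namespace SWB

/-! ### Basic properties of data -/

theorem ChordDatum.ext' {c d : ChordDatum} (hN : c.N = d.N) (hP : ∀ i, c.P i = d.P i)
    (hs : ∀ i, c.s i = d.s i) : c = d := by
  obtain ⟨N, P, s, _, _, _, _⟩ := c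
  obtain ⟨N', P', s', _, _, _, _⟩ := d
  obtain rfl : N = N' := hN
  obtain rfl : P = P' := funext hP
  obtain rfl : s = s' := funext hs
  rfl

theorem Datum.ext' {Θ Θ' : Datum} (hN : Θ.N = Θ'.N) (hP : ∀ i, Θ.P i = Θ'.P i)
    (hs : ∀ i, Θ.s i = Θ'.s i) (hf : ∀ i, Θ.f i = Θ'.f i) (hE : ∀ v, Θ.E v = Θ'.E v) :
    Θ = Θ' := by
  obtain ⟨⟨c, f, _, _, _⟩, E, _, _, _⟩ := Θ
  obtain ⟨⟨c', f', _, _, _⟩, E', _, _, _⟩ := Θ'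
  obtain rfl : c = c' := ChordDatum.ext' hN hP hs
  obtain rfl : f = f' := funext hf
  obtain rfl : E = E' := funext hE
  rfl

theorem ChordDatum.P_out (c : ChordDatum) {i : ℕ} (h : ¬(1 ≤ i ∧ i ≤ 2 * c.N)) : c.P i = i := by
  by_contra hne
  exact h ((c.P_ne i).1 hne)

theorem ChordDatum.P_mem (c : ChordDatum) {i : ℕ} (h : 1 ≤ i ∧ i ≤ 2 * c.N) :
    1 ≤ c.P i ∧ c.P i ≤ 2 * c.N := by
  rw [← c.P_ne, c.P_P]
  exact fun e => (c.P_ne i).2 h e.symm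

theorem ChordDatum.P_inj (c : ChordDatum) {i j : ℕ} : c.P i = c.P j ↔ i = j :=
  ⟨fun h => by rw [← c.P_P i, h, c.P_P], fun h => h ▸ rfl⟩

theorem Frame.mem_V {F : Frame} {v : ℕ × ℕ} : v ∈ F.V ↔ 1 ≤ v.2 ∧ v.2 ≤ F.f v.1 := Iff.rfl

theorem Frame.site_le {F : Frame} {v : ℕ × ℕ} (h : v ∈ F.V) : v.1 ≤ 2 * F.N + 1 := by
  by_contra hlt
  have := F.f_out v.1 (by omega)
  rw [Frame.mem_V, this] at h
  omega

theorem Frame.V_finite (F : Frame) : F.V.Finite := by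
  refine Set.Finite.subset (((Finset.range (2 * F.N + 2)).biUnion fun i =>
    (Finset.Icc 1 (F.f i)).image fun a => (i, a)).finite_toSet) fun v hv => ?_
  simp only [Finset.coe_biUnion, Set.mem_iUnion, Finset.mem_coe, Finset.mem_range,
    Finset.mem_image, Finset.mem_Icc]
  exact ⟨v.1, Nat.lt_succ_of_le (Frame.site_le hv), v.2, hv, rfl⟩

theorem Datum.E_mem {Θ : Datum} {v : ℕ × ℕ} (h : v ∈ Θ.V) : Θ.E v ∈ Θ.V := by
  rw [← Θ.E_ne, Θ.E_E]
  exact fun e => (Θ.E_ne v).2 h e.symm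

theorem Datum.E_out {Θ : Datum} {v : ℕ × ℕ} (h : v ∉ Θ.V) : Θ.E v = v := by
  by_contra hne
  exact h ((Θ.E_ne v).1 hne)

theorem Datum.E_inj {Θ : Datum} {u v : ℕ × ℕ} : Θ.E u = Θ.E v ↔ u = v :=
  ⟨fun h => by rw [← Θ.E_E u, h, Θ.E_E], fun h => h ▸ rfl⟩

theorem Datum.E_eq_comm {Θ : Datum} {u v : ℕ × ℕ} : Θ.E u = v ↔ Θ.E v = u :=
  ⟨fun h => by rw [← h, Θ.E_E], fun h => by rw [← h, Θ.E_E]⟩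

theorem Frame.iota_mem {F : Frame} {v : ℕ × ℕ} (h : v ∈ F.V) : F.iota v ∈ F.V := by
  rw [Frame.mem_V] at h ⊢
  simp only [Frame.iota, F.f_P]
  split_ifs <;> omega

theorem Frame.iota_internal {F : Frame} {v : ℕ × ℕ} (h : F.Internal v) : F.Internal (F.iota v) :=
  F.P_mem h

theorem Frame.iota_iota {F : Frame} {v : ℕ × ℕ} (h : v ∈ F.V) : F.iota (F.iota v) = v := by
  rw [Frame.mem_V] at h
  simp only [Frame.iota, F.P_P, F.s_P, F.f_P]
  split_ifs
  · exact Prod.ext rfl (by simp; omega)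
  · rfl

theorem Frame.iota_fst (F : Frame) (v : ℕ × ℕ) : (F.iota v).1 = F.P v.1 := rfl

theorem Frame.iota_site_ne {F : Frame} {v : ℕ × ℕ} (h : F.Internal v) : (F.iota v).1 ≠ v.1 :=
  (F.P_ne _).2 h

/-! ### The order of the vertices -/

theorem key_lt_iff {N : ℕ} {u v : ℕ × ℕ} :
    key N u < key N v ↔ u.1 < v.1 ∨ (u.1 = v.1 ∧ if u.1 ≤ 2 * N then u.2 < v.2 else v.2 < u.2) := by
  unfold key
  rw [Prod.Lex.toLex_lt_toLex]
  refine or_congr_right (and_congr_right fun h => ?_)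
  simp only at h
  rw [← h]
  split_ifs <;> simp

theorem key_injective (N : ℕ) : Function.Injective (key N) := by
  intro u v h
  have h' := toLex.injective h
  simp only [Prod.mk.injEq] at h'
  refine Prod.ext h'.1 ?_
  have h2 := h'.2
  rw [h'.1] at h2
  split_ifs at h2 <;> omega

theorem key_eq_of_le {N N' : ℕ} {v : ℕ × ℕ} (h : v.1 ≤ 2 * N) (h' : v.1 ≤ 2 * N') :
    key N v = key N' v := by
  simp [key, h, h']

/-- In `W'` there are as many points above `o t` as above `t`: `o` carries the points of `W` above
`t` onto those of `W'` above `o t`, and above `t` the sets `W` and `W'` coincide. In a finite chain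
this count determines the point. -/
theorem fixed_of_mono {α L : Type*} [LinearOrder L] {κ : α → L} (hκ : Function.Injective κ)
    {W W' T : Set α} {o : α → α} (hW : W.Finite) (ho : Set.BijOn o W W')
    (hm : ∀ u ∈ W, ∀ v ∈ W, κ u < κ v → κ (o u) < κ (o v)) (hT : T ⊆ W) (hT' : T ⊆ W')
    (hu : ∀ t ∈ T, ∀ u ∈ W, κ t < κ u → u ∈ T) (hu' : ∀ t ∈ T, ∀ u ∈ W', κ t < κ u → u ∈ T) :
    ∀ t ∈ T, o t = t := by
  intro t ht
  have hW' : W'.Finite := ho.image_eq ▸ hW.image o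
  have e1 : o '' {u | u ∈ W ∧ κ t < κ u} = {u | u ∈ W' ∧ κ (o t) < κ u} := by
    ext u
    constructor
    · rintro ⟨w, ⟨hw, hlt⟩, rfl⟩
      exact ⟨ho.mapsTo hw, hm t (hT ht) w hw hlt⟩
    · rintro ⟨hw, hlt⟩
      obtain ⟨w, hw', rfl⟩ := ho.surjOn hw
      refine ⟨w, ⟨hw', ?_⟩, rfl⟩
      rcases lt_trichotomy (κ t) (κ w) with h | h | h
      · exact h
      · exact absurd (hκ h ▸ hlt) (lt_irrefl _)
      · exact absurd hlt (not_lt.2 (hm w hw' t (hT ht) h).le)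
  have e2 : {u | u ∈ W ∧ κ t < κ u} = {u | u ∈ W' ∧ κ t < κ u} := by
    ext u
    exact ⟨fun h => ⟨hT' (hu t ht u h.1 h.2), h.2⟩, fun h => ⟨hT (hu' t ht u h.1 h.2), h.2⟩⟩
  have e3 : {u | u ∈ W' ∧ κ (o t) < κ u}.ncard = {u | u ∈ W' ∧ κ t < κ u}.ncard := by
    rw [← e1, ← e2, (ho.injOn.mono (fun u h => h.1)).ncard_image]
  have fin : ∀ x, {u | u ∈ W' ∧ x < κ u}.Finite := fun x => hW'.subset fun u h => h.1
  rcases lt_trichotomy (κ (o t)) (κ t) with h | h | h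
  · refine absurd (Set.ncard_lt_ncard ?_ (fin (κ (o t)))) e3.not_gt
    exact ⟨fun u hu => ⟨hu.1, h.trans hu.2⟩, fun hs => lt_irrefl _ (hs ⟨hT' ht, h⟩).2⟩
  · exact hκ h
  · refine absurd (Set.ncard_lt_ncard ?_ (fin (κ t))) e3.symm.not_gt
    exact ⟨fun u hu => ⟨hu.1, h.trans hu.2⟩,
      fun hs => lt_irrefl _ (hs ⟨ho.mapsTo (hT ht), h⟩).2⟩

/-- An order preserving bijection fixes a common final segment. -/
theorem IsOP.fixed {N : ℕ} {W W' T : Set (ℕ × ℕ)} {o : ℕ × ℕ → ℕ × ℕ} (h : IsOP N W W' o)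
    (hW : W.Finite) (hT : T ⊆ W) (hT' : T ⊆ W')
    (hu : ∀ t ∈ T, ∀ u ∈ W, key N t < key N u → u ∈ T)
    (hu' : ∀ t ∈ T, ∀ u ∈ W', key N t < key N u → u ∈ T) : ∀ t ∈ T, o t = t :=
  fixed_of_mono (key_injective N) hW h.1 h.2 hT hT' hu hu'

/-- An order preserving bijection which does not change the vertices on the top edge fixes them,
and preserves the set of the other vertices. -/
theorem IsOP.top {N : ℕ} {W W' : Set (ℕ × ℕ)} {o : ℕ × ℕ → ℕ × ℕ} (h : IsOP N W W' o)
    (hW : W.Finite) (hs : ∀ v ∈ W, v.1 ≤ 2 * N + 1) (hs' : ∀ v ∈ W', v.1 ≤ 2 * N + 1)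
    (ht : ∀ a, (2 * N + 1, a) ∈ W ↔ (2 * N + 1, a) ∈ W') :
    (∀ v ∈ W, v.1 = 2 * N + 1 → o v = v) ∧ ∀ v ∈ W, v.1 ≤ 2 * N → (o v).1 ≤ 2 * N := by
  have hT : ∀ t ∈ {v | v ∈ W ∧ v.1 = 2 * N + 1}, o t = t := by
    refine h.fixed hW (fun v hv => hv.1) (fun v hv => ?_) (fun t ht' u hu hlt => ⟨hu, ?_⟩)
      (fun t ht' u hu hlt => ?_)
    · have := (ht v.2).1 (by rw [← hv.2]; exact hv.1)
      rw [← hv.2] at this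
      exact this
    · have := hs u hu
      have := ht'.2
      rw [key_lt_iff] at hlt
      omega
    · have h1 : u.1 = 2 * N + 1 := by
        have := hs' u hu
        have := ht'.2
        rw [key_lt_iff] at hlt
        omega
      refine ⟨?_, h1⟩
      have := (ht u.2).2 (by rw [← h1]; exact hu)
      rw [← h1] at this
      exact this
  refine ⟨fun v hv h1 => hT v ⟨hv, h1⟩, fun v hv h1 => ?_⟩
  by_contra hgt
  have hmem := h.1.mapsTo hv
  have e : (o v).1 = 2 * N + 1 := by
    have := hs' _ hmem
    omega
  have hW2 : o v ∈ W := by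
    have := (ht (o v).2).2 (by rw [← e]; exact hmem)
    rwa [← e] at this
  have := h.1.injOn hW2 hv (hT (o v) ⟨hW2, e⟩)
  rw [this] at e
  omega

/-! ### Graphs and equivalence relations -/

section Graph

variable {V : Type*}

theorem reachableSetoid_sup (G H : SimpleGraph V) :
    (G ⊔ H).reachableSetoid = G.reachableSetoid ⊔ H.reachableSetoid := by
  apply le_antisymm
  · rintro u v (h : (G ⊔ H).Reachable u v)
    rw [SimpleGraph.reachable_iff_reflTransGen] at h
    induction h with
    | refl => exact Setoid.refl' _ _
    | tail _ hadj ih =>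
      refine Setoid.trans' _ ih ?_
      rcases hadj with h | h
      · exact sup_left (SimpleGraph.Adj.reachable h)
      · exact sup_right (SimpleGraph.Adj.reachable h)
  · refine sup_le (fun u v h => ?_) (fun u v h => ?_)
    · exact SimpleGraph.Reachable.mono le_sup_left h
    · exact SimpleGraph.Reachable.mono le_sup_right h

theorem reachableSetoid_fromRel (E : V → V) (hE : Function.Involutive E) :
    (SimpleGraph.fromRel fun u v => E u = v).reachableSetoid = invS E hE := by
  apply le_antisymm
  · rintro u v (h : SimpleGraph.Reachable _ u v)
    rw [SimpleGraph.reachable_iff_reflTransGen] at h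
    induction h with
    | refl => exact Setoid.refl' _ _
    | tail _ hadj ih =>
      refine Setoid.trans' _ ih ?_
      rw [SimpleGraph.fromRel_adj] at hadj
      rcases hadj.2 with h | h
      · exact Or.inr h
      · exact Or.inr (by rw [← h, hE])
  · rintro u v (rfl | rfl)
    · exact SimpleGraph.Reachable.refl _
    · by_cases h : u = E u
      · rw [← h]
      · exact SimpleGraph.Adj.reachable ((SimpleGraph.fromRel_adj _ _ _).2 ⟨h, Or.inl rfl⟩)

theorem supp_reachableSetoid (G : SimpleGraph V) : supp G.reachableSetoid ⊆ G.support := by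
  rintro v ⟨w, h, hne⟩
  change G.Reachable v w at h
  rw [SimpleGraph.reachable_iff_reflTransGen] at h
  rcases Relation.ReflTransGen.cases_head h with h | ⟨u, hu, -⟩
  · exact absurd h.symm hne
  · exact ⟨u, hu⟩

/-- A walk is cut at its vertices outside `U`; each piece is an edge of the contraction. -/
theorem contract_reachable_iff (G : SimpleGraph V) (U : Set V) {u v : V} (hu : u ∉ U)
    (hv : v ∉ U) : (contract G U).Reachable u v ↔ G.Reachable u v := by
  constructor
  · intro h
    rw [SimpleGraph.reachable_iff_reflTransGen] at h
    induction h with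
    | refl => exact SimpleGraph.Reachable.refl _
    | tail _ hadj ih =>
      obtain ⟨-, h1, -, p, -⟩ := hadj
      exact (ih h1).trans p.reachable
  · intro h
    rw [SimpleGraph.reachable_iff_reflTransGen] at h
    -- `u₀` is the last cut point so far. The endpoint `v` must be allowed to lie in `U` for the
    -- induction, so `hv` is dropped.
    have key : ∃ u₀, u₀ ∉ U ∧ (contract G U).Reachable u u₀ ∧
        ∃ p : G.Walk u₀ v, ∀ w ∈ p.support, w = u₀ ∨ w = v ∨ w ∈ U := by
      clear hv
      induction h with
      | refl => exact ⟨u, hu, SimpleGraph.Reachable.refl _, SimpleGraph.Walk.nil, by simp⟩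
      | @tail z z' _ hadj ih =>
        obtain ⟨u₀, h0, h1, p, hp⟩ := ih
        by_cases hz : z ∈ U
        · refine ⟨u₀, h0, h1, p.concat hadj, fun w hw => ?_⟩
          rw [SimpleGraph.Walk.support_concat, List.mem_append,
            List.mem_singleton] at hw
          rcases hw with hw | hw
          · rcases hp w hw with h | h | h
            · exact Or.inl h
            · exact Or.inr (Or.inr (h ▸ hz))
            · exact Or.inr (Or.inr h)
          · exact Or.inr (Or.inl hw)
        · refine ⟨z, hz, ?_, SimpleGraph.Walk.cons hadj SimpleGraph.Walk.nil, by simp⟩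
          by_cases e : u₀ = z
          · exact e ▸ h1
          · exact h1.trans (SimpleGraph.Adj.reachable ⟨e, h0, hz, p, hp⟩)
    obtain ⟨u₀, h0, h1, p, hp⟩ := key
    by_cases e : u₀ = v
    · exact e ▸ h1
    · exact h1.trans (SimpleGraph.Adj.reachable ⟨e, h0, hv, p, hp⟩)

/-- A map that matches the fibres of `f` with those of `g` identifies the two images even if it is
neither injective nor surjective; components can so be counted along a collapse. -/
theorem ncard_image_congr {α β γ δ : Type*} {W : Set α} {W' : Set β} (ψ : α → β)
    (hψ : Set.MapsTo ψ W W') (f : α → γ) (g : β → δ)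
    (h : ∀ x ∈ W, ∀ y ∈ W, f x = f y ↔ g (ψ x) = g (ψ y))
    (hs : ∀ y ∈ W', ∃ x ∈ W, g (ψ x) = g y) : (f '' W).ncard = (g '' W').ncard := by
  rcases isEmpty_or_nonempty α with hα | hα
  · have : W' = ∅ := Set.eq_empty_of_forall_notMem fun y hy => hα.elim (hs y hy).choose
    simp [this, Set.eq_empty_of_isEmpty W]
  have hx : ∀ a ∈ f '' W, ∃ x, x ∈ W ∧ f x = a := fun a ha => ha
  choose! r hr using hx
  refine Set.ncard_congr (fun a _ => g (ψ (r a))) (fun a ha => ⟨_, hψ (hr a ha).1, rfl⟩) ?_ ?_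
  · intro a b ha hb e
    rw [← (hr a ha).2, ← (hr b hb).2]
    exact (h _ (hr a ha).1 _ (hr b hb).1).2 e
  · rintro _ ⟨y, hy, rfl⟩
    obtain ⟨x, hx, e⟩ := hs y hy
    refine ⟨f x, ⟨x, hx, rfl⟩, ?_⟩
    rw [← e, ← h _ (hr _ ⟨x, hx, rfl⟩).1 _ hx]
    exact (hr _ ⟨x, hx, rfl⟩).2

theorem numComponents_congr {V' : Type*} {G : SimpleGraph V} {G' : SimpleGraph V'} {W : Set V}
    {W' : Set V'} (ψ : V → V') (hψ : Set.MapsTo ψ W W')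
    (h : ∀ x ∈ W, ∀ y ∈ W, G.Reachable x y ↔ G'.Reachable (ψ x) (ψ y))
    (hs : ∀ y ∈ W', ∃ x ∈ W, G'.Reachable (ψ x) y) : numComponents G W = numComponents G' W' :=
  ncard_image_congr ψ hψ _ _
    (fun x hx y hy => by simpa only [SimpleGraph.ConnectedComponent.eq] using h x hx y hy)
    (fun y hy => by simpa only [SimpleGraph.ConnectedComponent.eq] using hs y hy)

/-- Contraction preserves reachability outside `U`, so the components it loses are exactly those
contained in `U`. -/
theorem numComponents_sub_contract (G : SimpleGraph V) (W U : Set V) (hW : W.Finite) (hU : U ⊆ W)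
    (hc : G.support ⊆ W) :
    numComponents G W - numComponents (contract G U) (W \ U) = loops G.reachableSetoid U := by
  have e1 : numComponents (contract G U) (W \ U) = (G.connectedComponentMk '' (W \ U)).ncard :=
    ncard_image_congr id (fun x hx => hx) _ _ (fun x hx y hy => by
      simpa only [SimpleGraph.ConnectedComponent.eq, id] using contract_reachable_iff G U hx.2 hy.2)
      (fun y hy => ⟨y, hy, rfl⟩)
  have e2 : loops G.reachableSetoid U =
      (G.connectedComponentMk '' W \ G.connectedComponentMk '' (W \ U)).ncard := by
    unfold loops
    have hinj : Set.InjOn (SimpleGraph.ConnectedComponent.supp (G := G))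
      (G.connectedComponentMk '' W \ G.connectedComponentMk '' (W \ U)) :=
      fun a _ b _ h => SimpleGraph.ConnectedComponent.supp_injective h
    rw [← hinj.ncard_image]
    congr 1
    ext C
    constructor
    · rintro ⟨v, hv, rfl, hC⟩
      refine ⟨G.connectedComponentMk v, ⟨⟨v, hU hv, rfl⟩, ?_⟩, ?_⟩
      · rintro ⟨w, hw, e⟩
        exact hw.2 (hC (SimpleGraph.ConnectedComponent.exact e).symm)
      · ext w
        rw [SimpleGraph.ConnectedComponent.mem_supp_iff, SimpleGraph.ConnectedComponent.eq]
        exact ⟨fun h => h.symm, fun h => SimpleGraph.Reachable.symm h⟩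
    · rintro ⟨_, ⟨⟨v, hv, rfl⟩, hn⟩, rfl⟩
      have hmem : ∀ w, G.Reachable v w → w ∈ U := by
        intro w hw
        by_contra hwU
        refine hn ⟨w, ⟨?_, hwU⟩, SimpleGraph.ConnectedComponent.sound hw.symm⟩
        by_cases e : w = v
        · exact e ▸ hv
        · exact hc (supp_reachableSetoid G (mem_supp_right (R := G.reachableSetoid) hw
            (Ne.symm e)))
      refine ⟨v, hmem v (SimpleGraph.Reachable.refl v), ?_, fun w hw => ?_⟩
      · ext w
        rw [SimpleGraph.ConnectedComponent.mem_supp_iff, SimpleGraph.ConnectedComponent.eq]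
        exact ⟨fun h => h.symm, fun h => SimpleGraph.Reachable.symm h⟩
      · rw [SimpleGraph.ConnectedComponent.mem_supp_iff, SimpleGraph.ConnectedComponent.eq] at hw
        exact hmem w hw.symm
  rw [e1, e2, Set.ncard_sdiff (Set.image_mono Set.sdiff_subset) ((hW.subset
    Set.sdiff_subset).image _)]
  rfl

end Graph

end SWB

namespace SWB

/-! ### The equivalence relations of pairings, shifts and stacks -/

@[reducible] def arcS (Θ : Datum) : Setoid (ℕ × ℕ) := invS Θ.E Θ.E_E

theorem arcS_iff {Θ : Datum} {u v : ℕ × ℕ} : arcS Θ u v ↔ u = v ∨ Θ.E u = v := Iff.rfl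

theorem supp_arcS (Θ : Datum) : supp (arcS Θ) = Θ.V := by
  rw [supp_invS _ Θ.E_E]
  ext v
  exact Θ.E_ne v

/-- Transport of an equivalence relation along the shift of the sites. -/
@[reducible] def shS (c : ℕ) (R : Setoid (ℕ × ℕ)) : Setoid (ℕ × ℕ) where
  r u v := u = v ∨ (c ≤ u.1 ∧ c ≤ v.1 ∧ R (u.1 - c, u.2) (v.1 - c, v.2))
  iseqv := ⟨fun _ => Or.inl rfl, by
    rintro u v (rfl | ⟨h1, h2, h⟩)
    · exact Or.inl rfl
    · exact Or.inr ⟨h2, h1, R.symm' h⟩, by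
    rintro u v w (rfl | ⟨h1, h2, h⟩) (rfl | ⟨h3, h4, h'⟩)
    · exact Or.inl rfl
    · exact Or.inr ⟨h3, h4, h'⟩
    · exact Or.inr ⟨h1, h2, h⟩
    · exact Or.inr ⟨h1, h4, R.trans' h h'⟩⟩

theorem shS_iff {c : ℕ} {R : Setoid (ℕ × ℕ)} {u v : ℕ × ℕ} :
    shS c R u v ↔ u = v ∨ (c ≤ u.1 ∧ c ≤ v.1 ∧ R (u.1 - c, u.2) (v.1 - c, v.2)) := Iff.rfl

theorem unshift_eq {c : ℕ} {u v : ℕ × ℕ} (hu : c ≤ u.1) (hv : c ≤ v.1) :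
    ((u.1 - c, u.2) : ℕ × ℕ) = (v.1 - c, v.2) ↔ u = v := by
  rw [Prod.ext_iff, Prod.ext_iff]
  simp only
  omega

theorem mem_supp_shS {c : ℕ} {R : Setoid (ℕ × ℕ)} {u : ℕ × ℕ} :
    u ∈ supp (shS c R) ↔ c ≤ u.1 ∧ (u.1 - c, u.2) ∈ supp R := by
  constructor
  · rintro ⟨v, rfl | ⟨h1, h2, h⟩, hne⟩
    · exact absurd rfl hne
    · exact ⟨h1, _, h, fun e => hne ((unshift_eq h2 h1).1 e)⟩
  · rintro ⟨h1, v, h, hne⟩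
    refine ⟨(v.1 + c, v.2), Or.inr ⟨h1, Nat.le_add_left _ _, ?_⟩, fun e => hne ?_⟩
    · simpa using h
    · rw [← e]
      simp

theorem shS_sup (c : ℕ) (R S : Setoid (ℕ × ℕ)) : shS c (R ⊔ S) = shS c R ⊔ shS c S := by
  apply le_antisymm
  · rintro u v (rfl | ⟨h1, h2, h⟩)
    · exact Setoid.refl' _ _
    · have e : ∀ w : ℕ × ℕ, c ≤ w.1 → ((w.1 - c) + c, w.2) = w := fun w hw =>
        Prod.ext (Nat.sub_add_cancel hw) rfl
      have key := sup_rel_induction (P := fun z => (shS c R ⊔ shS c S) u (z.1 + c, z.2)) h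
        (by simp only [e u h1]; exact Setoid.refl' _ _)
        (fun y z hyz hy => Setoid.trans' _ hy (sup_left (Or.inr ⟨by simp, by simp, by simpa⟩)))
        (fun y z hyz hy => Setoid.trans' _ hy (sup_right (Or.inr ⟨by simp, by simp, by simpa⟩)))
      simpa only [e v h2] using key
  · refine sup_le ?_ ?_
    · rintro u v (rfl | ⟨h1, h2, h⟩)
      · exact Setoid.refl' _ _
      · exact Or.inr ⟨h1, h2, sup_left h⟩
    · rintro u v (rfl | ⟨h1, h2, h⟩)
      · exact Setoid.refl' _ _
      · exact Or.inr ⟨h1, h2, sup_right h⟩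

@[simp] theorem shift_fst (c : ℕ) (v : ℕ × ℕ) : (shift c v).1 = v.1 + c := rfl

@[simp] theorem shift_snd (c : ℕ) (v : ℕ × ℕ) : (shift c v).2 = v.2 := rfl

theorem reachableSetoid_map_shift (c : ℕ) (G : SimpleGraph (ℕ × ℕ)) :
    (G.map (shift c)).reachableSetoid = shS c G.reachableSetoid := by
  apply le_antisymm
  · rintro u v (h : SimpleGraph.Reachable _ u v)
    rw [SimpleGraph.reachable_iff_reflTransGen] at h
    induction h with
    | refl => exact Setoid.refl' _ _
    | tail _ hadj ih =>
      refine Setoid.trans' _ ih ?_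
      obtain ⟨-, a, b, hab, rfl, rfl⟩ := hadj
      refine Or.inr ⟨by simp, by simp, ?_⟩
      simp only [shift_fst, shift_snd, Nat.add_sub_cancel]
      exact SimpleGraph.Adj.reachable hab
  · rintro u v (rfl | ⟨h1, h2, h⟩)
    · exact SimpleGraph.Reachable.refl _
    · have := SimpleGraph.Reachable.map (SimpleGraph.Embedding.map (shift c) G).toHom h
      have e : ∀ w : ℕ × ℕ, c ≤ w.1 → shift c (w.1 - c, w.2) = w := fun w hw =>
        Prod.ext (Nat.sub_add_cancel hw) rfl
      change SimpleGraph.Reachable _ u v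
      simpa [e u h1, e v h2] using this

/-- The involution shifted by `c` sites. -/
def shE (c : ℕ) (E : ℕ × ℕ → ℕ × ℕ) (v : ℕ × ℕ) : ℕ × ℕ :=
  if c ≤ v.1 then ((E (v.1 - c, v.2)).1 + c, (E (v.1 - c, v.2)).2) else v

theorem shE_involutive {c : ℕ} {E : ℕ × ℕ → ℕ × ℕ} (hE : Function.Involutive E) :
    Function.Involutive (shE c E) := by
  intro v
  by_cases h : c ≤ v.1
  · simp [shE, h, hE (v.1 - c, v.2)]
  · simp [shE, h]

theorem shE_eq_self {c : ℕ} {E : ℕ × ℕ → ℕ × ℕ} {v : ℕ × ℕ} (h : c ≤ v.1) :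
    shE c E v = v ↔ E (v.1 - c, v.2) = (v.1 - c, v.2) := by
  rw [shE, if_pos h, Prod.ext_iff, Prod.ext_iff]
  simp only
  omega

theorem shS_invS (c : ℕ) (E : ℕ × ℕ → ℕ × ℕ) (hE : Function.Involutive E) :
    shS c (invS E hE) = invS (shE c E) (shE_involutive hE) := by
  ext u v
  rw [shS_iff, invS_iff, invS_iff]
  constructor
  · rintro (h | ⟨h1, h2, h | h⟩)
    · exact Or.inl h
    · exact Or.inl ((unshift_eq h1 h2).1 h)
    · refine Or.inr ?_
      rw [shE, if_pos h1, h]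
      exact Prod.ext (Nat.sub_add_cancel h2) rfl
  · rintro (h | h)
    · exact Or.inl h
    · by_cases h1 : c ≤ u.1
      · rw [shE, if_pos h1] at h
        refine Or.inr ⟨h1, by rw [← h]; simp, Or.inr ?_⟩
        rw [← h]
        simp
      · rw [shE, if_neg h1] at h
        exact Or.inl h

/-- The relation generated by the arcs of two stacked squares. -/
@[reducible] def stackS (Θ₁ Θ₂ : Datum) : Setoid (ℕ × ℕ) :=
  arcS Θ₁ ⊔ shS (2 * Θ₁.N + 1) (arcS Θ₂)

theorem stackArcGraph_reachable (Θ₁ Θ₂ : Datum) :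
    (stackArcGraph Θ₁ Θ₂).reachableSetoid = stackS Θ₁ Θ₂ := by
  rw [stackArcGraph, reachableSetoid_sup, reachableSetoid_map_shift, Datum.arcGraph,
    Datum.arcGraph, reachableSetoid_fromRel _ Θ₁.E_E, reachableSetoid_fromRel _ Θ₂.E_E]

theorem mem_stackV {Θ₁ Θ₂ : Datum} {v : ℕ × ℕ} : v ∈ stackV Θ₁ Θ₂ ↔
    v ∈ Θ₁.V ∨ (2 * Θ₁.N + 1 ≤ v.1 ∧ (v.1 - (2 * Θ₁.N + 1), v.2) ∈ Θ₂.V) := by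
  refine or_congr_right ⟨?_, fun ⟨h1, h2⟩ => ⟨_, h2, Prod.ext (Nat.sub_add_cancel h1) rfl⟩⟩
  rintro ⟨w, hw, rfl⟩
  exact ⟨by simp, by simpa using hw⟩

theorem stackV_finite (Θ₁ Θ₂ : Datum) : (stackV Θ₁ Θ₂).Finite :=
  Θ₁.V_finite.union (Θ₂.V_finite.image _)

theorem stackMid_finite (Θ₁ Θ₂ : Datum) : (stackMid Θ₁ Θ₂).Finite :=
  (stackV_finite Θ₁ Θ₂).subset fun _ h => h.1

theorem supp_stackS (Θ₁ Θ₂ : Datum) : supp (stackS Θ₁ Θ₂) ⊆ stackV Θ₁ Θ₂ := by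
  intro v hv
  rw [mem_stackV]
  refine (supp_sup_subset _ _ hv).imp (fun h => ?_) (fun h => ?_)
  · rwa [supp_arcS] at h
  · rwa [mem_supp_shS, supp_arcS] at h

theorem class_finite (Θ₁ Θ₂ : Datum) (v : ℕ × ℕ) : {w | stackS Θ₁ Θ₂ v w}.Finite := by
  refine ((stackV_finite Θ₁ Θ₂).insert v).subset fun w hw => ?_
  by_cases h : v = w
  · exact Or.inl h.symm
  · exact Or.inr (supp_stackS _ _ (mem_supp_right hw h))

theorem curveGraph_support (Θ : Datum) : Θ.curveGraph.support ⊆ Θ.V := by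
  rintro v ⟨w, h | h⟩
  · rw [Datum.arcGraph, SimpleGraph.fromRel_adj] at h
    rw [← Θ.E_ne]
    rcases h.2 with e | e
    · exact fun e' => h.1 (e'.symm.trans e)
    · exact fun e' => h.1 (by rw [← e', Datum.E_eq_comm.1 e])
  · rw [Datum.bandGraph, SimpleGraph.fromRel_adj] at h
    rcases h.2 with e | e
    · exact e.1
    · exact e.2.2 ▸ Frame.iota_mem e.1

theorem bandGraph_support (Θ : Datum) : Θ.bandGraph.support ⊆ {v | Θ.Internal v} := by
  rintro v ⟨w, h⟩
  change Θ.bandGraph.Adj v w at h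
  rw [Datum.bandGraph, SimpleGraph.fromRel_adj] at h
  rcases h.2 with e | e
  · exact e.2.1
  · exact e.2.2 ▸ Frame.iota_internal e.2.1

theorem map_graph_sup {V W : Type*} (f : V ↪ W) (G H : SimpleGraph V) :
    (G ⊔ H).map f = G.map f ⊔ H.map f := by
  ext u v
  simp only [SimpleGraph.map_adj, SimpleGraph.sup_adj]
  constructor
  · rintro ⟨a, b, h | h, rfl, rfl⟩
    · exact Or.inl ⟨a, b, h, rfl, rfl⟩
    · exact Or.inr ⟨a, b, h, rfl, rfl⟩
  · rintro (⟨a, b, h, rfl, rfl⟩ | ⟨a, b, h, rfl, rfl⟩)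
    · exact ⟨a, b, Or.inl h, rfl, rfl⟩
    · exact ⟨a, b, Or.inr h, rfl, rfl⟩

/-- The linking number counts the classes of the stack which consist of glued vertices. -/
theorem linking_eq (Θ₁ Θ₂ : Datum) :
    linking Θ₁ Θ₂ = loops (stackS Θ₁ Θ₂) (stackMid Θ₁ Θ₂) := by
  unfold linking
  rw [numComponents_sub_contract _ _ _ (stackV_finite Θ₁ Θ₂) (fun v h => h.1)]
  · have e : stackGraph Θ₁ Θ₂ = stackArcGraph Θ₁ Θ₂ ⊔
        (Θ₁.bandGraph ⊔ Θ₂.bandGraph.map (shift (2 * Θ₁.N + 1))) := by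
      unfold stackGraph stackArcGraph Datum.curveGraph
      rw [map_graph_sup, sup_sup_sup_comm]
    -- Band edges join internal vertices, none of which is glued, so they are irrelevant for classes
    -- inside the glued set.
    rw [e, reachableSetoid_sup, stackArcGraph_reachable, loops_sup]
    rw [Set.disjoint_left]
    intro v hv hmid
    obtain ⟨w, h | h⟩ := supp_reachableSetoid _ hv
    · have := bandGraph_support Θ₁ ⟨w, h⟩
      have h2 := hmid.2
      simp only [Set.mem_ofPred_eq, Frame.Internal] at this
      omega
    · rw [SimpleGraph.map_adj] at h
      obtain ⟨a, b, hab, rfl, rfl⟩ := h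
      have := bandGraph_support Θ₂ ⟨b, hab⟩
      have h2 := hmid.2
      simp only [Set.mem_ofPred_eq, Frame.Internal, shift_fst] at this h2
      omega
  · rintro v ⟨w, h | h⟩
    · exact Or.inl (curveGraph_support Θ₁ ⟨w, h⟩)
    · rw [SimpleGraph.map_adj] at h
      obtain ⟨a, b, hab, rfl, rfl⟩ := h
      exact Or.inr ⟨a, curveGraph_support Θ₂ ⟨b, hab⟩, rfl⟩

/-! ### Ends of the paths in a stack -/

/-- The numbers of points on the glued edges agree. -/
def Composable (Θ₁ Θ₂ : Datum) : Prop := Θ₁.f (2 * Θ₁.N + 1) = Θ₂.f 0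

theorem Sq.composable {n m l : ℕ} (Θ₁ : Sq n m) (Θ₂ : Sq m l) : Composable Θ₁.1 Θ₂.1 :=
  Θ₁.2.2.trans Θ₂.2.1.symm

section Ends

variable {Θ₁ Θ₂ : Datum}

theorem stackS_eq (Θ₁ Θ₂ : Datum) : stackS Θ₁ Θ₂ =
    invS Θ₁.E Θ₁.E_E ⊔ invS (shE (2 * Θ₁.N + 1) Θ₂.E) (shE_involutive Θ₂.E_E) := by
  rw [stackS, shS_invS _ _ Θ₂.E_E]

theorem shE_ne_iff {c : ℕ} {Θ : Datum} {v : ℕ × ℕ} :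
    shE c Θ.E v ≠ v ↔ c ≤ v.1 ∧ (v.1 - c, v.2) ∈ Θ.V := by
  by_cases h : c ≤ v.1
  · rw [Ne, shE_eq_self h, ← Ne, Θ.E_ne]
    exact (and_iff_right h).symm
  · simp [shE, h]

theorem mem_mid_iff (hc : Composable Θ₁ Θ₂) {v : ℕ × ℕ} : v ∈ stackMid Θ₁ Θ₂ ↔
    Θ₁.E v ≠ v ∧ shE (2 * Θ₁.N + 1) Θ₂.E v ≠ v := by
  rw [Θ₁.E_ne, shE_ne_iff]
  constructor
  · rintro ⟨h, h1⟩
    rw [mem_stackV] at h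
    simp only [Frame.mem_V, h1, Nat.sub_self, le_refl, true_and] at h ⊢
    rw [hc] at h ⊢
    tauto
  · rintro ⟨h1, h2, -⟩
    exact ⟨Or.inl h1, le_antisymm (Frame.site_le h1) h2⟩

theorem mem_stackV_iff {v : ℕ × ℕ} : v ∈ stackV Θ₁ Θ₂ ↔
    Θ₁.E v ≠ v ∨ shE (2 * Θ₁.N + 1) Θ₂.E v ≠ v := by
  rw [Θ₁.E_ne, shE_ne_iff, mem_stackV]

/-- Two distinct ends of the same path are the only ends of that path. -/
theorem end_unique (hc : Composable Θ₁ Θ₂) {u v w : ℕ × ℕ} (hu : u ∉ stackMid Θ₁ Θ₂)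
    (hv : v ∉ stackMid Θ₁ Θ₂) (hw : w ∉ stackMid Θ₁ Θ₂) (huv : stackS Θ₁ Θ₂ u v)
    (huw : stackS Θ₁ Θ₂ u w) (hne : u ≠ v) (hne' : u ≠ w) : v = w := by
  by_contra hvw
  rw [mem_mid_iff hc, not_and_or, not_not, not_not] at hu hv hw
  have hf := class_finite Θ₁ Θ₂ u
  rw [stackS_eq] at hf huv huw
  exact ends_le_two _ _ hf hne hne' hvw hu hv hw huv huw

/-- A vertex of the stack off the glued site is moved by exactly one of the two pairings, which is
the hypothesis of the parity argument. -/
theorem end_exists (hc : Composable Θ₁ Θ₂) {u : ℕ × ℕ}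
    (hu : u ∈ stackV Θ₁ Θ₂ \ stackMid Θ₁ Θ₂) :
    ∃ v ∈ stackV Θ₁ Θ₂ \ stackMid Θ₁ Θ₂, stackS Θ₁ Θ₂ u v ∧ v ≠ u := by
  have h1 := hu.1
  have h2 := hu.2
  rw [mem_stackV_iff] at h1
  rw [mem_mid_iff hc, not_and_or, not_not, not_not] at h2
  have hf := class_finite Θ₁ Θ₂ u
  rw [stackS_eq] at hf
  obtain ⟨v, hne, hv, he⟩ := exists_other_end Θ₁.E_E (shE_involutive Θ₂.E_E) hf (x := u) (by
    intro e
    have e' := iff_of_eq e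
    tauto)
  rw [← stackS_eq] at hv
  refine ⟨v, ⟨supp_stackS _ _ (mem_supp_right hv hne.symm), ?_⟩, hv, hne⟩
  rw [mem_mid_iff hc]
  tauto

/-- If `u` and `v` share a class, the contraction gives `u` some neighbour. This neighbour is an end
of the same path, and a path has only two ends, so it is `v`. -/
theorem contract_adj_iff (hc : Composable Θ₁ Θ₂) {u v : ℕ × ℕ} (hu : u ∉ stackMid Θ₁ Θ₂)
    (hv : v ∉ stackMid Θ₁ Θ₂) :
    (contract (stackArcGraph Θ₁ Θ₂) (stackMid Θ₁ Θ₂)).Adj u v ↔ u ≠ v ∧ stackS Θ₁ Θ₂ u v := by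
  rw [← stackArcGraph_reachable]
  constructor
  · rintro ⟨h, -, -, p, -⟩
    exact ⟨h, p.reachable⟩
  · rintro ⟨hne, h⟩
    have h' := (contract_reachable_iff _ _ hu hv).2 h
    rw [SimpleGraph.reachable_iff_reflTransGen] at h'
    rcases Relation.ReflTransGen.cases_head h' with e | ⟨w, hw, -⟩
    · exact absurd e hne
    · have hw' := hw
      obtain ⟨h1, h2, h3, p, -⟩ := hw'
      have hr : (stackArcGraph Θ₁ Θ₂).reachableSetoid u w := p.reachable
      rw [stackArcGraph_reachable] at h hr
      rwa [end_unique hc hu hv h3 h hr hne h1]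

end Ends

/-- The order preserving injection of the sites which omits the site `c`. -/
def re (c : ℕ) (v : ℕ × ℕ) : ℕ × ℕ := if v.1 < c then v else (v.1 + 1, v.2)

theorem re_injective (c : ℕ) : Function.Injective (re c) := by
  intro u v h
  unfold re at h
  rw [Prod.ext_iff] at h ⊢
  split_ifs at h <;> (try dsimp only at h ⊢) <;> omega

theorem re_fst_ne (c : ℕ) (v : ℕ × ℕ) : (re c v).1 ≠ c := by
  unfold re
  split_ifs <;> (try dsimp only) <;> omega

theorem mem_range_re {c : ℕ} {v : ℕ × ℕ} : v ∈ Set.range (re c) ↔ v.1 ≠ c := by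
  constructor
  · rintro ⟨w, rfl⟩
    exact re_fst_ne c w
  · intro h
    by_cases h1 : v.1 < c
    · exact ⟨v, by simp [re, h1]⟩
    · refine ⟨(v.1 - 1, v.2), ?_⟩
      have : ¬ v.1 - 1 < c := by omega
      simp only [re, this, if_false]
      exact Prod.ext (by simp only; omega) rfl

theorem unstack_re (N : ℕ) (v : ℕ × ℕ) : unstack N (re (2 * N + 1) v) = v := by
  unfold unstack re
  split_ifs with h1 h2 h2
  · rfl
  · omega
  · simp only at h2; omega
  · simp

theorem re_unstack {N : ℕ} {v : ℕ × ℕ} (h : v.1 ≠ 2 * N + 1) :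
    re (2 * N + 1) (unstack N v) = v := by
  obtain ⟨w, rfl⟩ := mem_range_re.2 h
  rw [unstack_re]

/-- The number of points at the sites of a juxtaposition. -/
theorem mem_stack_re {Θ₁ Θ₂ : Datum} {v : ℕ × ℕ} :
    re (2 * Θ₁.N + 1) v ∈ stackV Θ₁ Θ₂ \ stackMid Θ₁ Θ₂ ↔
    1 ≤ v.2 ∧ v.2 ≤ if v.1 ≤ 2 * Θ₁.N then Θ₁.f v.1 else Θ₂.f (v.1 - 2 * Θ₁.N) := by
  have h0 : re (2 * Θ₁.N + 1) v ∉ stackMid Θ₁ Θ₂ := fun h => re_fst_ne _ _ h.2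
  rw [Set.mem_sdiff, and_iff_left h0, mem_stackV]
  by_cases h : v.1 ≤ 2 * Θ₁.N
  · have h1 : v.1 < 2 * Θ₁.N + 1 := by omega
    have h2 : ¬ (2 * Θ₁.N + 1 ≤ v.1) := by omega
    simp only [re, h1, if_true, h2, false_and, or_false, h, Frame.mem_V]
  · have h1 : ¬ v.1 < 2 * Θ₁.N + 1 := by omega
    have h2 : 2 * Θ₁.N + 1 ≤ v.1 + 1 := by omega
    have h3 : (v.1 + 1, v.2) ∉ Θ₁.V := fun hm => by
      have := Frame.site_le hm
      simp only at this
      omega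
    have h4 : v.1 + 1 - (2 * Θ₁.N + 1) = v.1 - 2 * Θ₁.N := by omega
    simp only [re, h1, if_false, h2, true_and, h3, false_or, h, Frame.mem_V, h4]

theorem IsJuxtaposition.mem_V {Θ₁ Θ₂ Θ : Datum} (h : ∀ i, Θ.f i = if i ≤ 2 * Θ₁.N then Θ₁.f i
    else Θ₂.f (i - 2 * Θ₁.N)) {v : ℕ × ℕ} :
    v ∈ Θ.V ↔ re (2 * Θ₁.N + 1) v ∈ stackV Θ₁ Θ₂ \ stackMid Θ₁ Θ₂ := by
  rw [mem_stack_re, Frame.mem_V, h]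

/-- The vertexwise condition on contracted paths becomes a single equality of equivalence relations
on all of `ℕ × ℕ`, the form in which uniqueness, duality and associativity can be computed. -/
theorem isJuxtaposition_iff {Θ₁ Θ₂ Θ : Datum} (hc : Composable Θ₁ Θ₂) :
    IsJuxtaposition Θ₁ Θ₂ Θ ↔ Θ.N = Θ₁.N + Θ₂.N ∧
      (∀ i, Θ.P i = if i ≤ 2 * Θ₁.N then Θ₁.P i else Θ₂.P (i - 2 * Θ₁.N) + 2 * Θ₁.N) ∧
      (∀ i, Θ.s i = if i ≤ 2 * Θ₁.N then Θ₁.s i else Θ₂.s (i - 2 * Θ₁.N)) ∧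
      (∀ i, Θ.f i = if i ≤ 2 * Θ₁.N then Θ₁.f i else Θ₂.f (i - 2 * Θ₁.N)) ∧
      arcS Θ = Setoid.comap (re (2 * Θ₁.N + 1)) (stackS Θ₁ Θ₂) := by
  unfold IsJuxtaposition
  refine and_congr_right fun _ => and_congr_right fun _ => and_congr_right fun _ =>
    and_congr_right fun hf => ?_
  have hV := fun v => IsJuxtaposition.mem_V hf (v := v)
  constructor
  · intro h
    have main : ∀ u ∈ Θ.V, ∀ v ∈ Θ.V, arcS Θ u v ↔
        stackS Θ₁ Θ₂ (re (2 * Θ₁.N + 1) u) (re (2 * Θ₁.N + 1) v) := by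
      intro u hu v hv
      have := h _ ((hV u).1 hu) _ ((hV v).1 hv)
      rw [contract_adj_iff hc ((hV u).1 hu).2 ((hV v).1 hv).2, unstack_re, unstack_re,
        (re_injective _).ne_iff] at this
      rw [arcS_iff, this]
      by_cases e : u = v
      · rw [e]
        simp
      · simp [e]
    -- Both relations are trivial off the vertices of `Θ`, so agreement on the vertices suffices.
    have out : ∀ u ∉ Θ.V, ∀ v, stackS Θ₁ Θ₂ (re (2 * Θ₁.N + 1) u) (re (2 * Θ₁.N + 1) v) →
        u = v := by
      intro u hu v huv
      by_contra hne
      refine hu ((hV u).2 ⟨supp_stackS _ _ (mem_supp_left huv ?_), fun h => re_fst_ne _ _ h.2⟩)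
      exact fun e => hne (re_injective _ e)
    ext u v
    rw [Setoid.comap_rel]
    by_cases hu : u ∈ Θ.V
    · by_cases hv : v ∈ Θ.V
      · exact main u hu v hv
      · constructor
        · intro huv
          have hvu := Setoid.symm' _ huv
          rw [eq_of_notMem_supp hvu (by rwa [supp_arcS])]
        · intro huv
          rw [out v hv u (Setoid.symm' _ huv)]
    · constructor
      · intro huv
        rw [eq_of_notMem_supp huv (by rwa [supp_arcS])]
      · intro huv
        rw [out u hu v huv]
  · intro h v hv w hw
    have e : ∀ x ∈ stackV Θ₁ Θ₂ \ stackMid Θ₁ Θ₂,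
        re (2 * Θ₁.N + 1) (unstack Θ₁.N x) = x := fun x hx => re_unstack fun e => hx.2 ⟨hx.1, e⟩
    rw [contract_adj_iff hc hv.2 hw.2]
    have := congrArg (fun S : Setoid (ℕ × ℕ) => S (unstack Θ₁.N v) (unstack Θ₁.N w)) h
    simp only [Setoid.comap_rel, e v hv, e w hw, arcS_iff] at this
    rw [← this]
    have hm : unstack Θ₁.N v ∈ Θ.V := by
      rw [hV, e v hv]
      exact hv
    constructor
    · intro hE
      refine ⟨fun hvw => (Θ.E_ne _).2 hm ?_, Or.inr hE⟩
      rw [hE, hvw]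
    · rintro ⟨hne, he | he⟩
      · refine absurd ?_ hne
        rw [← e v hv, he, e w hw]
      · exact he

end SWB

namespace SWB

/-! ### Crossing numbers modulo two -/

section Crossing

open Classical in
/-- The indicator of a proposition, modulo two. -/
noncomputable def chi (p : Prop) : ZMod 2 := if p then 1 else 0

theorem chi_true {p : Prop} (h : p) : chi p = 1 := if_pos h

theorem chi_false {p : Prop} (h : ¬p) : chi p = 0 := if_neg h

/-- Two chords cross when exactly one end of the second lies between the ends of the first. Written
as a sum modulo two of comparisons between the chords, this condition can be added up along paths.
-/
theorem not_crosses_iff {L : Type*} [LinearOrder L] {a b c d : L} (hac : a ≠ c) (had : a ≠ d)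
    (hbc : b ≠ c) (hbd : b ≠ d) :
    ¬ Crosses a b c d ↔ chi (c < a) + chi (d < a) + (chi (c < b) + chi (d < b)) = 0 := by
  have h11 : (1 + 1 : ZMod 2) = 0 := by decide
  have h10 : ¬ (1 : ZMod 2) = 0 := by decide
  unfold Crosses
  rcases le_total a b with hab | hab <;> rcases le_total c d with hcd | hcd <;>
  rcases lt_or_gt_of_ne hac with h1 | h1 <;> rcases lt_or_gt_of_ne had with h2 | h2 <;>
  rcases lt_or_gt_of_ne hbc with h3 | h3 <;> rcases lt_or_gt_of_ne hbd with h4 | h4 <;>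
  first
  | (exfalso; order)
  | simp [chi, hab, hcd, h1, h2, h3, h4, h11, not_lt.2 h1.le,
      not_lt.2 h2.le, not_lt.2 h3.le, not_lt.2 h4.le]

variable {α L : Type*} [LinearOrder L]

/-- Grouping the terms by the pairing in both variables gives blocks of four, each of which vanishes
by the absence of crossings. -/
theorem sum_chi_eq_zero (κ : α → L) {E : α → α} (hE : Function.Involutive E) (A B : Finset α)
    (hA : ∀ a ∈ A, E a ∈ A) (hA' : ∀ a ∈ A, E a ≠ a) (hB : ∀ a ∈ B, E a ∈ B)
    (hB' : ∀ a ∈ B, E a ≠ a) (hne : ∀ a ∈ A, ∀ r ∈ B, κ a ≠ κ r)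
    (hcr : ∀ a ∈ A, ∀ r ∈ B, ¬ Crosses (κ a) (κ (E a)) (κ r) (κ (E r))) :
    ∑ a ∈ A, ∑ r ∈ B, chi (κ r < κ a) = 0 := by
  refine Finset.sum_involution (fun a _ => E a) (fun a ha => ?_) (fun a ha _ => hA' a ha) hA
    (fun a _ => hE a)
  rw [← Finset.sum_add_distrib]
  refine Finset.sum_involution (fun a _ => E a) (fun r hr => ?_) (fun a ha _ => hB' a ha) hB
    (fun a _ => hE a)
  have := (not_crosses_iff (hne a ha r hr) (hne a ha _ (hB r hr)) (hne _ (hA a ha) r hr)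
    (hne _ (hA a ha) _ (hB r hr))).1 (hcr a ha r hr)
  rw [← this]
  ring

end Crossing

/-! ### Existence of juxtapositions -/

/-- Concatenation of chord data. -/
def ChordDatum.concat (c d : ChordDatum) : ChordDatum where
  N := c.N + d.N
  P i := if i ≤ 2 * c.N then c.P i else d.P (i - 2 * c.N) + 2 * c.N
  s i := if i ≤ 2 * c.N then c.s i else d.s (i - 2 * c.N)
  P_P i := by
    by_cases h : i ≤ 2 * c.N
    · have : c.P i ≤ 2 * c.N := by
        by_cases h1 : 1 ≤ i
        · exact (c.P_mem ⟨h1, h⟩).2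
        · rw [c.P_out (by omega)]
          exact h
      simp [h, this, c.P_P]
    · have : ¬ (d.P (i - 2 * c.N) + 2 * c.N ≤ 2 * c.N) := by
        have : 1 ≤ d.P (i - 2 * c.N) := by
          by_cases h1 : 1 ≤ i - 2 * c.N ∧ i - 2 * c.N ≤ 2 * d.N
          · exact (d.P_mem h1).1
          · rw [d.P_out h1]
            omega
        omega
      simp only [h, if_false, this, Nat.add_sub_cancel, d.P_P]
      omega
  P_ne i := by
    by_cases h : i ≤ 2 * c.N
    · simp only [h, if_true]
      have := c.P_ne i
      rw [this]
      omega
    · simp only [h, if_false]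
      have := d.P_ne (i - 2 * c.N)
      rw [show d.P (i - 2 * c.N) + 2 * c.N ≠ i ↔ d.P (i - 2 * c.N) ≠ i - 2 * c.N by omega, this]
      omega
  s_P i := by
    by_cases h : i ≤ 2 * c.N
    · have : c.P i ≤ 2 * c.N := by
        by_cases h1 : 1 ≤ i
        · exact (c.P_mem ⟨h1, h⟩).2
        · rw [c.P_out (by omega)]
          exact h
      simp [h, this, c.s_P]
    · have : ¬ (d.P (i - 2 * c.N) + 2 * c.N ≤ 2 * c.N) := by
        have : 1 ≤ d.P (i - 2 * c.N) := by
          by_cases h1 : 1 ≤ i - 2 * c.N ∧ i - 2 * c.N ≤ 2 * d.N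
          · exact (d.P_mem h1).1
          · rw [d.P_out h1]
            omega
        omega
      simp only [h, if_false, this, Nat.add_sub_cancel, d.s_P]
  s_out i h := by
    split_ifs with h1
    · exact c.s_out i (by omega)
    · exact d.s_out _ (by omega)

/-- Both boundary graphs embed in that of the concatenation, and the edge from the upper vertex of
the last site of `c` to the lower vertex of the first site of `d` links them. -/
theorem ChordDatum.concat_preconnected (c d : ChordDatum) (hc : c.boundaryGraph.Preconnected)
    (hd : d.boundaryGraph.Preconnected) : (c.concat d).boundaryGraph.Preconnected := by
  let f : c.boundaryGraph →g (c.concat d).boundaryGraph :=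
    { toFun := fun x => ⟨x.1, x.2.1, by have := x.2.2; simp only [concat]; omega⟩
      map_rel' := by
        rintro ⟨x, hx⟩ ⟨y, hy⟩ h
        unfold boundaryGraph at h ⊢
        rw [SimpleGraph.fromRel_adj] at h ⊢
        refine ⟨fun e => h.1 (Subtype.ext (by simpa using congrArg Subtype.val e)), ?_⟩
        simpa [concat, hx.2, hy.2] using h.2 }
  let g : d.boundaryGraph →g (c.concat d).boundaryGraph :=
    { toFun := fun x => ⟨(x.1.1 + 2 * c.N, x.1.2), by have := x.2.1; dsimp only; omega, by
        have := x.2.2; simp only [concat]; omega⟩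
      map_rel' := by
        rintro ⟨⟨i, a⟩, hx⟩ ⟨⟨j, b⟩, hy⟩ h
        unfold boundaryGraph at h ⊢
        rw [SimpleGraph.fromRel_adj] at h ⊢
        simp only at hx hy
        refine ⟨fun e => h.1 (Subtype.ext ?_), ?_⟩
        · have := congrArg Subtype.val e
          simpa using this
        replace h := h.2
        have h1 : ¬ (i + 2 * c.N ≤ 2 * c.N) := by omega
        have h2 : ¬ (j + 2 * c.N ≤ 2 * c.N) := by omega
        simp only [concat, h1, h2, if_false,
          Nat.add_sub_cancel, Nat.add_right_cancel_iff, show ∀ k, (k + 2 * c.N = i + 2 * c.N + 1) =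
          (k = i + 1) from fun k => by rw [eq_iff_iff]; omega,
          show ∀ k, (k + 2 * c.N = j + 2 * c.N + 1) =
          (k = j + 1) from fun k => by rw [eq_iff_iff]; omega] at h ⊢
        exact h }
  have hf : ∀ x, (hx : x.1.1 ≤ 2 * c.N) → ∃ y, f y = x := fun x hx => ⟨⟨x.1, x.2.1, hx⟩, rfl⟩
  have hg : ∀ x, (hx : 2 * c.N < x.1.1) → ∃ y, g y = x := fun x hx =>
    ⟨⟨(x.1.1 - 2 * c.N, x.1.2), by dsimp only; omega, by
      have := x.2.2; simp only [concat] at this; dsimp only; omega⟩,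
      Subtype.ext (Prod.ext (by simp only [g, RelHom.coeFn_mk]; omega) rfl)⟩
  have mixed : ∀ x y, (c.concat d).boundaryGraph.Reachable (f x) (g y) := by
    intro x y
    have hx := x.2
    have hy := y.2
    let x₀ : {x : ℕ × Bool // 1 ≤ x.1 ∧ x.1 ≤ 2 * c.N} :=
      ⟨(2 * c.N, true), by dsimp only; omega, le_refl _⟩
    let y₀ : {x : ℕ × Bool // 1 ≤ x.1 ∧ x.1 ≤ 2 * d.N} :=
      ⟨(1, false), le_refl _, by dsimp only; omega⟩
    refine ((hc x x₀).map f).trans (SimpleGraph.Reachable.trans (SimpleGraph.Adj.reachable ?_)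
      ((hd y₀ y).map g))
    unfold boundaryGraph
    rw [SimpleGraph.fromRel_adj]
    refine ⟨fun e => ?_, Or.inl (Or.inl ⟨rfl, rfl, ?_⟩)⟩
    · have := congrArg (fun z => z.1.2) e
      simp [f, g, x₀, y₀] at this
    · change 1 + 2 * c.N = 2 * c.N + 1
      omega
  intro x y
  rcases le_or_gt x.1.1 (2 * c.N) with hx | hx <;> rcases le_or_gt y.1.1 (2 * c.N) with hy | hy
  · obtain ⟨x, rfl⟩ := hf x hx
    obtain ⟨y, rfl⟩ := hf y hy
    exact (hc x y).map f
  · obtain ⟨x, rfl⟩ := hf x hx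
    obtain ⟨y, rfl⟩ := hg y hy
    exact mixed x y
  · obtain ⟨x, rfl⟩ := hg x hx
    obtain ⟨y, rfl⟩ := hf y hy
    exact (mixed y x).symm
  · obtain ⟨x, rfl⟩ := hg x hx
    obtain ⟨y, rfl⟩ := hg y hy
    exact (hd x y).map g

def Frame.concat (F G : Frame) : Frame where
  toChordDatum := F.toChordDatum.concat G.toChordDatum
  f i := if i ≤ 2 * F.N then F.f i else G.f (i - 2 * F.N)
  f_P i := by
    simp only [ChordDatum.concat]
    by_cases h : i ≤ 2 * F.N
    · have : F.P i ≤ 2 * F.N := by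
        by_cases h1 : 1 ≤ i
        · exact (F.P_mem ⟨h1, h⟩).2
        · rw [F.P_out (by omega)]
          exact h
      simp [h, this, F.f_P]
    · have : ¬ (G.P (i - 2 * F.N) + 2 * F.N ≤ 2 * F.N) := by
        have : 1 ≤ G.P (i - 2 * F.N) := by
          by_cases h1 : 1 ≤ i - 2 * F.N ∧ i - 2 * F.N ≤ 2 * G.N
          · exact (G.P_mem h1).1
          · rw [G.P_out h1]
            omega
        omega
      simp only [h, if_false, this, Nat.add_sub_cancel, G.f_P]
  f_out i h := by
    simp only [ChordDatum.concat] at h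
    rw [if_neg (by omega)]
    exact G.f_out _ (by omega)
  oneBoundary := ChordDatum.concat_preconnected _ _ F.oneBoundary G.oneBoundary

section Juxt

variable {Θ₁ Θ₂ : Datum}

theorem concat_mem_V {v : ℕ × ℕ} : v ∈ (Θ₁.toFrame.concat Θ₂.toFrame).V ↔
    re (2 * Θ₁.N + 1) v ∈ stackV Θ₁ Θ₂ \ stackMid Θ₁ Θ₂ := mem_stack_re.symm

open Classical in
/-- The other end of the path which starts at a vertex off the glued edges. -/
noncomputable def otherEnd (Θ₁ Θ₂ : Datum) (v : ℕ × ℕ) : ℕ × ℕ :=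
  if h : ∃ w ≠ v, stackS Θ₁ Θ₂ (re (2 * Θ₁.N + 1) v) (re (2 * Θ₁.N + 1) w) then h.choose else v

theorem otherEnd_rel (v : ℕ × ℕ) :
    stackS Θ₁ Θ₂ (re (2 * Θ₁.N + 1) v) (re (2 * Θ₁.N + 1) (otherEnd Θ₁ Θ₂ v)) := by
  unfold otherEnd
  split_ifs with h
  · exact h.choose_spec.2
  · exact Setoid.refl' _ _

theorem otherEnd_eq (hc : Composable Θ₁ Θ₂) {v w : ℕ × ℕ} (hne : w ≠ v)
    (h : stackS Θ₁ Θ₂ (re (2 * Θ₁.N + 1) v) (re (2 * Θ₁.N + 1) w)) :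
    otherEnd Θ₁ Θ₂ v = w := by
  have hm : ∀ x, re (2 * Θ₁.N + 1) x ∉ stackMid Θ₁ Θ₂ := fun x h => re_fst_ne _ _ h.2
  have hex : ∃ w ≠ v, stackS Θ₁ Θ₂ (re (2 * Θ₁.N + 1) v) (re (2 * Θ₁.N + 1) w) := ⟨w, hne, h⟩
  rw [otherEnd, dif_pos hex]
  refine re_injective _ (end_unique hc (hm v) (hm _) (hm w) hex.choose_spec.2 h ?_ ?_)
  · exact fun e => hex.choose_spec.1 (re_injective _ e).symm
  · exact fun e => hne (re_injective _ e).symm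

theorem otherEnd_ne_iff (hc : Composable Θ₁ Θ₂) (v : ℕ × ℕ) :
    otherEnd Θ₁ Θ₂ v ≠ v ↔ v ∈ (Θ₁.toFrame.concat Θ₂.toFrame).V := by
  rw [concat_mem_V]
  constructor
  · intro h
    refine ⟨supp_stackS _ _ (mem_supp_left (otherEnd_rel v) fun e => h (re_injective _ e).symm),
      fun h => re_fst_ne _ _ h.2⟩
  · intro h
    obtain ⟨w, hw, hr, hne⟩ := end_exists hc h
    obtain ⟨w, rfl⟩ := mem_range_re.2 (fun e => hw.2 ⟨hw.1, e⟩ : w.1 ≠ 2 * Θ₁.N + 1)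
    have hne' : w ≠ v := fun e => hne (e ▸ rfl)
    rw [otherEnd_eq hc hne' hr]
    exact hne'

theorem otherEnd_otherEnd (hc : Composable Θ₁ Θ₂) (v : ℕ × ℕ) :
    otherEnd Θ₁ Θ₂ (otherEnd Θ₁ Θ₂ v) = v := by
  by_cases h : otherEnd Θ₁ Θ₂ v = v
  · rw [h, h]
  · exact otherEnd_eq hc (Ne.symm h) (Setoid.symm' _ (otherEnd_rel v))

/-- The comparison of the orders of the vertices of two squares with the order of the vertices of
their juxtaposition. -/
theorem chi_identity {N₁ N₂ : ℕ} {a r : ℕ × ℕ} (hne : a ≠ r) :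
    (if a.1 ≠ 2 * N₁ + 1 ∧ r.1 ≠ 2 * N₁ + 1 then
      chi (key (N₁ + N₂) (unstack N₁ r) < key (N₁ + N₂) (unstack N₁ a)) else 0) =
    (if a.1 ≤ 2 * N₁ + 1 ∧ r.1 ≤ 2 * N₁ + 1 then chi (key N₁ r < key N₁ a) else 0) +
    (if 2 * N₁ + 1 ≤ a.1 ∧ 2 * N₁ + 1 ≤ r.1 then
      chi (key N₂ (r.1 - (2 * N₁ + 1), r.2) < key N₂ (a.1 - (2 * N₁ + 1), a.2)) else 0) +
    (if 2 * N₁ + 1 ≤ a.1 ∧ r.1 ≤ 2 * N₁ + 1 then 1 else 0) := by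
  have h11 : (1 + 1 : ZMod 2) = 0 := by decide
  obtain ⟨i, x⟩ := a
  obtain ⟨j, y⟩ := r
  rw [Ne, Prod.mk.injEq] at hne
  generalize hp : (key (N₁ + N₂) (unstack N₁ (j, y)) < key (N₁ + N₂) (unstack N₁ (i, x))) = p
  generalize hq : (key N₁ (j, y) < key N₁ (i, x)) = q
  generalize hr : (key N₂ ((j, y).1 - (2 * N₁ + 1), (j, y).2) <
    key N₂ ((i, x).1 - (2 * N₁ + 1), (i, x).2)) = r
  rw [key_lt_iff, eq_iff_iff] at hp hq hr
  dsimp only at hq hr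
  rcases lt_trichotomy i (2 * N₁ + 1) with hi | hi | hi <;>
    rcases lt_trichotomy j (2 * N₁ + 1) with hj | hj | hj
  · simp only [unstack, show i ≤ 2 * N₁ by omega, show j ≤ 2 * N₁ by omega, if_true] at hp
    rw [if_pos (by omega), if_pos (by omega), if_neg (by omega), if_neg (by omega),
      add_zero, add_zero]
    congr 1
    rw [eq_iff_iff, ← hp, ← hq]
    split_ifs <;> omega
  · rw [if_neg (by omega), if_pos (by omega), if_neg (by omega), if_neg (by omega),
      chi_false (by rw [← hq]; omega)]
    simp
  · simp only [unstack, show i ≤ 2 * N₁ by omega, show ¬ j ≤ 2 * N₁ by omega, if_true,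
      if_false] at hp
    rw [if_pos (by omega), if_neg (by omega), if_neg (by omega), if_neg (by omega),
      chi_false (by rw [← hp]; omega)]
    simp
  · rw [if_neg (by omega), if_pos (by omega), if_neg (by omega), if_pos (by omega),
      chi_true (by rw [← hq]; omega)]
    simp [h11]
  -- Both points are glued. The top edge of the first square and the bottom edge of the second are
  -- ordered oppositely, so exactly one comparison holds, and the constant term cancels it.
  · rw [if_neg (by omega), if_pos (by omega), if_pos (by omega), if_pos (by omega)]
    subst hi hj
    simp only [lt_self_iff_false, false_or, true_and, Nat.sub_self, Nat.zero_le, if_true,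
      show ¬ 2 * N₁ + 1 ≤ 2 * N₁ by omega, if_false] at hq hr
    rcases lt_or_gt_of_ne (fun e => hne ⟨rfl, e⟩ : x ≠ y) with h | h
    · rw [chi_true (hq.1 h), chi_false (fun h' => absurd (hr.2 h') (not_lt.2 h.le)), add_zero, h11]
    · rw [chi_false (fun h' => absurd (hq.2 h') (not_lt.2 h.le)), chi_true (hr.1 h), zero_add, h11]
  · rw [if_neg (by omega), if_neg (by omega), if_pos (by omega), if_neg (by omega),
      chi_false (by rw [← hr]; omega)]
    simp
  · simp only [unstack, show ¬ i ≤ 2 * N₁ by omega, show j ≤ 2 * N₁ by omega, if_true,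
      if_false] at hp
    rw [if_pos (by omega), if_neg (by omega), if_neg (by omega), if_pos (by omega),
      chi_true (by rw [← hp]; omega)]
    simp
  · rw [if_neg (by omega), if_neg (by omega), if_pos (by omega), if_pos (by omega),
      chi_true (by rw [← hr]; omega)]
    simp [h11]
  · simp only [unstack, show ¬ i ≤ 2 * N₁ by omega, show ¬ j ≤ 2 * N₁ by omega,
      if_false] at hp
    rw [if_pos (by omega), if_neg (by omega), if_pos (by omega), if_neg (by omega),
      zero_add, add_zero]
    congr 1
    rw [eq_iff_iff, ← hp, ← hr]
    split_ifs <;> omega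

/-- For two distinct paths, the comparisons between all their points are summed using
`chi_identity`. The contributions of the two squares vanish because each is crossingless, and the
correction term is a product with an even factor. What survives is the parity of crossings between
the chords joining the ends. -/
theorem otherEnd_noncrossing (hc : Composable Θ₁ Θ₂) {u v : ℕ × ℕ}
    (hu : u ∈ (Θ₁.toFrame.concat Θ₂.toFrame).V) (hv : v ∈ (Θ₁.toFrame.concat Θ₂.toFrame).V) :
    ¬ Crosses (key (Θ₁.N + Θ₂.N) u) (key (Θ₁.N + Θ₂.N) (otherEnd Θ₁ Θ₂ u))
      (key (Θ₁.N + Θ₂.N) v) (key (Θ₁.N + Θ₂.N) (otherEnd Θ₁ Θ₂ v)) := by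
  classical
  set N := Θ₁.N + Θ₂.N with hN
  set c := 2 * Θ₁.N + 1 with hcdef
  set S := stackS Θ₁ Θ₂ with hS
  set e := otherEnd Θ₁ Θ₂ with he
  -- Ends of one path determine the same chord, which does not cross itself.
  by_cases huv : S (re c u) (re c v)
  · by_cases h : v = u
    · subst h
      rintro (h | h)
      · exact lt_irrefl _ h.1
      · exact lt_irrefl _ h.1
    · have h1 : e u = v := otherEnd_eq hc h huv
      have h2 : e v = u := by rw [← h1]; exact otherEnd_otherEnd hc u
      rw [h1, h2]
      rintro (h | h)
      · rw [min_comm] at h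
        exact lt_irrefl _ h.1
      · rw [min_comm] at h
        exact lt_irrefl _ h.1
  have hu0 := (otherEnd_ne_iff hc u).2 hu
  have hv0 := (otherEnd_ne_iff hc v).2 hv
  have hue : S (re c u) (re c (e u)) := otherEnd_rel u
  have hve : S (re c v) (re c (e v)) := otherEnd_rel v
  let C := (class_finite Θ₁ Θ₂ (re c u)).toFinset
  let D := (class_finite Θ₁ Θ₂ (re c v)).toFinset
  have hC : ∀ w, w ∈ C ↔ S (re c u) w := fun w => by simp [C]
  have hD : ∀ w, w ∈ D ↔ S (re c v) w := fun w => by simp [D]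
  have hCD : ∀ a ∈ C, ∀ r ∈ D, a ≠ r := by
    rintro a ha r hr rfl
    exact huv (S.trans' ((hC a).1 ha) (S.symm' ((hD a).1 hr)))
  -- every vertex of a class of ends lies on one of the squares
  have hsupp : ∀ x y, re c x ≠ re c y → S (re c x) (re c y) → ∀ w, S (re c x) w →
      w ∈ stackV Θ₁ Θ₂ := by
    intro x y hne hxy w hw
    by_cases h : re c x = w
    · rw [← h]
      exact supp_stackS _ _ (mem_supp_left hxy hne)
    · exact supp_stackS _ _ (mem_supp_right hw h)
  have hCV : ∀ a ∈ C, a ∈ stackV Θ₁ Θ₂ := fun a ha =>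
    hsupp u (e u) (fun h => hu0 (re_injective _ h).symm) hue a ((hC a).1 ha)
  have hDV : ∀ a ∈ D, a ∈ stackV Θ₁ Θ₂ := fun a ha =>
    hsupp v (e v) (fun h => hv0 (re_injective _ h).symm) hve a ((hD a).1 ha)
  have hS' : S = invS Θ₁.E Θ₁.E_E ⊔ invS (shE c Θ₂.E) (shE_involutive Θ₂.E_E) := stackS_eq _ _
  have hV1 : ∀ a ∈ stackV Θ₁ Θ₂, a.1 ≤ c → Θ₁.E a ≠ a := by
    intro a ha hac
    rcases eq_or_lt_of_le hac with h | h
    · exact ((mem_mid_iff hc).1 ⟨ha, h⟩).1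
    · rw [Θ₁.E_ne]
      rcases mem_stackV.1 ha with h' | h'
      · exact h'
      · omega
  have hV2 : ∀ a ∈ stackV Θ₁ Θ₂, c ≤ a.1 → shE c Θ₂.E a ≠ a := by
    intro a ha hac
    rcases eq_or_lt_of_le hac with h | h
    · exact ((mem_mid_iff hc).1 ⟨ha, h.symm⟩).2
    · rw [shE_ne_iff]
      rcases mem_stackV.1 ha with h' | h'
      · have := Frame.site_le h'
        omega
      · exact h'
  have hV1' : ∀ a, Θ₁.E a ≠ a → (Θ₁.E a).1 ≤ c := fun a ha =>
    Frame.site_le (Datum.E_mem ((Θ₁.E_ne a).1 ha))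
  have hV2' : ∀ a, c ≤ a.1 → c ≤ (shE c Θ₂.E a).1 := by
    intro a ha
    simp [shE, ha]
  have stepl : ∀ x a, S x a → S x (Θ₁.E a) := fun x a h =>
    S.trans' h (sup_left (Or.inr rfl))
  have stepr : ∀ x a, S x a → S x (shE c Θ₂.E a) := fun x a h =>
    S.trans' h (by rw [hS']; exact sup_right (Or.inr rfl))
  -- the first square
  have sum1 : ∑ a ∈ C.filter (fun a => a.1 ≤ c), ∑ r ∈ D.filter (fun a => a.1 ≤ c),
      chi (key Θ₁.N r < key Θ₁.N a) = 0 := by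
    apply sum_chi_eq_zero (key Θ₁.N) Θ₁.E_E
    · intro a ha
      rw [Finset.mem_filter] at ha ⊢
      exact ⟨(hC _).2 (stepl _ _ ((hC a).1 ha.1)), hV1' a (hV1 a (hCV a ha.1) ha.2)⟩
    · intro a ha
      rw [Finset.mem_filter] at ha
      exact hV1 a (hCV a ha.1) ha.2
    · intro a ha
      rw [Finset.mem_filter] at ha ⊢
      exact ⟨(hD _).2 (stepl _ _ ((hD a).1 ha.1)), hV1' a (hV1 a (hDV a ha.1) ha.2)⟩
    · intro a ha
      rw [Finset.mem_filter] at ha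
      exact hV1 a (hDV a ha.1) ha.2
    · intro a ha r hr h
      exact hCD a (Finset.mem_filter.1 ha).1 r (Finset.mem_filter.1 hr).1 (key_injective _ h)
    · intro a ha r hr
      rw [Finset.mem_filter] at ha hr
      exact Θ₁.noncrossing a ((Θ₁.E_ne a).1 (hV1 a (hCV a ha.1) ha.2)) r
        ((Θ₁.E_ne r).1 (hV1 r (hDV r hr.1) hr.2))
  -- the second square
  have sum2 : ∑ a ∈ C.filter (fun a => c ≤ a.1), ∑ r ∈ D.filter (fun a => c ≤ a.1),
      chi (key Θ₂.N (r.1 - c, r.2) < key Θ₂.N (a.1 - c, a.2)) = 0 := by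
    apply sum_chi_eq_zero (fun a => key Θ₂.N (a.1 - c, a.2)) (shE_involutive (c := c) Θ₂.E_E)
    · intro a ha
      rw [Finset.mem_filter] at ha ⊢
      exact ⟨(hC _).2 (stepr _ _ ((hC a).1 ha.1)), hV2' a ha.2⟩
    · intro a ha
      rw [Finset.mem_filter] at ha
      exact hV2 a (hCV a ha.1) ha.2
    · intro a ha
      rw [Finset.mem_filter] at ha ⊢
      exact ⟨(hD _).2 (stepr _ _ ((hD a).1 ha.1)), hV2' a ha.2⟩
    · intro a ha
      rw [Finset.mem_filter] at ha
      exact hV2 a (hDV a ha.1) ha.2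
    · intro a ha r hr h
      rw [Finset.mem_filter] at ha hr
      exact hCD a ha.1 r hr.1 ((unshift_eq ha.2 hr.2).1 (key_injective _ h))
    · intro a ha r hr
      rw [Finset.mem_filter] at ha hr
      have h1 := ((shE_ne_iff.1 (hV2 a (hCV a ha.1) ha.2))).2
      have h2 := ((shE_ne_iff.1 (hV2 r (hDV r hr.1) hr.2))).2
      have := Θ₂.noncrossing _ h1 _ h2
      simpa [shE, ha.2, hr.2] using this
  -- The even factor of the correction term: the points of `C` in the closed second square are
  -- paired off by the arcs of that square.
  have card2 : ((C.filter (fun a => c ≤ a.1)).card : ZMod 2) = 0 := by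
    apply even_card_of_involution (shE c Θ₂.E) (shE_involutive Θ₂.E_E)
    · intro a ha
      rw [Finset.mem_filter] at ha ⊢
      exact ⟨(hC _).2 (stepr _ _ ((hC a).1 ha.1)), hV2' a ha.2⟩
    · intro a ha
      rw [Finset.mem_filter] at ha
      exact hV2 a (hCV a ha.1) ha.2
  have total : ∑ a ∈ C, ∑ r ∈ D, (if a.1 ≠ c ∧ r.1 ≠ c then
      chi (key N (unstack Θ₁.N r) < key N (unstack Θ₁.N a)) else 0) = 0 := by
    rw [Finset.sum_congr rfl fun a ha => Finset.sum_congr rfl fun r hr =>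
      chi_identity (N₁ := Θ₁.N) (N₂ := Θ₂.N) (hCD a ha r hr)]
    simp only [Finset.sum_add_distrib]
    have split : ∀ (p q : ℕ × ℕ → Prop) [DecidablePred p] [DecidablePred q] (g : ℕ × ℕ → ℕ × ℕ → ZMod 2),
        ∑ a ∈ C, ∑ r ∈ D, (if p a ∧ q r then g a r else 0) =
        ∑ a ∈ C.filter p, ∑ r ∈ D.filter q, g a r := by
      intro p q _ _ g
      rw [Finset.sum_filter]
      refine Finset.sum_congr rfl fun a _ => ?_
      split_ifs with h
      · rw [Finset.sum_filter]
        simp [h]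
      · simp [h]
    rw [split (fun a => a.1 ≤ 2 * Θ₁.N + 1) (fun a => a.1 ≤ 2 * Θ₁.N + 1),
      split (fun a => 2 * Θ₁.N + 1 ≤ a.1) (fun a => 2 * Θ₁.N + 1 ≤ a.1),
      split (fun a => 2 * Θ₁.N + 1 ≤ a.1) (fun a => a.1 ≤ 2 * Θ₁.N + 1) (fun _ _ => 1),
      sum1, sum2]
    rw [Finset.sum_const, nsmul_eq_mul, card2]
    simp
  -- Off the glued site a path has only its two ends, so the total collapses to the four terms of
  -- `not_crosses_iff`.
  have endsC : C.filter (fun a => a.1 ≠ c) = {re c u, re c (e u)} := by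
    ext a
    rw [Finset.mem_filter, hC, Finset.mem_insert, Finset.mem_singleton]
    constructor
    · rintro ⟨h1, h2⟩
      obtain ⟨w, rfl⟩ := mem_range_re.2 h2
      by_cases h : w = u
      · exact Or.inl (h ▸ rfl)
      · exact Or.inr (by rw [he, otherEnd_eq hc h h1])
    · rintro (rfl | rfl)
      · exact ⟨S.refl' _, re_fst_ne _ _⟩
      · exact ⟨hue, re_fst_ne _ _⟩
  have endsD : D.filter (fun a => a.1 ≠ c) = {re c v, re c (e v)} := by
    ext a
    rw [Finset.mem_filter, hD, Finset.mem_insert, Finset.mem_singleton]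
    constructor
    · rintro ⟨h1, h2⟩
      obtain ⟨w, rfl⟩ := mem_range_re.2 h2
      by_cases h : w = v
      · exact Or.inl (h ▸ rfl)
      · exact Or.inr (by rw [he, otherEnd_eq hc h h1])
    · rintro (rfl | rfl)
      · exact ⟨S.refl' _, re_fst_ne _ _⟩
      · exact ⟨hve, re_fst_ne _ _⟩
  have split' : ∑ a ∈ C, ∑ r ∈ D, (if a.1 ≠ c ∧ r.1 ≠ c then
      chi (key N (unstack Θ₁.N r) < key N (unstack Θ₁.N a)) else 0) =
      ∑ a ∈ C.filter (fun a => a.1 ≠ c), ∑ r ∈ D.filter (fun a => a.1 ≠ c),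
        chi (key N (unstack Θ₁.N r) < key N (unstack Θ₁.N a)) := by
    rw [Finset.sum_filter]
    refine Finset.sum_congr rfl fun a _ => ?_
    split_ifs with h
    · rw [Finset.sum_filter]
      simp [h]
    · simp [h]
  have hne : ∀ x y, re c x ≠ re c y ↔ x ≠ y := fun x y => (re_injective c).ne_iff
  rw [split', endsC, endsD, Finset.sum_pair ((hne _ _).2 (Ne.symm hu0)),
    Finset.sum_pair ((hne _ _).2 (Ne.symm hv0)), Finset.sum_pair ((hne _ _).2 (Ne.symm hv0))]
    at total
  simp only [hcdef, unstack_re] at total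
  have dist : ∀ x y, S (re c u) (re c x) → S (re c v) (re c y) → key N x ≠ key N y := by
    intro x y hx hy h
    rw [key_injective N h] at hx
    exact huv (S.trans' hx (S.symm' hy))
  rw [not_crosses_iff (dist _ _ (S.refl' _) (S.refl' _)) (dist _ _ (S.refl' _) hve)
    (dist _ _ hue (S.refl' _)) (dist _ _ hue hve)]
  exact total

/-- The vertical juxtaposition, with `Θ₂` on top of `Θ₁`. -/
noncomputable def juxtDatum (Θ₁ Θ₂ : Datum) (hc : Composable Θ₁ Θ₂) : Datum where
  toFrame := Θ₁.toFrame.concat Θ₂.toFrame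
  E := otherEnd Θ₁ Θ₂
  E_E := otherEnd_otherEnd hc
  E_ne := otherEnd_ne_iff hc
  noncrossing _ hu _ hv := otherEnd_noncrossing hc hu hv

theorem juxtDatum_N (hc : Composable Θ₁ Θ₂) : (juxtDatum Θ₁ Θ₂ hc).N = Θ₁.N + Θ₂.N := rfl

theorem juxtDatum_f (hc : Composable Θ₁ Θ₂) (i : ℕ) : (juxtDatum Θ₁ Θ₂ hc).f i =
    if i ≤ 2 * Θ₁.N then Θ₁.f i else Θ₂.f (i - 2 * Θ₁.N) := rfl

theorem arcS_juxtDatum (hc : Composable Θ₁ Θ₂) :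
    arcS (juxtDatum Θ₁ Θ₂ hc) = Setoid.comap (re (2 * Θ₁.N + 1)) (stackS Θ₁ Θ₂) := by
  ext u v
  rw [Setoid.comap_rel, arcS_iff]
  constructor
  · rintro (rfl | rfl)
    · exact Setoid.refl' _ _
    · exact otherEnd_rel u
  · intro h
    by_cases e : v = u
    · exact Or.inl e.symm
    · exact Or.inr (otherEnd_eq hc e h)

theorem isJuxtaposition_juxtDatum (hc : Composable Θ₁ Θ₂) :
    IsJuxtaposition Θ₁ Θ₂ (juxtDatum Θ₁ Θ₂ hc) :=
  (isJuxtaposition_iff hc).2 ⟨rfl, fun _ => rfl, fun _ => rfl, fun _ => rfl, arcS_juxtDatum hc⟩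

end Juxt

theorem Datum.eq_of_arcS {Θ Θ' : Datum} (hN : Θ.N = Θ'.N) (hP : ∀ i, Θ.P i = Θ'.P i)
    (hs : ∀ i, Θ.s i = Θ'.s i) (hf : ∀ i, Θ.f i = Θ'.f i) (hE : arcS Θ = arcS Θ') : Θ = Θ' := by
  refine Datum.ext' hN hP hs hf fun v => ?_
  have hV : Θ.V = Θ'.V := by rw [← supp_arcS, hE, supp_arcS]
  by_cases hv : v ∈ Θ.V
  · have h : arcS Θ v (Θ.E v) := Or.inr rfl
    rw [hE] at h
    rcases h with h | h
    · exact absurd h.symm ((Θ.E_ne v).2 hv)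
    · exact h.symm
  · rw [Datum.E_out hv, Datum.E_out (hV ▸ hv)]

theorem IsJuxtaposition.unique {Θ₁ Θ₂ Θ Θ' : Datum} (hc : Composable Θ₁ Θ₂)
    (h : IsJuxtaposition Θ₁ Θ₂ Θ) (h' : IsJuxtaposition Θ₁ Θ₂ Θ') : Θ = Θ' := by
  rw [isJuxtaposition_iff hc] at h h'
  obtain ⟨hN, hP, hs, hf, hE⟩ := h
  obtain ⟨hN', hP', hs', hf', hE'⟩ := h'
  exact Datum.eq_of_arcS (hN.trans hN'.symm) (fun i => (hP i).trans (hP' i).symm)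
    (fun i => (hs i).trans (hs' i).symm) (fun i => (hf i).trans (hf' i).symm) (hE.trans hE'.symm)

/-- The vertical juxtaposition of data with prescribed types. -/
noncomputable def juxt {n m l : ℕ} (Θ₁ : Sq n m) (Θ₂ : Sq m l) : Sq n l :=
  ⟨juxtDatum Θ₁.1 Θ₂.1 (Sq.composable Θ₁ Θ₂), by
    rw [juxtDatum_f, if_pos (Nat.zero_le _)]
    exact Θ₁.2.1, by
    have e : 2 * (Θ₁.1.N + Θ₂.1.N) + 1 - 2 * Θ₁.1.N = 2 * Θ₂.1.N + 1 := by omega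
    rw [juxtDatum_f, juxtDatum_N, if_neg (by omega), e]
    exact Θ₂.2.2⟩

theorem juxt_spec {n m l : ℕ} (Θ₁ : Sq n m) (Θ₂ : Sq m l) :
    IsJuxtaposition Θ₁.1 Θ₂.1 (juxt Θ₁ Θ₂).1 :=
  isJuxtaposition_juxtDatum (Sq.composable Θ₁ Θ₂)

theorem juxt_eq {n m l : ℕ} {Θ₁ : Sq n m} {Θ₂ : Sq m l} {Θ : Sq n l}
    (h : IsJuxtaposition Θ₁.1 Θ₂.1 Θ.1) : juxt Θ₁ Θ₂ = Θ :=
  Subtype.ext ((juxt_spec Θ₁ Θ₂).unique (Sq.composable Θ₁ Θ₂) h)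

end SWB

namespace SWB

/-! ### Duality -/

theorem flip_flip (N i : ℕ) : flip N (flip N i) = i := by
  unfold flip
  split_ifs <;> omega

theorem flip_internal {N i : ℕ} : (1 ≤ flip N i ∧ flip N i ≤ 2 * N) ↔ (1 ≤ i ∧ i ≤ 2 * N) := by
  unfold flip
  split_ifs <;> omega

theorem flip_inj {N i j : ℕ} : flip N i = flip N j ↔ i = j :=
  ⟨fun h => by rw [← flip_flip N i, h, flip_flip], fun h => h ▸ rfl⟩

theorem flip_le {N i : ℕ} : flip N i ≤ 2 * N + 1 ↔ i ≤ 2 * N + 1 := by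
  unfold flip
  split_ifs <;> omega

def ChordDatum.dual (c : ChordDatum) : ChordDatum where
  N := c.N
  P i := flip c.N (c.P (flip c.N i))
  s i := c.s (flip c.N i)
  P_P i := by simp only [flip_flip, c.P_P]
  P_ne i := by
    rw [← flip_internal (N := c.N), ← c.P_ne, not_iff_not]
    nth_rw 2 [← flip_inj (N := c.N)]
    rw [flip_flip]
  s_P i := by simp only [flip_flip, c.s_P]
  s_out i h := c.s_out _ (by rwa [flip_internal])

def ChordDatum.dualHom (c : ChordDatum) : c.boundaryGraph →g c.dual.boundaryGraph where
  toFun x := ⟨(flip c.N x.1.1, !x.1.2), flip_internal.2 x.2⟩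
  map_rel' := by
    rintro ⟨⟨i, a⟩, hx⟩ ⟨⟨j, b⟩, hy⟩ h
    unfold boundaryGraph at h ⊢
    rw [SimpleGraph.fromRel_adj] at h ⊢
    refine ⟨fun e => h.1 ?_, ?_⟩
    · replace e := congrArg Subtype.val e
      simp only [Prod.mk.injEq, flip_inj, Bool.not_inj_iff] at e
      simp [e]
    · replace h := h.2
      simp only at hx hy
      have h1 : (flip c.N i = flip c.N j + 1) ↔ j = i + 1 := by
        unfold flip
        split_ifs <;> omega
      have h2 : (flip c.N j = flip c.N i + 1) ↔ i = j + 1 := by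
        unfold flip
        split_ifs <;> omega
      simp only [dual, flip_flip, flip_inj, h1, h2] at h ⊢
      have h3 : ∀ (x y : Bool) (p : Prop) [Decidable p], ((!x) = if p then !!y else !y) ↔
          (x = if p then !y else y) := by
        intro x y p _
        split_ifs <;> simp
      simp only [h3]
      simp only [Bool.not_eq_eq_eq_not, Bool.not_true, Bool.not_false]
      tauto

theorem ChordDatum.dual_preconnected {c : ChordDatum} (h : c.boundaryGraph.Preconnected) :
    c.dual.boundaryGraph.Preconnected := by
  intro x y
  have hs : ∀ x, ∃ z, c.dualHom z = x := fun x =>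
    ⟨⟨(flip c.N x.1.1, !x.1.2), flip_internal.2 x.2⟩,
      Subtype.ext (by simp [dualHom, flip_flip])⟩
  obtain ⟨x, rfl⟩ := hs x
  obtain ⟨y, rfl⟩ := hs y
  exact (h x y).map _

def Frame.dual (F : Frame) : Frame where
  toChordDatum := F.toChordDatum.dual
  f i := F.f (flip F.N i)
  f_P i := by simp only [ChordDatum.dual, flip_flip, F.f_P]
  f_out i h := F.f_out _ (by
    change 2 * F.N + 1 < i at h
    rw [← not_le, flip_le, not_le]
    exact h)
  oneBoundary := ChordDatum.dual_preconnected F.oneBoundary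

/-- The order reversing bijection from the vertices of a frame to those of its dual. -/
def Frame.dm (F : Frame) (v : ℕ × ℕ) : ℕ × ℕ :=
  (flip F.N v.1, if (1 ≤ v.1 ∧ v.1 ≤ 2 * F.N) ∧ 1 ≤ v.2 ∧ v.2 ≤ F.f v.1 then F.f v.1 + 1 - v.2
    else v.2)

theorem reflect_reflect (p : Prop) [Decidable p] (M a : ℕ) :
    (if p ∧ 1 ≤ (if p ∧ 1 ≤ a ∧ a ≤ M then M + 1 - a else a) ∧
      (if p ∧ 1 ≤ a ∧ a ≤ M then M + 1 - a else a) ≤ M then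
      M + 1 - (if p ∧ 1 ≤ a ∧ a ≤ M then M + 1 - a else a)
      else (if p ∧ 1 ≤ a ∧ a ≤ M then M + 1 - a else a)) = a := by
  by_cases h : p ∧ 1 ≤ a ∧ a ≤ M
  · simp only [if_pos h]
    rw [if_pos ⟨h.1, by omega, by omega⟩]
    omega
  · simp only [if_neg h]

theorem Frame.dual_dm_dm (F : Frame) (v : ℕ × ℕ) : F.dual.dm (F.dm v) = v := by
  obtain ⟨i, a⟩ := v
  simp only [Frame.dm, Frame.dual, ChordDatum.dual, flip_flip, flip_internal]
  exact Prod.ext rfl (reflect_reflect _ _ _)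

theorem Frame.dm_dual_dm (F : Frame) (v : ℕ × ℕ) : F.dm (F.dual.dm v) = v := by
  obtain ⟨i, a⟩ := v
  simp only [Frame.dm, Frame.dual, ChordDatum.dual, flip_flip, flip_internal]
  exact Prod.ext rfl (reflect_reflect _ _ _)

theorem Frame.dm_injective (F : Frame) : Function.Injective F.dm := fun u v h => by
  rw [← F.dual_dm_dm u, h, F.dual_dm_dm]

theorem Frame.dm_mem {F : Frame} {v : ℕ × ℕ} : F.dm v ∈ F.dual.V ↔ v ∈ F.V := by
  obtain ⟨i, a⟩ := v
  simp only [Frame.mem_V, Frame.dm, Frame.dual, flip_flip]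
  split_ifs <;> omega

theorem Frame.dual_dm_mem {F : Frame} {v : ℕ × ℕ} : F.dual.dm v ∈ F.V ↔ v ∈ F.dual.V := by
  rw [← dm_mem, dm_dual_dm]

theorem Frame.dm_image (F : Frame) : F.dm '' F.V = F.dual.V := by
  ext v
  constructor
  · rintro ⟨u, hu, rfl⟩
    exact dm_mem.2 hu
  · intro hv
    exact ⟨F.dual.dm v, dual_dm_mem.2 hv, F.dm_dual_dm v⟩

theorem Frame.dm_fst (F : Frame) (v : ℕ × ℕ) : (F.dm v).1 = flip F.N v.1 := rfl

theorem Frame.dm_internal {F : Frame} {v : ℕ × ℕ} : F.dual.Internal (F.dm v) ↔ F.Internal v :=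
  flip_internal

theorem Frame.dm_iota {F : Frame} {v : ℕ × ℕ} (hv : v ∈ F.V) (hi : F.Internal v) :
    F.dual.iota (F.dm v) = F.dm (F.iota v) := by
  obtain ⟨i, a⟩ := v
  have h1 := F.P_mem hi
  have h2 := F.f_P i
  simp only [Frame.mem_V, Frame.Internal] at hv hi
  simp only [Frame.iota, Frame.dm, Frame.dual, ChordDatum.dual, flip_flip, h2, h1.1, h1.2, hi.1,
    hi.2, hv.1, hv.2, true_and, if_true]
  refine Prod.ext rfl ?_
  dsimp only
  split_ifs <;> omega

/-- Heights are reflected at internal sites. On the horizontal edges they are kept, but the order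
convention is reversed only on the top edge, so exchanging these edges reverses the order as well.
The constant `M` is free so that the same computation covers vertices and the doubled coordinates of
regions. -/
theorem key_lt_flip {N : ℕ} {M : ℕ → ℕ} {u v u' v' : ℕ × ℕ} (hu : u.1 ≤ 2 * N + 1)
    (hv : v.1 ≤ 2 * N + 1) (hu' : u'.1 = flip N u.1) (hv' : v'.1 = flip N v.1)
    (hu2 : if 1 ≤ u.1 ∧ u.1 ≤ 2 * N then u'.2 + u.2 = M u.1 else u'.2 = u.2)
    (hv2 : if 1 ≤ v.1 ∧ v.1 ≤ 2 * N then v'.2 + v.2 = M v.1 else v'.2 = v.2) :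
    key N u' < key N v' ↔ key N v < key N u := by
  rw [key_lt_iff, key_lt_iff, hu', hv']
  obtain ⟨i, a⟩ := u
  obtain ⟨j, b⟩ := v
  simp only at hu hv hu2 hv2 ⊢
  by_cases e : i = j
  · subst e
    unfold flip
    split_ifs at hu2 hv2 ⊢ <;> omega
  · unfold flip
    split_ifs at hu2 hv2 ⊢ <;> omega

theorem Frame.dm_spec {F : Frame} {v : ℕ × ℕ} (hv : v ∈ F.V) :
    if 1 ≤ v.1 ∧ v.1 ≤ 2 * F.N then (F.dm v).2 + v.2 = F.f v.1 + 1 else (F.dm v).2 = v.2 := by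
  rw [Frame.mem_V] at hv
  unfold Frame.dm
  dsimp only
  split_ifs <;> omega

theorem Frame.dm_lt {F : Frame} {u v : ℕ × ℕ} (hu : u ∈ F.V) (hv : v ∈ F.V) :
    key F.N (F.dm u) < key F.N (F.dm v) ↔ key F.N v < key F.N u :=
  key_lt_flip (M := fun i => F.f i + 1) (Frame.site_le hu) (Frame.site_le hv) rfl rfl (dm_spec hu)
    (dm_spec hv)

/-- Crossing is invariant under reversal of the order. The maps are compared only on `S`, so the
minima and maxima are resolved by cases before comparing. -/
theorem crosses_anti {L L' : Type*} [LinearOrder L] [LinearOrder L'] {α : Type*} {κ : α → L}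
    {κ' : α → L'} {S : Set α} (h : ∀ x ∈ S, ∀ y ∈ S, κ' x < κ' y ↔ κ y < κ x) {a b c d : α}
    (ha : a ∈ S) (hb : b ∈ S) (hc : c ∈ S) (hd : d ∈ S) :
    Crosses (κ' a) (κ' b) (κ' c) (κ' d) ↔ Crosses (κ a) (κ b) (κ c) (κ d) := by
  have h' : ∀ x ∈ S, ∀ y ∈ S, κ' x ≤ κ' y ↔ κ y ≤ κ x := fun x hx y hy => by
    rw [← not_lt, ← not_lt, h y hy x hx]
  unfold Crosses
  rcases le_total (κ a) (κ b) with hab | hab <;> rcases le_total (κ c) (κ d) with hcd | hcd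
  · rw [min_eq_left hab, max_eq_right hab, min_eq_left hcd, max_eq_right hcd,
      min_eq_right ((h' b hb a ha).2 hab), max_eq_left ((h' b hb a ha).2 hab),
      min_eq_right ((h' d hd c hc).2 hcd), max_eq_left ((h' d hd c hc).2 hcd),
      h _ hb _ hd, h _ hd _ ha, h _ ha _ hc, h _ hd _ hb, h _ hb _ hc, h _ hc _ ha]
    tauto
  · rw [min_eq_left hab, max_eq_right hab, min_eq_right hcd, max_eq_left hcd,
      min_eq_right ((h' b hb a ha).2 hab), max_eq_left ((h' b hb a ha).2 hab),
      min_eq_left ((h' c hc d hd).2 hcd), max_eq_right ((h' c hc d hd).2 hcd),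
      h _ hb _ hc, h _ hc _ ha, h _ ha _ hd, h _ hc _ hb, h _ hb _ hd, h _ hd _ ha]
    tauto
  · rw [min_eq_right hab, max_eq_left hab, min_eq_left hcd, max_eq_right hcd,
      min_eq_left ((h' a ha b hb).2 hab), max_eq_right ((h' a ha b hb).2 hab),
      min_eq_right ((h' d hd c hc).2 hcd), max_eq_left ((h' d hd c hc).2 hcd),
      h _ ha _ hd, h _ hd _ hb, h _ hb _ hc, h _ hd _ ha, h _ ha _ hc, h _ hc _ hb]
    tauto
  · rw [min_eq_right hab, max_eq_left hab, min_eq_right hcd, max_eq_left hcd,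
      min_eq_left ((h' a ha b hb).2 hab), max_eq_right ((h' a ha b hb).2 hab),
      min_eq_left ((h' c hc d hd).2 hcd), max_eq_right ((h' c hc d hd).2 hcd),
      h _ ha _ hc, h _ hc _ hb, h _ hb _ hd, h _ hc _ ha, h _ ha _ hd, h _ hd _ hb]
    tauto

/-- The dual of a square with bands datum. -/
def Datum.dual (Θ : Datum) : Datum where
  toFrame := Θ.toFrame.dual
  E v := Θ.dm (Θ.E (Θ.toFrame.dual.dm v))
  E_E v := by rw [Frame.dual_dm_dm, Θ.E_E, Frame.dm_dual_dm]
  E_ne v := by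
    rw [← Frame.dual_dm_mem, ← Θ.E_ne, not_iff_not]
    constructor
    · intro h
      conv_rhs => rw [← h]
      rw [Frame.dual_dm_dm]
    · intro h
      rw [h, Frame.dm_dual_dm]
  noncrossing u hu v hv := by
    obtain ⟨u, rfl⟩ : ∃ w, Θ.dm w = u := ⟨_, Θ.dm_dual_dm u⟩
    obtain ⟨v, rfl⟩ : ∃ w, Θ.dm w = v := ⟨_, Θ.dm_dual_dm v⟩
    rw [Frame.dm_mem] at hu hv
    rw [Frame.dual_dm_dm, Frame.dual_dm_dm]
    have := crosses_anti (κ := key Θ.N) (κ' := fun w => key Θ.N (Θ.dm w)) (S := Θ.V)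
      (fun x hx y hy => Frame.dm_lt hx hy) hu (Datum.E_mem hu) hv (Datum.E_mem hv)
    exact fun h => Θ.noncrossing u hu v hv (this.1 h)

theorem Datum.dual_E_dm (Θ : Datum) (v : ℕ × ℕ) : Θ.dual.E (Θ.dm v) = Θ.dm (Θ.E v) := by
  change Θ.dm (Θ.E (Θ.toFrame.dual.dm (Θ.dm v))) = _
  rw [Frame.dual_dm_dm]

theorem Datum.dual_N (Θ : Datum) : Θ.dual.N = Θ.N := rfl

theorem Datum.dual_P (Θ : Datum) (i : ℕ) : Θ.dual.P i = flip Θ.N (Θ.P (flip Θ.N i)) := rfl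

theorem Datum.dual_s (Θ : Datum) (i : ℕ) : Θ.dual.s i = Θ.s (flip Θ.N i) := rfl

theorem Datum.dual_f (Θ : Datum) (i : ℕ) : Θ.dual.f i = Θ.f (flip Θ.N i) := rfl

theorem Datum.dual_dm_dm (Θ : Datum) (v : ℕ × ℕ) : Θ.dual.dm (Θ.dm v) = v :=
  Frame.dual_dm_dm _ v

theorem Datum.dm_dual_dm (Θ : Datum) (v : ℕ × ℕ) : Θ.dm (Θ.dual.dm v) = v :=
  Frame.dm_dual_dm _ v

theorem Datum.dm_mem {Θ : Datum} {v : ℕ × ℕ} : Θ.dm v ∈ Θ.dual.V ↔ v ∈ Θ.V := Frame.dm_mem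

/-- The order reversing bijection in the definition is forced: followed by the inverse of `dm` it is
an order preserving self-bijection of a finite set, hence the identity. -/
theorem isDual_iff {Θ Θ' : Datum} : IsDual Θ Θ' ↔ Θ' = Θ.dual := by
  constructor
  · rintro ⟨hN, hP, hs, hf, o, ho, hm, hE⟩
    have hV : Θ'.V = Θ.dual.V := by
      ext v
      rw [Frame.mem_V, Frame.mem_V, hf, Θ.dual_f]
    have hd : IsOP Θ.N Θ.V Θ.V (Θ.dual.dm ∘ o) := by
      have hb : Set.BijOn Θ.dual.dm Θ.dual.V Θ.V := by
        refine ⟨fun v hv => ?_, (Frame.dm_injective _).injOn, fun v hv => ?_⟩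
        · exact Frame.dual_dm_mem.2 hv
        · exact ⟨Θ.dm v, Datum.dm_mem.2 hv, Θ.dual_dm_dm v⟩
      refine ⟨hb.comp (hV ▸ ho), fun u hu v hv h => ?_⟩
      have := hm u hu v hv h
      have e : ∀ w ∈ Θ.V, o w ∈ Θ.dual.V := fun w hw => hV ▸ ho.mapsTo hw
      exact (Frame.dm_lt (F := Θ.dual.toFrame) (e u hu) (e v hv)).2 this
    have hfix := hd.fixed Θ.V_finite subset_rfl subset_rfl (fun _ _ u hu _ => hu)
      (fun _ _ u hu _ => hu)
    have ho' : ∀ v ∈ Θ.V, o v = Θ.dm v := fun v hv => by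
      conv_rhs => rw [← hfix v hv]
      exact (Θ.dm_dual_dm _).symm
    refine Datum.ext' hN hP hs hf fun v => ?_
    by_cases hv : v ∈ Θ.dual.V
    · obtain ⟨w, rfl⟩ : ∃ w, Θ.dm w = v := ⟨_, Θ.dm_dual_dm v⟩
      rw [Datum.dm_mem] at hv
      rw [Θ.dual_E_dm, ← ho' w hv, hE w hv, ho' _ (Datum.E_mem hv)]
    · rw [Datum.E_out hv, Datum.E_out (hV ▸ hv)]
  · rintro rfl
    refine ⟨rfl, fun _ => rfl, fun _ => rfl, fun _ => rfl, Θ.dm, ?_, ?_, fun v _ => Θ.dual_E_dm v⟩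
    · refine ⟨fun v hv => Datum.dm_mem.2 hv, (Frame.dm_injective _).injOn, fun v hv => ?_⟩
      exact ⟨Θ.dual.dm v, Frame.dual_dm_mem.2 hv, Θ.dm_dual_dm v⟩
    · exact fun u hu v hv h => (Frame.dm_lt hv hu).2 h

theorem Datum.dual_dual (Θ : Datum) : Θ.dual.dual = Θ := by
  refine Datum.ext' rfl (fun i => ?_) (fun i => ?_) (fun i => ?_) (fun v => ?_)
  · simp only [dual_P, dual_N, flip_flip]
  · simp only [dual_s, dual_N, flip_flip]
  · simp only [dual_f, dual_N, flip_flip]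
  · obtain ⟨w, rfl⟩ : ∃ w, Θ.dual.dm w = v := ⟨Θ.dm v, Θ.dual_dm_dm v⟩
    rw [Θ.dual.dual_E_dm, ← Θ.dm_dual_dm w, Θ.dual_E_dm, Θ.dual_dm_dm, Θ.dual_dm_dm]

theorem arcS_dual (Θ : Datum) : arcS Θ.dual = Setoid.comap Θ.dual.dm (arcS Θ) := by
  ext u v
  rw [Setoid.comap_rel, arcS_iff, arcS_iff, (Frame.dm_injective _).eq_iff]
  refine or_congr_right ?_
  change Θ.dm (Θ.E (Θ.dual.dm u)) = v ↔ _
  exact ⟨fun h => by rw [← h, Θ.dual_dm_dm], fun h => by rw [h, Θ.dm_dual_dm]⟩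

/-- The dual of a datum with prescribed type. -/
def dualSq {n m : ℕ} (Θ : Sq n m) : Sq m n :=
  ⟨Θ.1.dual, by
    rw [Datum.dual_f]
    exact Θ.2.2, by
    rw [Datum.dual_f, Datum.dual_N]
    have : flip Θ.1.N (2 * Θ.1.N + 1) = 0 := by simp [flip]
    rw [this]
    exact Θ.2.1⟩

theorem dualSq_dualSq {n m : ℕ} (Θ : Sq n m) : dualSq (dualSq Θ) = Θ :=
  Subtype.ext Θ.1.dual_dual

/-! ### Duals of juxtapositions -/

/-- The order reversing bijection of the vertices of a stack. -/
def dst (A B : Datum) (v : ℕ × ℕ) : ℕ × ℕ :=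
  if v.1 ≤ 2 * A.N + 1 then ((A.dm v).1 + (2 * B.N + 1), (A.dm v).2)
  else if v.1 ≤ 2 * A.N + 1 + (2 * B.N + 1) then B.dm (v.1 - (2 * A.N + 1), v.2)
  else v

theorem dm_site_le {A : Datum} {v : ℕ × ℕ} (h : v.1 ≤ 2 * A.N + 1) : (A.dm v).1 ≤ 2 * A.N + 1 :=
  flip_le.2 h

theorem dm_mid {A : Datum} {v : ℕ × ℕ} (h : v.1 = 0 ∨ v.1 = 2 * A.N + 1) :
    A.dm v = (flip A.N v.1, v.2) := by
  unfold Frame.dm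
  rw [if_neg (by omega)]

theorem dst_dst (A B : Datum) (v : ℕ × ℕ) : dst B.dual A.dual (dst A B v) = v := by
  by_cases h1 : v.1 ≤ 2 * A.N + 1
  · by_cases h2 : v.1 = 2 * A.N + 1
    · have e1 : dst A B v = (2 * B.N + 1, v.2) := by
        rw [dst, if_pos h1, dm_mid (Or.inr h2), h2]
        simp [flip]
      rw [e1, dst, Datum.dual_N, Datum.dual_N, if_pos (le_refl _), dm_mid (Or.inr rfl),
        Datum.dual_N, ← h2]
      simp [flip]
    · have e1 : dst A B v = ((A.dm v).1 + (2 * B.N + 1), (A.dm v).2) := by rw [dst, if_pos h1]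
      have h3 := dm_site_le h1
      have h4 : (A.dm v).1 ≠ 0 := by
        rw [Frame.dm_fst]
        unfold flip
        split_ifs; omega
      rw [e1, dst, Datum.dual_N, Datum.dual_N, if_neg (by dsimp only; omega),
        if_pos (by dsimp only; omega)]
      dsimp only
      rw [Nat.add_sub_cancel]
      exact A.dual_dm_dm v
  · by_cases h2 : v.1 ≤ 2 * A.N + 1 + (2 * B.N + 1)
    · have e1 : dst A B v = B.dm (v.1 - (2 * A.N + 1), v.2) := by rw [dst, if_neg h1, if_pos h2]
      have h3 : (B.dm (v.1 - (2 * A.N + 1), v.2)).1 ≤ 2 * B.N + 1 :=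
        dm_site_le (by dsimp only; omega)
      rw [e1, dst, Datum.dual_N, Datum.dual_N, if_pos h3, B.dual_dm_dm]
      exact Prod.ext (by dsimp only; omega) rfl
    · have e1 : dst A B v = v := by rw [dst, if_neg h1, if_neg h2]
      rw [e1, dst, Datum.dual_N, Datum.dual_N, if_neg (by omega), if_neg (by omega)]

theorem dst_surjective (A B : Datum) : Function.Surjective (dst A B) := fun v => by
  refine ⟨dst B.dual A.dual v, ?_⟩
  have := dst_dst B.dual A.dual v
  rwa [A.dual_dual, B.dual_dual] at this

theorem dst_injective (A B : Datum) : Function.Injective (dst A B) := fun u v h => by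
  rw [← dst_dst A B u, h, dst_dst]

/-- Turning the stack upside down makes each square the dual of itself and exchanges their roles, so
the two terms of the join are swapped. Pullback distributes over the join because `dst` is
surjective. -/
theorem stackS_dual (A B : Datum) :
    stackS A B = Setoid.comap (dst A B) (stackS B.dual A.dual) := by
  have hA : arcS A = Setoid.comap A.dm (arcS A.dual) := by
    have := arcS_dual A.dual
    rwa [A.dual_dual] at this
  have hB : arcS B = Setoid.comap B.dm (arcS B.dual) := by
    have := arcS_dual B.dual
    rwa [B.dual_dual] at this
  rw [comap_sup _ _ _ (by rw [(dst_surjective A B).range_eq]; exact Set.subset_univ _)]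
  refine Eq.trans ?_ (sup_comm _ _)
  refine congrArg₂ (· ⊔ ·) ?_ ?_
  · ext u v
    rw [Setoid.comap_rel, shS_iff, arcS_iff, arcS_iff, ← arcS_iff, ← arcS_iff,
      (dst_injective A B).eq_iff]
    by_cases huv : u = v
    · rw [huv]
      simp
    have key : ∀ w, w.1 ≤ 2 * A.N + 1 → 2 * B.N + 1 ≤ (dst A B w).1 ∧
        ((dst A B w).1 - (2 * B.N + 1), (dst A B w).2) = A.dm w := by
      intro w hw
      rw [dst, if_pos hw]
      simp
    simp only [huv, false_or, Datum.dual_N]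
    by_cases hu : u.1 ≤ 2 * A.N + 1
    · by_cases hv : v.1 ≤ 2 * A.N + 1
      · rw [(key u hu).2, (key v hv).2, hA, Setoid.comap_rel]
        simp [(key u hu).1, (key v hv).1]
      · constructor
        · intro h
          refine absurd (mem_supp_right h huv) ?_
          rw [supp_arcS]
          exact fun h => hv (Frame.site_le h)
        · rintro ⟨h1, h2, h3⟩
          exfalso
          have h4 := mem_supp_right h3 (fun e => huv ((dst_injective A B) ((unshift_eq h1 h2).1 e)))
          rw [supp_arcS] at h4
          by_cases hv2 : v.1 ≤ 2 * A.N + 1 + (2 * B.N + 1)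
          · rw [dst, if_neg hv, if_pos hv2, Frame.dm_fst] at h2
            unfold flip at h2
            simp only at h2
            split_ifs at h2 <;> omega
          · have := Frame.site_le h4
            rw [dst, if_neg hv, if_neg hv2, A.dual_N] at this
            dsimp only at this
            omega
    · constructor
      · intro h
        refine absurd (mem_supp_left h huv) ?_
        rw [supp_arcS]
        exact fun h => hu (Frame.site_le h)
      · rintro ⟨h1, h2, h3⟩
        exfalso
        have h4 := mem_supp_left h3 (fun e => huv ((dst_injective A B) ((unshift_eq h1 h2).1 e)))
        rw [supp_arcS] at h4
        by_cases hv2 : u.1 ≤ 2 * A.N + 1 + (2 * B.N + 1)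
        · rw [dst, if_neg hu, if_pos hv2, Frame.dm_fst] at h1
          unfold flip at h1
          simp only at h1
          split_ifs at h1 <;> omega
        · have := Frame.site_le h4
          rw [dst, if_neg hu, if_neg hv2, A.dual_N] at this
          dsimp only at this
          omega
  · ext u v
    rw [Setoid.comap_rel, shS_iff]
    by_cases huv : u = v
    · rw [huv]
      simp
    have key : ∀ w, 2 * A.N + 1 ≤ w.1 → w.1 ≤ 2 * A.N + 1 + (2 * B.N + 1) →
        dst A B w = B.dm (w.1 - (2 * A.N + 1), w.2) := by
      intro w hw hw2
      by_cases h : w.1 ≤ 2 * A.N + 1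
      · have h' : w.1 = 2 * A.N + 1 := le_antisymm h hw
        rw [dst, if_pos h, dm_mid (Or.inr h'), dm_mid (Or.inl (by simp [h'])), h']
        simp [flip]
      · rw [dst, if_neg h, if_pos hw2]
    have hlow : ∀ w, w.1 < 2 * A.N + 1 → 2 * B.N + 1 < (dst A B w).1 := by
      intro w hw
      rw [dst, if_pos hw.le]
      dsimp only
      rw [Frame.dm_fst]
      unfold flip
      split_ifs <;> omega
    have hhigh : ∀ w, 2 * A.N + 1 + (2 * B.N + 1) < w.1 → dst A B w = w := by
      intro w hw
      rw [dst, if_neg (by omega), if_neg (by omega)]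
    have out : ∀ w, arcS B.dual (dst A B u) (dst A B v) → (w = u ∨ w = v) →
        2 * A.N + 1 ≤ w.1 ∧ w.1 ≤ 2 * A.N + 1 + (2 * B.N + 1) := by
      intro w h hw
      have hs : dst A B w ∈ supp (arcS B.dual) := by
        rcases hw with rfl | rfl
        · exact mem_supp_left h (fun e => huv (dst_injective A B e))
        · exact mem_supp_right h (fun e => huv (dst_injective A B e))
      rw [supp_arcS] at hs
      have hle := Frame.site_le hs
      rw [B.dual_N] at hle
      constructor
      · by_contra hlt
        have := hlow w (by omega)
        omega
      · by_contra hlt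
        rw [hhigh w (by omega)] at hle
        omega
    simp only [huv, false_or]
    constructor
    · rintro ⟨h1, h2, h⟩
      have hs : ∀ w, w = u ∨ w = v → w.1 ≤ 2 * A.N + 1 + (2 * B.N + 1) := by
        intro w hw
        have hs : (w.1 - (2 * A.N + 1), w.2) ∈ supp (arcS B) := by
          rcases hw with rfl | rfl
          · exact mem_supp_left h (fun e => huv ((unshift_eq h1 h2).1 e))
          · exact mem_supp_right h (fun e => huv ((unshift_eq h1 h2).1 e))
        rw [supp_arcS] at hs
        have := Frame.site_le hs
        dsimp only at this
        omega
      rw [key u h1 (hs u (Or.inl rfl)), key v h2 (hs v (Or.inr rfl))]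
      rwa [hB, Setoid.comap_rel] at h
    · intro h
      have h1 := out u h (Or.inl rfl)
      have h2 := out v h (Or.inr rfl)
      refine ⟨h1.1, h2.1, ?_⟩
      rw [hB, Setoid.comap_rel, ← key u h1.1 h1.2, ← key v h2.1 h2.2]
      exact h

theorem Composable.dual {A B : Datum} (h : Composable A B) : Composable B.dual A.dual := by
  unfold Composable
  rw [Datum.dual_f, Datum.dual_f, Datum.dual_N]
  have e : flip B.N (2 * B.N + 1) = 0 := by simp [flip]
  have e' : flip A.N 0 = 2 * A.N + 1 := by simp [flip]
  rw [e, e']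
  exact h.symm

/-- `dst` maps the glued vertices of one stack onto those of the other without changing their
heights, so closed classes correspond. -/
theorem linking_dual (A B : Datum) (hc : Composable A B) :
    linking B.dual A.dual = linking A B := by
  rw [linking_eq, linking_eq, stackS_dual A B, loops_comap _ (dst_injective A B) _ _
    (stackMid_finite A B) (fun v _ w _ => (dst_surjective A B) w)]
  congr 1
  ext v
  have hm : ∀ {A B : Datum}, Composable A B → ∀ {w : ℕ × ℕ}, w ∈ stackMid A B ↔
      w.1 = 2 * A.N + 1 ∧ 1 ≤ w.2 ∧ w.2 ≤ B.f 0 := by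
    intro A B hc w
    constructor
    · rintro ⟨h1, h2⟩
      refine ⟨h2, ?_⟩
      rw [mem_stackV] at h1
      simp only [Frame.mem_V, h2, Nat.sub_self] at h1
      rw [hc] at h1
      tauto
    · rintro ⟨h1, h2⟩
      refine ⟨mem_stackV.2 (Or.inl ?_), h1⟩
      rw [Frame.mem_V, h1, hc]
      exact h2
  have e' : flip A.N 0 = 2 * A.N + 1 := by simp [flip]
  rw [hm hc.dual, Datum.dual_N, Datum.dual_f, e', hc]
  constructor
  · rintro ⟨h1, h2⟩
    refine ⟨(2 * A.N + 1, v.2), (hm hc).2 ⟨rfl, h2⟩, ?_⟩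
    rw [dst, if_pos (le_refl _), dm_mid (Or.inr rfl)]
    simp only [flip, le_refl, if_true, Nat.sub_self, zero_add]
    rw [← h1]
  · rintro ⟨w, hw, rfl⟩
    rw [hm hc] at hw
    rw [dst, if_pos hw.1.le, dm_mid (Or.inr hw.1), hw.1]
    simp only [flip, le_refl, if_true, Nat.sub_self, zero_add, true_and]
    exact hw.2

/-- The arithmetic of sites is routine; for the arcs, the point is that order reversal commutes with
skipping the glued site. -/
theorem IsJuxtaposition.dual {A B Θ : Datum} (hc : Composable A B) (h : IsJuxtaposition A B Θ) :
    IsJuxtaposition B.dual A.dual Θ.dual := by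
  rw [isJuxtaposition_iff hc] at h
  obtain ⟨hN, hP, hs, hf, hE⟩ := h
  rw [isJuxtaposition_iff hc.dual]
  have site : ∀ i, (i ≤ 2 * B.N → 1 ≤ i → (flip Θ.N i = flip B.N i + 2 * A.N ∧
      ¬ flip Θ.N i ≤ 2 * A.N)) ∧ (¬ i ≤ 2 * B.N → i ≤ 2 * Θ.N + 1 →
      flip Θ.N i = flip A.N (i - 2 * B.N) ∧ flip Θ.N i ≤ 2 * A.N) := by
    intro i
    rw [hN]
    unfold flip
    split_ifs <;> omega
  have f0 : flip Θ.N 0 = 2 * Θ.N + 1 := by simp [flip]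
  have f0B : flip B.N 0 = 2 * B.N + 1 := by simp [flip]
  have hfd : ∀ i, Θ.dual.f i = if i ≤ 2 * B.N then B.dual.f i else A.dual.f (i - 2 * B.N) := by
    intro i
    rw [Datum.dual_f, Datum.dual_f, Datum.dual_f, hf]
    by_cases h : i ≤ 2 * B.N
    · rcases Nat.eq_zero_or_pos i with rfl | h1
      · rw [f0, if_neg (by omega), if_pos h, f0B]
        congr 1
        omega
      · obtain ⟨e, e'⟩ := (site i).1 h h1
        rw [if_neg e', if_pos h, e, Nat.add_sub_cancel]
    · rw [if_neg h]
      by_cases h1 : i ≤ 2 * Θ.N + 1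
      · obtain ⟨e, e'⟩ := (site i).2 h h1
        rw [if_pos e', e]
      · have e : flip Θ.N i = i := by simp [flip, h1]
        have e2 : flip A.N (i - 2 * B.N) = i - 2 * B.N := by
          unfold flip
          rw [if_neg (by omega)]
        rw [e, e2, if_neg (by omega), B.f_out _ (by omega), A.f_out _ (by omega)]
  refine ⟨by rw [Datum.dual_N, hN, add_comm, Datum.dual_N, Datum.dual_N], fun i => ?_,
    fun i => ?_, hfd, ?_⟩
  · by_cases hi : 1 ≤ i ∧ i ≤ 2 * Θ.N
    · rw [Datum.dual_P, hP, Datum.dual_N]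
      by_cases h : i ≤ 2 * B.N
      · obtain ⟨e, e'⟩ := (site i).1 h hi.1
        rw [if_neg e', if_pos h, e, Nat.add_sub_cancel, Datum.dual_P]
        have := B.P_mem (flip_internal.2 ⟨hi.1, h⟩)
        rw [hN]
        generalize B.P (flip B.N i) = x at *
        unfold flip
        split_ifs <;> omega
      · obtain ⟨e, e'⟩ := (site i).2 h (by omega)
        rw [if_pos e', if_neg h, e, Datum.dual_P]
        have := A.P_mem (flip_internal.2 (⟨by omega, by omega⟩ :
          1 ≤ i - 2 * B.N ∧ i - 2 * B.N ≤ 2 * A.N))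
        rw [hN]
        generalize A.P (flip A.N (i - 2 * B.N)) = x at *
        unfold flip
        split_ifs <;> omega
    · rw [Θ.dual.P_out hi, Datum.dual_N]
      split_ifs with h
      · rw [B.dual.P_out (by rw [Datum.dual_N]; omega)]
      · rw [A.dual.P_out (by rw [Datum.dual_N]; omega)]
        omega
  · by_cases hi : 1 ≤ i ∧ i ≤ 2 * Θ.N
    · rw [Datum.dual_s, hs, Datum.dual_N]
      by_cases h : i ≤ 2 * B.N
      · obtain ⟨e, e'⟩ := (site i).1 h hi.1
        rw [if_neg e', if_pos h, e, Nat.add_sub_cancel, Datum.dual_s]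
      · obtain ⟨e, e'⟩ := (site i).2 h (by omega)
        rw [if_pos e', if_neg h, e, Datum.dual_s]
    · rw [Θ.dual.s_out i hi, Datum.dual_N]
      split_ifs with h
      · rw [B.dual.s_out _ (by rw [Datum.dual_N]; omega)]
      · rw [A.dual.s_out _ (by rw [Datum.dual_N]; omega)]
  · have comm : re (2 * A.N + 1) ∘ Θ.dual.dm = dst B.dual A.dual ∘ re (2 * B.dual.N + 1) := by
      funext v
      obtain ⟨i, a⟩ := v
      simp only [Function.comp]
      have hfi := hfd i
      rw [Datum.dual_N]
      by_cases h : i ≤ 2 * B.N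
      · have e1 : re (2 * B.N + 1) (i, a) = (i, a) := by
          rw [re, if_pos (by dsimp only; omega)]
        rw [if_pos h] at hfi
        rw [e1, dst, if_pos (by rw [Datum.dual_N]; dsimp only; omega)]
        have e2 : ¬ (Θ.dual.dm (i, a)).1 < 2 * A.N + 1 := by
          rw [Frame.dm_fst, Datum.dual_N, hN]
          unfold flip
          dsimp only
          split_ifs <;> omega
        rw [re, if_neg e2]
        unfold Frame.dm
        dsimp only
        rw [hfi, Datum.dual_N, Datum.dual_N, Datum.dual_N, hN]
        refine Prod.ext ?_ ?_
        · dsimp only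
          unfold flip
          split_ifs <;> omega
        · dsimp only
          split_ifs <;> omega
      · have e1 : re (2 * B.N + 1) (i, a) = (i + 1, a) := by
          rw [re, if_neg (by dsimp only; omega)]
        rw [if_neg h] at hfi
        have e3 : i + 1 - (2 * B.N + 1) = i - 2 * B.N := by omega
        rw [e1, dst, if_neg (by rw [Datum.dual_N]; dsimp only; omega), Datum.dual_N,
          Datum.dual_N]
        dsimp only
        rw [e3]
        by_cases h1 : i ≤ 2 * Θ.N + 1
        · rw [if_pos (by omega)]
          have e2 : (Θ.dual.dm (i, a)).1 < 2 * A.N + 1 := by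
            rw [Frame.dm_fst, Datum.dual_N, hN]
            unfold flip
            dsimp only
            split_ifs <;> omega
          rw [re, if_pos e2]
          unfold Frame.dm
          dsimp only
          rw [hfi, Datum.dual_N, Datum.dual_N, hN]
          refine Prod.ext ?_ ?_
          · dsimp only
            unfold flip
            split_ifs <;> omega
          · dsimp only
            split_ifs <;> omega
        · rw [if_neg (by omega)]
          have e2 : Θ.dual.dm (i, a) = (i, a) := by
            unfold Frame.dm
            dsimp only
            rw [Datum.dual_N, if_neg (by omega), flip, if_neg h1]
          rw [e2, re, if_neg (by dsimp only; omega)]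
    have hst : stackS B.dual A.dual = Setoid.comap (dst B.dual A.dual) (stackS A B) := by
      have := stackS_dual B.dual A.dual
      rwa [A.dual_dual, B.dual_dual] at this
    ext u v
    rw [arcS_dual, hE, hst]
    change stackS A B ((re (2 * A.N + 1) ∘ Θ.dual.dm) u) ((re (2 * A.N + 1) ∘ Θ.dual.dm) v) ↔
      stackS A B ((dst B.dual A.dual ∘ re (2 * B.dual.N + 1)) u)
        ((dst B.dual A.dual ∘ re (2 * B.dual.N + 1)) v)
    rw [comm]

end SWB

namespace SWB

/-! ### Components -/

theorem curve_reachable_E (Θ : Datum) (u : ℕ × ℕ) : Θ.curveGraph.Reachable u (Θ.E u) := by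
  by_cases h : u = Θ.E u
  · rw [← h]
  · refine SimpleGraph.Adj.reachable (Or.inl ?_)
    exact (SimpleGraph.fromRel_adj _ _ _).2 ⟨h, Or.inl rfl⟩

theorem curve_reachable_iota {Θ : Datum} {u : ℕ × ℕ} (hu : u ∈ Θ.V) (hi : Θ.Internal u) :
    Θ.curveGraph.Reachable u (Θ.iota u) := by
  refine SimpleGraph.Adj.reachable (Or.inr ?_)
  exact (SimpleGraph.fromRel_adj _ _ _).2
    ⟨fun e => Frame.iota_site_ne hi (congrArg Prod.fst e).symm, Or.inl ⟨hu, hi, rfl⟩⟩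

theorem curve_adj {Θ : Datum} {u w : ℕ × ℕ} (h : Θ.curveGraph.Adj u w) :
    w = Θ.E u ∨ (Θ.Internal u ∧ w = Θ.iota u) := by
  rcases h with h | h
  · have := ((SimpleGraph.fromRel_adj _ _ _).1 h).2
    exact Or.inl (this.elim (fun h => h.symm) (fun h => (Datum.E_eq_comm.1 h).symm))
  · have := ((SimpleGraph.fromRel_adj _ _ _).1 h).2
    rcases this with ⟨h1, h2, h3⟩ | ⟨h1, h2, h3⟩
    · exact Or.inr ⟨h2, h3.symm⟩
    · refine Or.inr ⟨h3 ▸ Frame.iota_internal h2, ?_⟩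
      rw [← h3, Frame.iota_iota h1]

theorem curve_induction {Θ : Datum} {P : ℕ × ℕ → Prop} {v w : ℕ × ℕ}
    (h : Θ.curveGraph.Reachable v w) (hv : P v) (hE : ∀ u, P u → P (Θ.E u))
    (hi : ∀ u, P u → Θ.Internal u → P (Θ.iota u)) : P w := by
  rw [SimpleGraph.reachable_iff_reflTransGen] at h
  induction h with
  | refl => exact hv
  | tail _ hadj ih =>
    rcases curve_adj hadj with rfl | ⟨h1, rfl⟩
    · exact hE _ ih
    · exact hi _ ih h1

section Component

variable {Θ : Datum} {Γ : Set (ℕ × ℕ)}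

theorem Datum.IsComponent.subset (h : Θ.IsComponent Γ) : Γ ⊆ Θ.V := by
  obtain ⟨v, hv, rfl⟩ := h
  exact fun w hw => curve_induction hw hv (fun _ => E_mem) (fun _ h _ => Frame.iota_mem h)

theorem Datum.IsComponent.E_mem (h : Θ.IsComponent Γ) {u : ℕ × ℕ} (hu : u ∈ Γ) : Θ.E u ∈ Γ := by
  obtain ⟨v, hv, rfl⟩ := h
  exact SimpleGraph.Reachable.trans hu (curve_reachable_E _ _)

theorem Datum.IsComponent.iota_mem (h : Θ.IsComponent Γ) {u : ℕ × ℕ} (hu : u ∈ Γ)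
    (hi : Θ.Internal u) : Θ.iota u ∈ Γ := by
  have hV := h.subset hu
  obtain ⟨v, hv, rfl⟩ := h
  exact SimpleGraph.Reachable.trans hu (curve_reachable_iota hV hi)

theorem Datum.IsComponent.E_mem_iff (h : Θ.IsComponent Γ) {u : ℕ × ℕ} : Θ.E u ∈ Γ ↔ u ∈ Γ :=
  ⟨fun hu => by have := h.E_mem hu; rwa [Θ.E_E] at this, h.E_mem⟩

/-- A component is what the two involutions generate from a vertex, so a map intertwining them
carries it onto a component. -/
theorem Datum.IsComponent.map {Θ' : Datum} (h : Θ.IsComponent Γ) (g : ℕ × ℕ → ℕ × ℕ)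
    (hV : ∀ u ∈ Γ, g u ∈ Θ'.V) (hE : ∀ u ∈ Γ, Θ'.E (g u) = g (Θ.E u))
    (hI : ∀ u ∈ Γ, Θ'.Internal (g u) ↔ Θ.Internal u)
    (hi : ∀ u ∈ Γ, Θ.Internal u → Θ'.iota (g u) = g (Θ.iota u)) : Θ'.IsComponent (g '' Γ) := by
  have hΓ := h
  obtain ⟨v, hv, e⟩ := h
  have hvΓ : v ∈ Γ := e ▸ SimpleGraph.Reachable.refl v
  refine ⟨g v, hV v hvΓ, ?_⟩
  ext w
  constructor
  · rintro ⟨u, hu, rfl⟩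
    have hu' := hu
    rw [e] at hu'
    have key := curve_induction (P := fun u => u ∈ Γ ∧ Θ'.curveGraph.Reachable (g v) (g u)) hu'
      ⟨hvΓ, SimpleGraph.Reachable.refl _⟩
      (fun x hx => ⟨hΓ.E_mem hx.1, hE x hx.1 ▸ hx.2.trans (curve_reachable_E _ _)⟩)
      (fun x hx hx' => ⟨hΓ.iota_mem hx.1 hx', hi x hx.1 hx' ▸
        hx.2.trans (curve_reachable_iota (hV x hx.1) ((hI x hx.1).2 hx'))⟩)
    exact key.2
  · intro hw
    refine curve_induction (P := fun w => w ∈ g '' Γ) hw ⟨v, hvΓ, rfl⟩ ?_ ?_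
    · rintro _ ⟨x, hx, rfl⟩
      exact ⟨Θ.E x, hΓ.E_mem hx, (hE x hx).symm⟩
    · rintro _ ⟨x, hx, rfl⟩ hx'
      have hx2 := (hI x hx).1 hx'
      exact ⟨Θ.iota x, hΓ.iota_mem hx hx2, (hi x hx hx2).symm⟩

end Component

/-! ### Duals of restrictions and of components -/

/-- Conjugation by order reversals on both sides reverses twice. -/
theorem IsOP.dual {F F' : Frame} (hN : F'.N = F.N) {W W' : Set (ℕ × ℕ)} {o : ℕ × ℕ → ℕ × ℕ}
    (h : IsOP F.N W W' o) (hW : W ⊆ F.V) (hW' : W' ⊆ F'.V) :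
    IsOP F.N (F.dm '' W) (F'.dm '' W') (F'.dm ∘ o ∘ F.dual.dm) := by
  refine ⟨⟨?_, ?_, ?_⟩, ?_⟩
  · rintro _ ⟨u, hu, rfl⟩
    simp only [Function.comp, Frame.dual_dm_dm]
    exact ⟨o u, h.1.mapsTo hu, rfl⟩
  · rintro _ ⟨u, hu, rfl⟩ _ ⟨v, hv, rfl⟩ e
    simp only [Function.comp, Frame.dual_dm_dm] at e
    rw [h.1.injOn hu hv (F'.dm_injective e)]
  · rintro _ ⟨v, hv, rfl⟩
    obtain ⟨u, hu, rfl⟩ := h.1.surjOn hv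
    refine ⟨F.dm u, ⟨u, hu, rfl⟩, ?_⟩
    simp only [Function.comp, Frame.dual_dm_dm]
  · rintro _ ⟨u, hu, rfl⟩ _ ⟨v, hv, rfl⟩ hlt
    simp only [Function.comp, Frame.dual_dm_dm]
    rw [Frame.dm_lt (hW hu) (hW hv)] at hlt
    rw [← hN, Frame.dm_lt (hW' (h.1.mapsTo hu)) (hW' (h.1.mapsTo hv)), hN]
    exact h.2 _ hv _ hu hlt

theorem dual_chord_eq {Θ Θ' : Datum} (h : Θ'.toChordDatum = Θ.toChordDatum) :
    Θ'.dual.toChordDatum = Θ.dual.toChordDatum :=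
  congrArg ChordDatum.dual h

theorem IsRestriction.dual {Θ Θ' : Datum} {S : Set (ℕ × ℕ)} (hS : S ⊆ Θ.V)
    (h : IsRestriction Θ S Θ') : IsRestriction Θ.dual (Θ.dm '' S) Θ'.dual := by
  obtain ⟨hc, hf, o, ho, hE⟩ := h
  have hN : Θ'.N = Θ.N := congrArg ChordDatum.N hc
  refine ⟨dual_chord_eq hc, fun i => ?_, Θ'.dm ∘ o ∘ Θ.dual.dm, ?_, ?_⟩
  · rw [Datum.dual_f, hf]
    have : {v | v ∈ Θ.dm '' S ∧ v.1 = i} = Θ.dm '' {v | v ∈ S ∧ v.1 = flip Θ'.N i} := by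
      ext w
      constructor
      · rintro ⟨⟨u, hu, rfl⟩, rfl⟩
        refine ⟨u, ⟨hu, ?_⟩, rfl⟩
        rw [Frame.dm_fst, hN, flip_flip]
      · rintro ⟨u, ⟨hu, he⟩, rfl⟩
        refine ⟨⟨u, hu, rfl⟩, ?_⟩
        rw [Frame.dm_fst, he, hN, flip_flip]
    rw [this, Set.ncard_image_of_injective _ (Frame.dm_injective _)]
  · have := ho.dual (F := Θ.toFrame) (F' := Θ'.toFrame) hN hS subset_rfl
    rwa [Frame.dm_image] at this
  · rintro _ ⟨u, hu, rfl⟩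
    simp only [Function.comp, Datum.dual_dm_dm, Datum.dual_E_dm, hE u hu]

theorem dm_image_sdiff (Θ : Datum) (Γ : Set (ℕ × ℕ)) :
    Θ.dm '' (Θ.V \ Γ) = Θ.dual.V \ (Θ.dm '' Γ) := by
  rw [Set.image_sdiff (Frame.dm_injective _), Frame.dm_image]
  rfl

theorem IsDeletion.dual {Θ Θ' : Datum} {Γ : Set (ℕ × ℕ)}
    (h : IsDeletion Θ Γ Θ') : IsDeletion Θ.dual (Θ.dm '' Γ) Θ'.dual := by
  have := IsRestriction.dual (fun _ h => h.1) h
  rwa [dm_image_sdiff] at this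

theorem Datum.IsInternalComponent.dual {Θ : Datum} {Γ : Set (ℕ × ℕ)}
    (h : Θ.IsInternalComponent Γ) : Θ.dual.IsInternalComponent (Θ.dm '' Γ) := by
  refine ⟨h.1.map Θ.dm (fun u hu => dm_mem.2 (h.1.subset hu)) (fun u _ => Θ.dual_E_dm u)
    (fun u _ => Frame.dm_internal) (fun u hu hi => Frame.dm_iota (h.1.subset hu) hi), ?_⟩
  rintro _ ⟨u, hu, rfl⟩
  exact Frame.dm_internal.2 (h.2 u hu)

theorem flip_lt {N i j : ℕ} (hi : i ≤ 2 * N + 1) (hj : j ≤ 2 * N + 1) :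
    flip N i < flip N j ↔ j < i := by
  unfold flip
  rw [if_pos hi, if_pos hj]
  omega

/-- Each arc in a band is counted at its lower end, and the reversal exchanges lower and upper ends.
The bijection between the two counts therefore passes through `iota` before reversing. -/
theorem Datum.twist_dual {Θ : Datum} {Γ : Set (ℕ × ℕ)} (h : Θ.IsInternalComponent Γ) :
    Θ.dual.twist (Θ.dm '' Γ) = Θ.twist Γ := by
  unfold twist
  congr 1
  have e : {v | v ∈ Θ.dm '' Γ ∧ v.1 < Θ.dual.P v.1 ∧ Θ.dual.s v.1 = 1} =
      (Θ.dm ∘ Θ.iota) '' {v | v ∈ Γ ∧ v.1 < Θ.P v.1 ∧ Θ.s v.1 = 1} := by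
    ext w
    constructor
    · rintro ⟨⟨u, hu, rfl⟩, h1, h2⟩
      have hi := h.2 u hu
      have hp := Θ.P_mem hi
      rw [dual_P, Frame.dm_fst, flip_flip, flip_lt (by have := hi.2; omega) (by omega)] at h1
      rw [dual_s, Frame.dm_fst, flip_flip] at h2
      refine ⟨Θ.iota u, ⟨h.1.iota_mem hu hi, ?_, ?_⟩, ?_⟩
      · rw [Frame.iota_fst, Θ.P_P]
        exact h1
      · rw [Frame.iota_fst, Θ.s_P]
        exact h2
      · simp only [Function.comp, Frame.iota_iota (h.1.subset hu)]
    · rintro ⟨u, ⟨hu, h1, h2⟩, rfl⟩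
      have hi := h.2 u hu
      have hp := Θ.P_mem hi
      refine ⟨⟨Θ.iota u, h.1.iota_mem hu hi, rfl⟩, ?_, ?_⟩
      · simp only [Function.comp]
        rw [dual_P, Frame.dm_fst, flip_flip, flip_lt (by rw [Frame.iota_fst]; omega)
          (by rw [Frame.iota_fst, Θ.P_P]; have := hi.2; omega), Frame.iota_fst, Θ.P_P]
        exact h1
      · simp only [Function.comp]
        rw [dual_s, Frame.dm_fst, flip_flip, Frame.iota_fst, Θ.s_P]
        exact h2
  rw [e, Set.InjOn.ncard_image]
  rintro u ⟨hu, -⟩ v ⟨hv, -⟩ e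
  have := Frame.dm_injective _ e
  rw [← Frame.iota_iota (h.1.subset hu), this, Frame.iota_iota (h.1.subset hv)]

/-! ### Duals of complement graphs -/

/-- The order reversing bijection of the vertices of the complement graphs. -/
def Datum.rm (Θ : Datum) (x : ℕ × ℕ) : ℕ × ℕ :=
  (flip Θ.N x.1, if 1 ≤ x.1 ∧ x.1 ≤ 2 * Θ.N then Θ.f x.1 - x.2 else x.2)

theorem Datum.rm_mem {Θ : Datum} {x : ℕ × ℕ} (h : x ∈ Θ.regions) : Θ.rm x ∈ Θ.dual.regions := by
  refine ⟨flip_le.2 h.1, ?_⟩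
  have := h.2
  rw [dual_f]
  simp only [rm, flip_flip]
  split_ifs <;> omega

theorem Datum.dual_rm_rm {Θ : Datum} {x : ℕ × ℕ} (h : x ∈ Θ.regions) :
    Θ.dual.rm (Θ.rm x) = x := by
  have := h.2
  simp only [rm, dual_N, dual_f, flip_flip, flip_internal]
  refine Prod.ext rfl ?_
  dsimp only
  split_ifs <;> omega

/-- Band edges are compared site by site; edges in the square are preserved because the reversal
acts compatibly on regions and on chord ends. -/
theorem Datum.complement_adj_dual {Θ : Datum} {x y : ℕ × ℕ} (h : Θ.complementGraph.Adj x y) :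
    Θ.dual.complementGraph.Adj (Θ.rm x) (Θ.rm y) := by
  unfold complementGraph at h ⊢
  have band : ∀ x y, (x ∈ Θ.regions ∧ Θ.Internal x ∧
      y = (Θ.P x.1, if Θ.s x.1 = 0 then Θ.f x.1 - x.2 else x.2)) → y ∈ Θ.regions ∧
      (Θ.rm x ∈ Θ.dual.regions ∧ Θ.dual.Internal (Θ.rm x) ∧ Θ.rm y = (Θ.dual.P (Θ.rm x).1,
        if Θ.dual.s (Θ.rm x).1 = 0 then Θ.dual.f (Θ.rm x).1 - (Θ.rm x).2 else (Θ.rm x).2)) := by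
    rintro ⟨i, k⟩ y ⟨h1, h2, rfl⟩
    have h3 := Θ.P_mem h2
    have h4 := Θ.f_P i
    have h5 := h1.2
    dsimp only at h3 h4 h5
    simp only [Frame.Internal] at h2
    refine ⟨⟨by dsimp only; omega, ?_⟩, rm_mem h1, flip_internal.2 h2, ?_⟩
    · dsimp only
      rw [h4]
      split_ifs <;> omega
    · simp only [rm, dual_P, dual_s, dual_f, flip_flip, h2.1, h2.2, h3.1, h3.2, true_and, if_true,
        h4]
      refine Prod.ext rfl ?_
      dsimp only
      split_ifs <;> rfl
  have sq : ∀ x y, (x ∈ Θ.regions ∧ y ∈ Θ.regions ∧ ∀ v ∈ Θ.V,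
      ¬ Crosses (key Θ.N (x.1, 2 * x.2 + 1)) (key Θ.N (y.1, 2 * y.2 + 1))
        (key Θ.N (v.1, 2 * v.2)) (key Θ.N ((Θ.E v).1, 2 * (Θ.E v).2))) →
      (Θ.rm x ∈ Θ.dual.regions ∧ Θ.rm y ∈ Θ.dual.regions ∧ ∀ v ∈ Θ.dual.V,
      ¬ Crosses (key Θ.N ((Θ.rm x).1, 2 * (Θ.rm x).2 + 1))
        (key Θ.N ((Θ.rm y).1, 2 * (Θ.rm y).2 + 1))
        (key Θ.N (v.1, 2 * v.2)) (key Θ.N ((Θ.dual.E v).1, 2 * (Θ.dual.E v).2))) := by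
    rintro x y ⟨hx, hy, hv⟩
    refine ⟨rm_mem hx, rm_mem hy, fun w hw hcr => ?_⟩
    obtain ⟨v, rfl⟩ : ∃ v, Θ.dm v = w := ⟨_, Θ.dm_dual_dm w⟩
    rw [dm_mem] at hw
    rw [dual_E_dm] at hcr
    refine hv v hw ?_
    -- Regions and vertices are moved by different formulas, so the order reversal is stated on
    -- their disjoint union; the doubled coordinates turn `f + 1` into `2 * f + 2`.
    let κ : (ℕ × ℕ) ⊕ (ℕ × ℕ) → ℕ ×ₗ ℤ :=
      Sum.elim (fun x => key Θ.N (x.1, 2 * x.2 + 1)) (fun v => key Θ.N (v.1, 2 * v.2))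
    let κ' : (ℕ × ℕ) ⊕ (ℕ × ℕ) → ℕ ×ₗ ℤ :=
      Sum.elim (fun x => key Θ.N ((Θ.rm x).1, 2 * (Θ.rm x).2 + 1))
        (fun v => key Θ.N ((Θ.dm v).1, 2 * (Θ.dm v).2))
    have hreg : ∀ x ∈ Θ.regions, if 1 ≤ x.1 ∧ x.1 ≤ 2 * Θ.N then
        (2 * (Θ.rm x).2 + 1) + (2 * x.2 + 1) = 2 * Θ.f x.1 + 2
        else 2 * (Θ.rm x).2 + 1 = 2 * x.2 + 1 := by
      intro x hx
      have := hx.2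
      simp only [rm]
      split_ifs <;> omega
    have hver : ∀ x ∈ Θ.V, if 1 ≤ x.1 ∧ x.1 ≤ 2 * Θ.N then
        2 * (Θ.dm x).2 + 2 * x.2 = 2 * Θ.f x.1 + 2 else 2 * (Θ.dm x).2 = 2 * x.2 := by
      intro x hx
      have := Frame.dm_spec hx
      split_ifs at this ⊢ <;> omega
    have key : ∀ a ∈ Set.sumEquiv.symm (Θ.regions, Θ.V), ∀ b ∈
        Set.sumEquiv.symm (Θ.regions, Θ.V), κ' a < κ' b ↔ κ b < κ a := by
      rintro (a | a) ha (b | b) hb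
      · simp at ha hb
        exact key_lt_flip (M := fun i => 2 * Θ.f i + 2) ha.1 hb.1 rfl rfl (hreg a ha) (hreg b hb)
      · simp at ha hb
        exact key_lt_flip (M := fun i => 2 * Θ.f i + 2) ha.1 (Frame.site_le (F := Θ.toFrame) (v := b) hb) rfl rfl (hreg a ha)
          (hver b hb)
      · simp at ha hb
        exact key_lt_flip (M := fun i => 2 * Θ.f i + 2) (Frame.site_le (F := Θ.toFrame) (v := a) ha) hb.1 rfl rfl (hver a ha)
          (hreg b hb)
      · simp at ha hb
        exact key_lt_flip (M := fun i => 2 * Θ.f i + 2) (Frame.site_le (F := Θ.toFrame) (v := a) ha) (Frame.site_le (F := Θ.toFrame) (v := b) hb) rfl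
          rfl (hver a ha) (hver b hb)
    exact (crosses_anti key (a := Sum.inl x) (b := Sum.inl y) (c := Sum.inr v)
      (d := Sum.inr (Θ.E v)) (by simpa using hx) (by simpa using hy) (by simpa using hw)
      (by simpa using E_mem hw)).1 hcr
  rw [SimpleGraph.fromRel_adj] at h ⊢
  have hmem : x ∈ Θ.regions ∧ y ∈ Θ.regions := by
    rcases h.2 with (h | h) | (h | h)
    · exact ⟨h.1, (band x y h).1⟩
    · exact ⟨h.1, h.2.1⟩
    · exact ⟨(band y x h).1, h.1⟩
    · exact ⟨h.2.1, h.1⟩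
  refine ⟨fun e => h.1 ?_, ?_⟩
  · rw [← dual_rm_rm hmem.1, e, dual_rm_rm hmem.2]
  · rcases h.2 with (h | h) | (h | h)
    · exact Or.inl (Or.inl (band x y h).2)
    · exact Or.inl (Or.inr (sq x y h))
    · exact Or.inr (Or.inl (band y x h).2)
    · exact Or.inr (Or.inr (sq y x h))

theorem Datum.numComponents_dual (Θ : Datum) :
    numComponents Θ.dual.complementGraph Θ.dual.regions =
    numComponents Θ.complementGraph Θ.regions := by
  have one : ∀ (Θ : Datum) (x y : ℕ × ℕ), Θ.complementGraph.Reachable x y →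
      Θ.dual.complementGraph.Reachable (Θ.rm x) (Θ.rm y) := by
    intro Θ x y h
    exact h.map (G' := Θ.dual.complementGraph) ⟨Θ.rm, complement_adj_dual⟩
  symm
  refine numComponents_congr Θ.rm (fun x hx => rm_mem hx) (fun x hx y hy => ⟨one Θ x y, fun h => ?_⟩)
    (fun y hy => ?_)
  · have := one Θ.dual _ _ h
    rwa [Θ.dual_dual, dual_rm_rm hx, dual_rm_rm hy] at this
  · have h1 := rm_mem hy
    have h2 := dual_rm_rm hy
    rw [Θ.dual_dual] at h1 h2
    exact ⟨_, h1, by rw [h2]⟩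

theorem Datum.IsSeparating.dual {Θ : Datum} {Γ : Set (ℕ × ℕ)} (hΓ : Γ ⊆ Θ.V)
    (h : Θ.IsSeparating Γ) : Θ.dual.IsSeparating (Θ.dm '' Γ) := by
  obtain ⟨Θ', hr, hn⟩ := h
  exact ⟨Θ'.dual, hr.dual hΓ, by rw [numComponents_dual, hn]⟩

theorem Datum.IsNonSeparating.dual {Θ : Datum} {Γ : Set (ℕ × ℕ)} (hΓ : Γ ⊆ Θ.V)
    (h : Θ.IsNonSeparating Γ) : Θ.dual.IsNonSeparating (Θ.dm '' Γ) := by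
  obtain ⟨Θ', hr, hn⟩ := h
  exact ⟨Θ'.dual, hr.dual hΓ, by rw [numComponents_dual, hn]⟩

/-! ### Duals of pull-throughs -/

theorem Datum.dm_apply {Θ : Datum} {i a : ℕ} (hi : 1 ≤ i ∧ i ≤ 2 * Θ.N) (ha : 1 ≤ a ∧ a ≤ Θ.f i) :
    Θ.dm (i, a) = (2 * Θ.N + 1 - i, Θ.f i + 1 - a) := by
  unfold Frame.dm flip
  dsimp only
  rw [if_pos (by omega), if_pos ⟨hi, ha⟩]

/-- The reflection sends heights `a + 1`, `a` to `f - a`, `f - a + 1`, so the lower point of the new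
turn-back comes from the upper one of the old, and the two image points are exchanged. -/
theorem IsPullThrough.dual {Θ Θ' : Datum} {i a : ℕ} (h : IsPullThrough Θ i a Θ') :
    IsPullThrough Θ.dual (flip Θ.N i) (Θ.f i - a) Θ'.dual := by
  obtain ⟨hi, ha, hE, hne, hc, hf, o, ho, hE1, hE2⟩ := h
  have hb : (i, a + 1) ∈ Θ.V := hE ▸ Datum.E_mem ha
  have hN : Θ'.N = Θ.N := congrArg ChordDatum.N hc
  have ha1 := ha.1
  have hb1 := hb.2
  dsimp only at ha1 hb1
  have hfl : flip Θ.N i = 2 * Θ.N + 1 - i := by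
    unfold flip
    rw [if_pos (by omega)]
  have e1 : Θ.dm (i, a + 1) = (flip Θ.N i, Θ.f i - a) := by
    rw [Datum.dm_apply hi ⟨by omega, hb1⟩, hfl]
    congr 1
    omega
  have e2 : Θ.dm (i, a) = (flip Θ.N i, Θ.f i - a + 1) := by
    rw [Datum.dm_apply hi ⟨ha1, by omega⟩, hfl]
    congr 1
    omega
  have i1 : Θ.dual.iota (flip Θ.N i, Θ.f i - a) = Θ.dm (Θ.iota (i, a + 1)) := by
    rw [← e1]
    exact Frame.dm_iota hb hi
  have i2 : Θ.dual.iota (flip Θ.N i, Θ.f i - a + 1) = Θ.dm (Θ.iota (i, a)) := by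
    rw [← e2]
    exact Frame.dm_iota ha hi
  have hpull : Θ.dual.pullSet (flip Θ.N i) (Θ.f i - a) = Θ.dm '' Θ.pullSet i a := by
    ext w
    simp only [Frame.pullSet, i1, i2, Set.image_insert_eq, Set.image_singleton, e1, e2,
      Set.mem_insert_iff, Set.mem_singleton_iff]
    tauto
  have hdiff : Θ.dual.V \ Θ.dual.pullSet (flip Θ.N i) (Θ.f i - a) =
      Θ.dm '' (Θ.V \ Θ.pullSet i a) := by
    rw [hpull, dm_image_sdiff]
  refine ⟨flip_internal.2 hi, ?_, ?_, ?_, dual_chord_eq hc, fun j => ?_, Θ'.dm ∘ o ∘ Θ.dual.dm,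
    ?_, ?_, ?_⟩
  · rw [← e1]
    exact Datum.dm_mem.2 hb
  · rw [← e1, ← e2, Datum.dual_E_dm, ← hE, Θ.E_E]
  · rw [i1, i2, Datum.dual_E_dm, (Frame.dm_injective _).ne_iff]
    exact fun e => hne (Datum.E_eq_comm.1 e)
  · rw [Datum.dual_f, Datum.dual_f, hf, hN, Datum.dual_P, flip_flip]
    congr 1
    rw [← flip_inj (N := Θ.N), flip_flip, ← flip_inj (N := Θ.N) (j := Θ.P i), flip_flip]
  · rw [hdiff]
    have := ho.dual (F := Θ.toFrame) (F' := Θ'.toFrame) hN (fun _ h => h.1) subset_rfl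
    rwa [Frame.dm_image] at this
  · rw [hdiff, hpull]
    rintro _ ⟨u, hu, rfl⟩ hu2
    rw [Datum.dual_E_dm, (Frame.dm_injective _).mem_set_image] at hu2
    simp only [Function.comp, Datum.dual_dm_dm, Datum.dual_E_dm, hE1 u hu hu2]
  · rw [i1, i2]
    simp only [Function.comp, Datum.dual_dm_dm, Datum.dual_E_dm]
    rw [← hE2, Θ'.E_E]

/-! ### Duals of handle slides -/

/-- Which vertices are nearest to the slid end is a symmetric notion. One inclusion is checked for
every frame, and the converse is that inclusion for the dual frame. -/
theorem newVertices_dual {F : Frame} {k l c d : ℕ} (hk : 1 ≤ k ∧ k ≤ 2 * F.N)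
    (hl : 1 ≤ l ∧ l ≤ 2 * F.N) (hne : k ≠ l) (hfk : F.f k = c) (hfl : F.f l = d + c) :
    F.dm '' newVertices k l c d = newVertices (flip F.N k) (flip F.N l) c d := by
  have sub : ∀ (G : Frame) (k l : ℕ), (1 ≤ k ∧ k ≤ 2 * G.N) → (1 ≤ l ∧ l ≤ 2 * G.N) → k ≠ l →
      G.f k = c → G.f l = d + c →
      ∀ v ∈ newVertices k l c d, G.dm v ∈ newVertices (flip G.N k) (flip G.N l) c d := by
    rintro G k l hk hl hne hfk hfl ⟨i, a⟩ (⟨h1, h2⟩ | ⟨h1, h2⟩)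
    · simp only at h1 h2
      subst h1
      refine Or.inl ?_
      unfold Frame.dm
      dsimp only
      rw [if_pos ⟨hk, by omega⟩]
      refine ⟨rfl, ?_⟩
      omega
    · simp only at h1 h2
      subst h1
      refine Or.inr ?_
      unfold Frame.dm
      dsimp only
      have : flip G.N i < flip G.N k ↔ k < i := flip_lt (by omega) (by omega)
      refine ⟨rfl, ?_⟩
      simp only [this]
      split_ifs at h2 ⊢ <;> omega
  have f1 : F.dual.f (flip F.N k) = c := by
    change F.f (flip F.N (flip F.N k)) = c
    rw [flip_flip, hfk]
  have f2 : F.dual.f (flip F.N l) = d + c := by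
    change F.f (flip F.N (flip F.N l)) = d + c
    rw [flip_flip, hfl]
  ext w
  constructor
  · rintro ⟨v, hv, rfl⟩
    exact sub F k l hk hl hne hfk hfl v hv
  · intro hw
    refine ⟨F.dual.dm w, ?_, F.dm_dual_dm w⟩
    have := sub F.dual (flip F.N k) (flip F.N l) (flip_internal.2 hk) (flip_internal.2 hl)
      (fun e => hne (flip_inj.1 e)) f1 f2 w hw
    change F.dual.dm w ∈ newVertices (flip F.N (flip F.N k)) (flip F.N (flip F.N l)) c d at this
    rwa [flip_flip, flip_flip] at this

end SWB

namespace SWB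

/-- The conjugate of a permutation of the sites by the order reversing permutation. -/
def flipPerm (N : ℕ) (σ : Equiv.Perm ℕ) : Equiv.Perm ℕ :=
  let φ : Equiv.Perm ℕ := ⟨flip N, flip N, flip_flip N, flip_flip N⟩
  φ.trans (σ.trans φ)

theorem flipPerm_apply (N : ℕ) (σ : Equiv.Perm ℕ) (k : ℕ) :
    flipPerm N σ k = flip N (σ (flip N k)) := rfl

theorem perm_internal {N : ℕ} {σ : Equiv.Perm ℕ} (h : ∀ k, ¬(1 ≤ k ∧ k ≤ 2 * N) → σ k = k) {k : ℕ} :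
    (1 ≤ σ k ∧ σ k ≤ 2 * N) ↔ (1 ≤ k ∧ k ≤ 2 * N) := by
  constructor
  · intro hk
    by_contra hn
    rw [h k hn] at hk
    exact hn hk
  · intro hk
    by_contra hn
    have := σ.injective (h _ hn)
    rw [this] at hn
    exact hn hk

/-- The direction changes sign and the site permutation is conjugated by the flip; the half-twist
rule involves no direction. -/
theorem IsHandleSlide.dual {Θ Θ' : Datum} {i : ℕ} {ε : ℤ} (h : IsHandleSlide Θ i ε Θ') :
    IsHandleSlide Θ.dual (flip Θ.N i) (-ε) Θ'.dual := by
  obtain ⟨j, σ, hε, hj, hi, hjI, hne, hσ, hmono, hσi, hN, hP, hs, hf, ⟨o, ho, hoE⟩, hnew⟩ := h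
  have hPj := Θ.P_mem hjI
  have fle : ∀ {k}, (1 ≤ k ∧ k ≤ 2 * Θ.N) → flip Θ.N k = 2 * Θ.N + 1 - k := fun hk => by
    unfold flip
    rw [if_pos (by omega)]
  have hij : i ≠ j := by rintro rfl; omega
  have hiPj : i ≠ Θ.P j := fun e => hne (by rw [e, Θ.P_P])
  have hfi : Θ'.f (σ i) = Θ.f i := by rw [hf, if_neg (by tauto), add_zero]
  have hfj : Θ'.f (σ (Θ.P j)) = Θ.f j + Θ.f i := by rw [hf, if_pos (Or.inr rfl), Θ.f_P]
  have hσk := (perm_internal hσ).2 hi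
  have hσl := (perm_internal hσ).2 hPj
  have hkl : σ i ≠ σ (Θ.P j) := fun e => hiPj (σ.injective e)
  have hnv := newVertices_dual (F := Θ'.toFrame) (hN ▸ hσk) (hN ▸ hσl) hkl hfi hfj
  rw [show Θ'.toFrame.N = Θ.N from hN] at hnv
  have feq : ∀ {a b : ℕ}, flip Θ.N a = b ↔ a = flip Θ.N b := fun {a b} => by
    rw [← flip_inj (N := Θ.N), flip_flip]
  have hσP : flipPerm Θ.N σ (Θ.dual.P (flip Θ.N j)) = flip Θ.N (σ (Θ.P j)) := by
    rw [flipPerm_apply, Datum.dual_P, flip_flip, flip_flip]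
  have hσI : flipPerm Θ.N σ (flip Θ.N i) = flip Θ.N (σ i) := by
    rw [flipPerm_apply, flip_flip]
  refine ⟨flip Θ.N j, flipPerm Θ.N σ, by omega, ?_, flip_internal.2 hi, flip_internal.2 hjI, ?_, ?_,
    ?_, ?_, hN, ?_, ?_, ?_, ⟨Θ'.dm ∘ o ∘ Θ.dual.dm, ?_, ?_⟩, ?_⟩
  · rw [fle hi, fle hjI]
    omega
  · rw [Datum.dual_P, flip_flip]
    exact fun e => hne (flip_inj.1 e)
  · intro k hk
    rw [Datum.dual_N] at hk
    rw [flipPerm_apply, hσ _ (fun h => hk (flip_internal.1 h)), flip_flip]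
  · rintro x ⟨hx, hxi⟩ y ⟨hy, hyi⟩ hxy
    rw [Datum.dual_N] at hx hy
    have hx' := flip_internal.2 hx
    have hy' := flip_internal.2 hy
    have := hmono (a := flip Θ.N y) ⟨hy', fun e => hyi (feq.1 e)⟩
      (b := flip Θ.N x) ⟨hx', fun e => hxi (feq.1 e)⟩
      ((flip_lt (by have := hy.2; omega) (by have := hx.2; omega)).2 hxy)
    rw [flipPerm_apply, flipPerm_apply, flip_lt]
    · exact this
    · have := (perm_internal hσ).2 hx'
      omega
    · have := (perm_internal hσ).2 hy'
      omega
  · rw [hσP, hσI, fle hσk, fle hσl, Datum.dual_s, flip_flip]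
    split_ifs at hσi ⊢ <;> omega
  · intro k
    rw [Datum.dual_P, Datum.dual_P, hN, flipPerm_apply, flipPerm_apply, flip_flip, flip_flip, hP]
  · intro k
    rw [Datum.dual_s, hN, flipPerm_apply, flip_flip, hs, Datum.dual_s, Datum.dual_s, Datum.dual_P,
      flip_flip, flip_flip]
    simp only [feq]
  · intro k
    rw [Datum.dual_f, hN, flipPerm_apply, flip_flip, hf, Datum.dual_f, Datum.dual_f, Datum.dual_P,
      flip_flip, flip_flip]
    congr 1
    simp only [feq]
  · have := ho.dual (F := Θ.toFrame) (F' := Θ'.toFrame) hN subset_rfl (fun _ h => h.1)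
    rw [Set.image_sdiff (Frame.dm_injective _), Frame.dm_image, Frame.dm_image, hnv] at this
    rw [hσP, hσI, Datum.dual_f, Datum.dual_f, flip_flip, flip_flip]
    exact this
  · intro v hv
    obtain ⟨u, rfl⟩ : ∃ u, Θ.dm u = v := ⟨_, Θ.dm_dual_dm v⟩
    rw [Datum.dm_mem] at hv
    simp only [Function.comp, Datum.dual_dm_dm, Datum.dual_E_dm, hoE u hv]
  · intro b hb1 hb2
    rw [Datum.dual_f, flip_flip] at hb2
    rw [hσP, hσI, Datum.dual_f, Datum.dual_f, flip_flip, flip_flip]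
    have e1 : (flip Θ.N (σ i), Θ.f i + 1 - b) = Θ'.dm (σ i, b) := by
      rw [Datum.dm_apply (hN ▸ hσk) (by omega), hfi, fle hσk, hN]
    -- Heights are reversed at the slid end, so the new arc of index `b` in the dual comes from the
    -- one of index `f i + 1 - b`.
    have e2 : b = Θ.f i + 1 - (Θ.f i + 1 - b) := by omega
    rw [e1, Datum.dual_E_dm]
    conv_lhs => rw [e2]
    rw [hnew _ (by omega) (by omega)]
    have hlt : flip Θ.N (σ (Θ.P j)) < flip Θ.N (σ i) ↔ σ i < σ (Θ.P j) :=
      flip_lt (by omega) (by omega)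
    unfold newArc
    rw [fle hσl] at hlt ⊢
    simp only [hlt]
    split_ifs with c1 c2 c2
    · omega
    · rw [Datum.dm_apply (hN ▸ hσl) (by omega), hfj, hN]
      congr 1
      omega
    · rw [Datum.dm_apply (hN ▸ hσl) (by omega), hfj, hN]
      congr 1
      omega
    · omega

end SWB

namespace SWB

/-! ### Transport of relations in the lower square of a stack -/

/-- The extension of a map of the points at the sites `≤ n` by the identity. -/
def lowExt (n : ℕ) (o : ℕ × ℕ → ℕ × ℕ) (v : ℕ × ℕ) : ℕ × ℕ := if v.1 ≤ n then o v else v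

/-- The points which lie in `W` or at a site `> n`. -/
def lowSet (n : ℕ) (W : Set (ℕ × ℕ)) : Set (ℕ × ℕ) := {v | v.1 ≤ n → v ∈ W}

/-- The map `o` on the set `W` of points at the sites `≤ n + 1` identifies the relations
`Q` and `R`, and it fixes the points at the site `n + 1`. -/
structure Transport (n : ℕ) (W : Set (ℕ × ℕ)) (o : ℕ × ℕ → ℕ × ℕ) (Q R : Setoid (ℕ × ℕ)) : Prop where
  site : ∀ u ∈ W, u.1 ≤ n + 1
  inj : Set.InjOn o W
  low : ∀ u ∈ W, u.1 ≤ n → (o u).1 ≤ n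
  top : ∀ u ∈ W, u.1 = n + 1 → o u = u
  suppQ : ∀ u ∈ supp Q, u.1 ≤ n + 1 ∧ (u.1 = n + 1 → u ∈ W)
  suppR : ∀ u ∈ supp R, u.1 ≤ n + 1 ∧ (u.1 = n + 1 → u ∈ W)
  rel : ∀ u ∈ W, ∀ w ∈ W, R (o u) (o w) ↔ Q u w

namespace Transport

variable {n : ℕ} {W : Set (ℕ × ℕ)} {o : ℕ × ℕ → ℕ × ℕ} {Q R : Setoid (ℕ × ℕ)}

theorem lowExt_eq (h : Transport n W o Q R) {u : ℕ × ℕ} (hu : u ∈ W) : lowExt n o u = o u := by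
  unfold lowExt
  split_ifs with h1
  · rfl
  · have := h.site u hu
    exact (h.top u hu (by omega)).symm

theorem lowExt_le (h : Transport n W o Q R) {u : ℕ × ℕ} (hu : u ∈ lowSet n W) :
    (lowExt n o u).1 ≤ n ↔ u.1 ≤ n := by
  unfold lowExt
  split_ifs with h1
  · exact iff_of_true (h.low u (hu h1) h1) h1
  · rfl

theorem lowExt_of_lt {u : ℕ × ℕ} (hu : n < u.1) : lowExt n o u = u := by
  unfold lowExt
  rw [if_neg (by omega)]

theorem lowExt_injOn (h : Transport n W o Q R) : Set.InjOn (lowExt n o) (lowSet n W) := by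
  intro u hu v hv e
  have h1 := h.lowExt_le hu
  have h2 := h.lowExt_le hv
  rw [e, h2] at h1
  by_cases hn : v.1 ≤ n
  · have hn' := h1.1 hn
    rw [h.lowExt_eq (hu hn'), h.lowExt_eq (hv hn)] at e
    exact h.inj (hu hn') (hv hn) e
  · have hn' := fun hh => hn (h1.2 hh)
    rwa [lowExt_of_lt (by omega), lowExt_of_lt (by omega)] at e

theorem high (h : Transport n W o Q R) {u : ℕ × ℕ} (hu : u ∈ lowSet n W) (huW : u ∉ W) :
    n < u.1 ∧ u ∉ supp Q ∧ u ∉ supp R := by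
  have h1 : n < u.1 := by
    by_contra hn
    exact huW (hu (by omega))
  refine ⟨h1, fun hs => ?_, fun hs => ?_⟩
  · have := h.suppQ u hs
    exact huW (this.2 (by omega))
  · have := h.suppR u hs
    exact huW (this.2 (by omega))

/-- Both stacks are pulled back to the common index set `lowSet n W`. The joins may be pulled back
termwise because the two squares meet only at the site `n + 1`, all of whose relevant points are in
`W` and are fixed by `o`. -/
theorem comap_sup_eq (h : Transport n W o Q R) (B : Setoid (ℕ × ℕ)) :
    Setoid.comap (fun z : lowSet n W => lowExt n o z) (R ⊔ shS (n + 1) B) =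
    Setoid.comap (fun z : lowSet n W => (z : ℕ × ℕ)) (Q ⊔ shS (n + 1) B) := by
  rw [comap_sup, comap_sup]
  · congr 1
    · ext ⟨u, hu⟩ ⟨w, hw⟩
      rw [Setoid.comap_rel, Setoid.comap_rel]
      dsimp only
      have out : ∀ u ∈ lowSet n W, ∀ w ∈ lowSet n W, u ∉ W →
          (R (lowExt n o u) (lowExt n o w) ↔ Q u w) := by
        intro u hu w hw huW
        obtain ⟨h1, h2, h3⟩ := h.high hu huW
        constructor
        · intro hr
          rw [lowExt_of_lt h1] at hr
          have := eq_of_notMem_supp hr h3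
          rw [← lowExt_of_lt (o := o) h1] at this
          rw [h.lowExt_injOn hw hu this]
        · intro hr
          rw [eq_of_notMem_supp hr h2]
      by_cases h1 : u ∈ W
      · by_cases h2 : w ∈ W
        · rw [h.lowExt_eq h1, h.lowExt_eq h2, h.rel u h1 w h2]
          rfl
        · rw [Setoid.comm', out w hw u hu h2, Setoid.comm']
          rfl
      · exact out u hu w hw h1
    · ext ⟨u, hu⟩ ⟨w, hw⟩
      rw [Setoid.comap_rel, Setoid.comap_rel]
      dsimp only
      rw [shS_iff, shS_iff, h.lowExt_injOn.eq_iff hu hw]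
      have h1 := h.lowExt_le hu
      have h2 := h.lowExt_le hw
      by_cases c1 : u.1 ≤ n
      · have := h1.2 c1
        refine or_congr_right ⟨fun h => ?_, fun h => ?_⟩ <;> have := h.1 <;> omega
      · rw [lowExt_of_lt (u := u) (by omega)]
        by_cases c2 : w.1 ≤ n
        · have := h2.2 c2
          refine or_congr_right ⟨fun h => ?_, fun h => ?_⟩ <;> have := h.2.1 <;> omega
        · rw [lowExt_of_lt (u := w) (by omega)]
  · rintro u ⟨h1, h2⟩
    rw [mem_supp_shS] at h2
    exact ⟨⟨u, fun h => by omega⟩, rfl⟩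
  · rintro u ⟨h1, h2⟩
    rw [mem_supp_shS] at h2
    exact ⟨⟨u, fun h => by omega⟩, lowExt_of_lt (by dsimp only; omega)⟩

theorem sup_iff (h : Transport n W o Q R) (B : Setoid (ℕ × ℕ)) {u w : ℕ × ℕ}
    (hu : u ∈ lowSet n W) (hw : w ∈ lowSet n W) :
    (R ⊔ shS (n + 1) B) (lowExt n o u) (lowExt n o w) ↔ (Q ⊔ shS (n + 1) B) u w := by
  have := congrArg (fun S : Setoid (lowSet n W) => S ⟨u, hu⟩ ⟨w, hw⟩) (h.comap_sup_eq B)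
  exact iff_of_eq this

/-- `X` stands for vertices deleted by the move and `M` for glued ones. Closed classes before the
move lie inside `X` or meet `M`, and only the latter survive as closed classes after the move. -/
theorem loops_eq (h : Transport n W o Q R) (B : Setoid (ℕ × ℕ)) {M X : Set (ℕ × ℕ)}
    (hM : ∀ v ∈ M, n < v.1) (hMf : M.Finite) (hXf : X.Finite) (hX : ∀ v ∈ X, v.1 ≤ n ∧ v ∉ W)
    (hQ : ∀ v w, v ∈ W ∪ X → Q v w → w ∈ W ∪ X) (hR : ∀ v ∈ W, ∀ w, R (o v) w → w ∈ o '' W) :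
    loops (Q ⊔ shS (n + 1) B) X + loops (R ⊔ shS (n + 1) B) M =
      loops (Q ⊔ shS (n + 1) B) (X ∪ M) := by
  have hMZ : M ⊆ lowSet n W := fun v hv hn => by
    have := hM v hv
    omega
  set M' : Set (lowSet n W) := Subtype.val ⁻¹' M with hM'
  have hM'f : M'.Finite := hMf.preimage Subtype.val_injective.injOn
  have e1 : (fun z : lowSet n W => (z : ℕ × ℕ)) '' M' = M := by
    rw [hM', Set.image_preimage_eq_inter_range, Subtype.range_coe]
    exact Set.inter_eq_left.2 hMZ
  have e2 : (fun z : lowSet n W => lowExt n o z) '' M' = M := by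
    rw [← e1]
    refine Set.image_congr fun z hz => ?_
    exact lowExt_of_lt (hM z hz)
  have k1 := loops_add (fun z : lowSet n W => (z : ℕ × ℕ)) Subtype.val_injective
    (Q ⊔ shS (n + 1) B) X M' hXf hM'f (by
      rw [Set.disjoint_left]
      rintro v hv ⟨z, rfl⟩
      exact (hX _ hv).2 (z.2 (hX _ hv).1)) (by
      rintro v - w hw
      have := sup_rel_induction (P := fun w => w ∈ X ∨ w ∈ lowSet n W) hw (Or.inr v.2) ?_ ?_
      · exact this.imp_right fun h => ⟨⟨w, h⟩, rfl⟩
      · intro y z hyz hy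
        by_cases hyW : y ∈ W ∪ X
        · rcases hQ y z hyW hyz with h | h
          · exact Or.inr fun _ => h
          · exact Or.inl h
        · rcases hy with hy | hy
          · exact absurd (Or.inr hy) hyW
          · rw [eq_of_notMem_supp hyz (h.high hy fun h => hyW (Or.inl h)).2.1]
            exact Or.inr hy
      · rintro y z (rfl | ⟨-, h2, -⟩) hy
        · exact hy
        · exact Or.inr fun h => by omega)
  have k2 := loops_comap (fun z : lowSet n W => lowExt n o z)
    (fun y z e => Subtype.ext (h.lowExt_injOn y.2 z.2 e)) (R ⊔ shS (n + 1) B) M' hM'f (by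
      rintro v - w hw
      refine sup_rel_induction (P := fun w => w ∈ Set.range fun z : lowSet n W => lowExt n o z) hw
        ⟨v, rfl⟩ ?_ ?_
      · rintro _ z hyz ⟨y, rfl⟩
        by_cases hyW : (y : ℕ × ℕ) ∈ W
        · dsimp only at hyz
          rw [h.lowExt_eq hyW] at hyz
          obtain ⟨x, hx, rfl⟩ := hR _ hyW _ hyz
          exact ⟨⟨x, fun _ => hx⟩, h.lowExt_eq hx⟩
        · obtain ⟨h1, h2, h3⟩ := h.high y.2 hyW
          dsimp only at hyz
          rw [lowExt_of_lt h1] at hyz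
          rw [eq_of_notMem_supp hyz h3]
          exact ⟨y, lowExt_of_lt h1⟩
      · rintro y z (rfl | ⟨-, h2, -⟩) hy
        · exact hy
        · exact ⟨⟨z, fun h => by omega⟩, lowExt_of_lt (by dsimp only; omega)⟩)
  rw [e1] at k1
  rw [e2, h.comap_sup_eq B] at k2
  rw [← k2, k1]

end Transport

theorem loops_empty {α : Type*} (S : Setoid α) : loops S ∅ = 0 := by
  unfold loops
  simp

theorem re_lowExt {n : ℕ} {W : Set (ℕ × ℕ)} {o : ℕ × ℕ → ℕ × ℕ} {Q R : Setoid (ℕ × ℕ)}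
    (h : Transport n W o Q R) {v : ℕ × ℕ} (hv : v ∈ lowSet n W) :
    re (n + 1) (lowExt n o v) = lowExt n o (re (n + 1) v) := by
  have h1 := h.lowExt_le hv
  by_cases hn : v.1 ≤ n
  · have := h1.2 hn
    have e : re (n + 1) v = v := by rw [re, if_pos (by omega)]
    rw [e, re, if_pos (by omega)]
  · rw [Transport.lowExt_of_lt (by omega), Transport.lowExt_of_lt]
    rw [re, if_neg (by omega)]
    dsimp only
    omega

theorem re_mem_lowSet {n : ℕ} {W : Set (ℕ × ℕ)} {v : ℕ × ℕ} (hv : v ∈ lowSet n W) :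
    re (n + 1) v ∈ lowSet n W := by
  unfold re
  split_ifs with h
  · exact hv
  · intro h'
    dsimp only at h'
    omega

/-- Order preserving bijections of the vertices of the lower square extend to juxtapositions. -/
theorem IsOP.lowExt {N M : ℕ} {W W' X X' : Set (ℕ × ℕ)} {o : ℕ × ℕ → ℕ × ℕ} (h : IsOP N W W' o)
    (hNM : N ≤ M) (hfix : ∀ v ∈ W, 2 * N < v.1 → o v = v)
    (hlow : ∀ v ∈ W, v.1 ≤ 2 * N → (o v).1 ≤ 2 * N)
    (hX : ∀ v, v.1 ≤ 2 * N → (v ∈ X ↔ v ∈ W)) (hX' : ∀ v, v.1 ≤ 2 * N → (v ∈ X' ↔ v ∈ W'))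
    (hXX' : ∀ v, 2 * N < v.1 → (v ∈ X ↔ v ∈ X')) : IsOP M X X' (lowExt (2 * N) o) := by
  have e1 : ∀ v, v.1 ≤ 2 * N → SWB.lowExt (2 * N) o v = o v := fun v hv => if_pos hv
  have e2 : ∀ v, ¬ v.1 ≤ 2 * N → SWB.lowExt (2 * N) o v = v := fun v hv => if_neg hv
  have e3 : ∀ v ∈ X, (SWB.lowExt (2 * N) o v).1 ≤ 2 * N ↔ v.1 ≤ 2 * N := by
    intro v hv
    by_cases hn : v.1 ≤ 2 * N
    · rw [e1 v hn]
      exact iff_of_true (hlow v ((hX v hn).1 hv) hn) hn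
    · rw [e2 v hn]
  refine ⟨⟨fun v hv => ?_, fun u hu v hv e => ?_, fun w hw => ?_⟩, fun u hu v hv hlt => ?_⟩
  · by_cases hn : v.1 ≤ 2 * N
    · have := (hX v hn).1 hv
      rw [e1 v hn, hX' _ (hlow v this hn)]
      exact h.1.mapsTo this
    · rw [e2 v hn]
      exact (hXX' v (by omega)).1 hv
  · have h1 := e3 u hu
    rw [e, e3 v hv] at h1
    by_cases hn : v.1 ≤ 2 * N
    · have hn' := h1.1 hn
      rw [e1 u hn', e1 v hn] at e
      exact h.1.injOn ((hX u hn').1 hu) ((hX v hn).1 hv) e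
    · rwa [e2 u (fun hh => hn (h1.2 hh)), e2 v hn] at e
  · by_cases hn : w.1 ≤ 2 * N
    · obtain ⟨v, hv, rfl⟩ := h.1.surjOn ((hX' w hn).1 hw)
      have hn' : v.1 ≤ 2 * N := by
        by_contra hlt
        rw [hfix v hv (by omega)] at hn
        exact hlt hn
      exact ⟨v, (hX v hn').2 hv, e1 v hn'⟩
    · exact ⟨w, (hXX' w (by omega)).2 hw, e2 w hn⟩
  · have h1 := e3 u hu
    have h2 := e3 v hv
    by_cases hu' : u.1 ≤ 2 * N
    · by_cases hv' : v.1 ≤ 2 * N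
      · have huW := (hX u hu').1 hu
        have hvW := (hX v hv').1 hv
        rw [e1 u hu', e1 v hv', key_eq_of_le (N' := N) (v := o u) _ (hlow u huW hu'),
          key_eq_of_le (N' := N) (v := o v) _ (hlow v hvW hv')]
        · refine h.2 u huW v hvW ?_
          rwa [key_eq_of_le (N' := M) hu' (by omega), key_eq_of_le (N' := M) hv' (by omega)]
        · have := hlow v hvW hv'
          omega
        · have := hlow u huW hu'
          omega
      · rw [e2 v hv', key_lt_iff]
        have := h1.2 hu'
        omega
    · rw [key_lt_iff] at hlt
      have hv' : ¬ v.1 ≤ 2 * N := by omega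
      rw [e2 u hu', e2 v hv', key_lt_iff]
      exact hlt

/-! ### Changing the lower square under a fixed upper square -/

section Juxtaposition

variable {A A' B J J' : Datum} {W : Set (ℕ × ℕ)} {o : ℕ × ℕ → ℕ × ℕ}

/-- Data of the same rank with the same number of points on the top edge have the same points
there. -/
theorem top_mem_iff (hN : A'.N = A.N) (hf : A'.f (2 * A.N + 1) = A.f (2 * A.N + 1)) {v : ℕ × ℕ}
    (hv : 2 * A.N < v.1) : v ∈ A.V ↔ v ∈ A'.V := by
  by_cases h : v.1 = 2 * A.N + 1
  · rw [Frame.mem_V, Frame.mem_V, h, hf]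
  · constructor
    · intro hm
      have := Frame.site_le hm
      omega
    · intro hm
      have := Frame.site_le hm
      have hN' : A'.toFrame.N = A.N := hN
      omega

/-- The relabelling fixes the glued edge because the points there form a common final segment of
source and target. -/
theorem IsOP.transport {W' : Set (ℕ × ℕ)} {Q : Setoid (ℕ × ℕ)} (hN : A'.N = A.N)
    (hf : A'.f (2 * A.N + 1) = A.f (2 * A.N + 1)) (ho : IsOP A.N W W' o) (hW : W ⊆ A.V)
    (hW' : W' ⊆ A'.V) (htop : ∀ v ∈ A.V, v.1 = 2 * A.N + 1 → v ∈ W)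
    (htop' : ∀ v ∈ A'.V, v.1 = 2 * A.N + 1 → v ∈ W') (hQ : supp Q ⊆ A.V)
    (hrel : ∀ u ∈ W, ∀ w ∈ W, arcS A' (o u) (o w) ↔ Q u w) :
    Transport (2 * A.N) W o Q (arcS A') := by
  have hs : ∀ v ∈ W, v.1 ≤ 2 * A.N + 1 := fun v hv => Frame.site_le (hW hv)
  have hN' : A'.toFrame.N = A.N := hN
  have hV' : ∀ v ∈ A'.V, v.1 ≤ 2 * A.N + 1 := fun v hv => by
    have := Frame.site_le hv
    omega
  have ht := ho.top (A.V_finite.subset hW) hs (fun v hv => hV' v (hW' hv)) (fun a => by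
    have := top_mem_iff hN hf (v := (2 * A.N + 1, a)) (by simp)
    exact ⟨fun h => htop' _ (this.1 (hW h)) rfl, fun h => htop _ (this.2 (hW' h)) rfl⟩)
  refine ⟨hs, ho.1.injOn, ht.2, ht.1, fun u hu => ?_, fun u hu => ?_, hrel⟩
  · exact ⟨Frame.site_le (hQ hu), htop u (hQ hu)⟩
  · rw [supp_arcS] at hu
    exact ⟨hV' u hu, fun e => htop u ((top_mem_iff hN hf (by omega)).2 hu) e⟩

/-- The vertices of a juxtaposition at the sites of the lower square. -/
theorem juxt_low_mem (hf : ∀ i, J.f i = if i ≤ 2 * A.N then A.f i else B.f (i - 2 * A.N))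
    {v : ℕ × ℕ} (hv : v.1 ≤ 2 * A.N) : v ∈ J.V ↔ v ∈ A.V := by
  rw [Frame.mem_V, Frame.mem_V, hf, if_pos hv]

theorem juxt_high_mem (hN : A'.N = A.N)
    (hf : ∀ i, J.f i = if i ≤ 2 * A.N then A.f i else B.f (i - 2 * A.N))
    (hf' : ∀ i, J'.f i = if i ≤ 2 * A'.N then A'.f i else B.f (i - 2 * A'.N))
    {v : ℕ × ℕ} (hv : 2 * A.N < v.1) : v ∈ J.V ↔ v ∈ J'.V := by
  rw [Frame.mem_V, Frame.mem_V, hf, hf', hN, if_neg (by omega), if_neg (by omega)]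

/-- The arcs of the new juxtaposition are read off in the old stack, with `Q` replacing the arcs of
the lower square. -/
theorem Transport.arcS_juxt {Q : Setoid (ℕ × ℕ)} (h : Transport (2 * A.N) W o Q (arcS A'))
    (hN : A'.N = A.N) (hJ' : arcS J' = Setoid.comap (re (2 * A'.N + 1)) (stackS A' B)) {u w : ℕ × ℕ}
    (hu : u ∈ lowSet (2 * A.N) W) (hw : w ∈ lowSet (2 * A.N) W) :
    arcS J' (lowExt (2 * A.N) o u) (lowExt (2 * A.N) o w) ↔
      (Q ⊔ shS (2 * A.N + 1) (arcS B)) (re (2 * A.N + 1) u) (re (2 * A.N + 1) w) := by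
  rw [hJ', Setoid.comap_rel, stackS, hN, re_lowExt h hu, re_lowExt h hw,
    h.sup_iff _ (re_mem_lowSet hu) (re_mem_lowSet hw)]

theorem E_of_arcS {g : ℕ × ℕ → ℕ × ℕ} {u : ℕ × ℕ} (hne : g u ≠ g (J.E u))
    (h : arcS J' (g u) (g (J.E u))) : J'.E (g u) = g (J.E u) :=
  (arcS_iff.1 h).resolve_left hne

/-- For handle slides and deletions `X` is empty and linking numbers agree; for pull-throughs `X`
consists of the four removed vertices. -/
theorem linking_of_transport {Q : Setoid (ℕ × ℕ)} {X : Set (ℕ × ℕ)}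
    (h : Transport (2 * A.N) W o Q (arcS A')) (hN : A'.N = A.N)
    (hf : A'.f (2 * A.N + 1) = A.f (2 * A.N + 1)) (hXf : X.Finite)
    (hX : ∀ v ∈ X, v.1 ≤ 2 * A.N ∧ v ∉ W)
    (hQ : ∀ v w, v ∈ W ∪ X → Q v w → w ∈ W ∪ X)
    (hR : ∀ v ∈ W, ∀ w, arcS A' (o v) w → w ∈ o '' W) :
    loops (Q ⊔ shS (2 * A.N + 1) (arcS B)) X + linking A' B =
      loops (Q ⊔ shS (2 * A.N + 1) (arcS B)) (X ∪ stackMid A B) := by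
  have hmid : stackMid A' B = stackMid A B := by
    unfold stackMid
    ext v
    simp only [Set.mem_ofPred_eq, hN]
    refine and_congr_left fun e => ?_
    rw [mem_stackV, mem_stackV, hN, top_mem_iff hN hf (by omega)]
  rw [linking_eq, hmid, stackS, hN]
  exact h.loops_eq _ (fun v hv => by have := hv.2; omega) (stackMid_finite _ _) hXf hX hQ hR

end Juxtaposition

end SWB

namespace SWB

/-! ### Sites and arcs of a juxtaposition away from the glued edge -/

section Juxtaposition

variable {A A' B J J' : Datum}

theorem juxt_arcS (hc : Composable A B) (hJ : IsJuxtaposition A B J) :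
    arcS J = Setoid.comap (re (2 * A.N + 1)) (stackS A B) :=
  ((isJuxtaposition_iff hc).1 hJ).2.2.2.2

theorem re_low {n : ℕ} {v : ℕ × ℕ} (h : v.1 ≤ n) : re (n + 1) v = v := by
  rw [re, if_pos (by omega)]

/-- The arcs of the lower square which do not touch the glued edge are arcs of the
juxtaposition. -/
theorem juxt_E_low (hc : Composable A B) (hJ : IsJuxtaposition A B J) {u : ℕ × ℕ}
    (hu : u.1 ≤ 2 * A.N) (hE : (A.E u).1 ≤ 2 * A.N) : J.E u = A.E u := by
  have h : arcS J u (A.E u) := by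
    rw [juxt_arcS hc hJ, Setoid.comap_rel, re_low hu, re_low hE]
    exact sup_left (Or.inr rfl)
  by_cases huV : u ∈ A.V
  · exact h.resolve_left fun e => (A.E_ne u).2 huV e.symm
  · rw [Datum.E_out huV, Datum.E_out]
    rwa [juxt_low_mem hJ.2.2.2.1 hu]

theorem juxt_iota_low (hJ : IsJuxtaposition A B J) {u : ℕ × ℕ} (hu : u.1 ≤ 2 * A.N) :
    J.iota u = A.iota u := by
  obtain ⟨-, hP, hs, hf, -⟩ := hJ
  unfold Frame.iota
  rw [hP, hs, hf, if_pos hu, if_pos hu, if_pos hu]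

theorem juxt_P_high (hJ : IsJuxtaposition A B J) {k : ℕ} (hk : 2 * A.N < k) :
    2 * A.N < J.P k := by
  rw [hJ.2.1, if_neg (by omega)]
  by_cases h : 1 ≤ k - 2 * A.N ∧ k - 2 * A.N ≤ 2 * B.N
  · have := B.P_mem h
    omega
  · rw [B.P_out h]
    omega

theorem ncard_site (F : Frame) (i : ℕ) : {v | v ∈ F.V ∧ v.1 = i}.ncard = F.f i := by
  have : {v | v ∈ F.V ∧ v.1 = i} = (fun a => (i, a)) '' (Finset.Icc 1 (F.f i) : Set ℕ) := by
    ext ⟨j, a⟩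
    simp only [Frame.mem_V, Set.mem_ofPred_eq, Set.mem_image, Finset.coe_Icc, Set.mem_Icc,
      Prod.mk.injEq]
    constructor
    · rintro ⟨h, rfl⟩
      exact ⟨a, h, rfl, rfl⟩
    · rintro ⟨b, h, rfl, rfl⟩
      exact ⟨h, rfl⟩
  rw [this, Set.ncard_image_of_injective _ (Prod.mk_right_injective i), Set.ncard_coe_finset,
    Nat.card_Icc, Nat.add_sub_cancel]

/-! ### Handle slides of the lower square -/

/-- Sites of the lower square keep their numbers in the juxtaposition, and the site permutation is
already the identity above them, so the same slide data work. The new parallel arcs stay below the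
glued edge and the old ones are transported. -/
theorem IsHandleSlide.juxt {i : ℕ} {ε : ℤ} (hc : Composable A B) (hc' : Composable A' B)
    (hJ : IsJuxtaposition A B J) (hJ' : IsJuxtaposition A' B J') (h : IsHandleSlide A i ε A') :
    IsHandleSlide J i ε J' ∧ linking A' B = linking A B := by
  obtain ⟨j, σ, hε, hj, hi, hjI, hne, hσ, hmono, hσi, hN, hP, hs, hf, ⟨o, ho, hoE⟩, hnew⟩ := h
  have hPj := A.P_mem hjI
  have hPi := A.P_mem hi
  have htopf : A'.f (2 * A.N + 1) = A.f (2 * A.N + 1) := by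
    rw [Composable, hN] at hc'
    exact hc'.trans hc.symm
  have hσlow : ∀ k, k ≤ 2 * A.N → σ k ≤ 2 * A.N := fun k hk => by
    by_cases h : 1 ≤ k ∧ k ≤ 2 * A.N
    · exact ((perm_internal hσ).2 h).2
    · rwa [hσ k h]
  have hσhigh : ∀ k, 2 * A.N < k → σ k = k := fun k hk => hσ k (by omega)
  have hnv : ∀ v ∈ newVertices (σ i) (σ (A.P j)) (A.f i) (A.f j), v.1 ≤ 2 * A.N := by
    rintro v (⟨h, -⟩ | ⟨h, -⟩)
    · rw [h]
      exact hσlow _ hi.2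
    · rw [h]
      exact hσlow _ hPj.2
  have tr : Transport (2 * A.N) A.V o (arcS A) (arcS A') := by
    refine ho.transport hN htopf subset_rfl (fun v hv => hv.1) (fun v hv _ => hv)
      (fun v hv e => ⟨hv, fun h => ?_⟩) (supp_arcS A).le (fun u hu w hw => ?_)
    · have := hnv v h
      omega
    · rw [arcS_iff, arcS_iff, hoE u hu, ho.1.injOn.eq_iff hu hw,
        ho.1.injOn.eq_iff (Datum.E_mem hu) hw]
  have hJN := hJ.1
  have hJN' := hJ'.1
  have hJP := hJ.2.1
  have hJP' := hJ'.2.1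
  have hJs := hJ.2.2.1
  have hJs' := hJ'.2.2.1
  have hJf := hJ.2.2.2.1
  have hJf' := hJ'.2.2.2.1
  have ePi : J.P i = A.P i := by rw [hJP, if_pos hi.2]
  have ePj : J.P j = A.P j := by rw [hJP, if_pos hjI.2]
  have esj : J.s j = A.s j := by rw [hJs, if_pos hjI.2]
  have efi : J.f i = A.f i := by rw [hJf, if_pos hi.2]
  have efj : J.f j = A.f j := by rw [hJf, if_pos hjI.2]
  have hlowV : ∀ v ∈ J.V, v ∈ lowSet (2 * A.N) A.V := fun v hv hn => (juxt_low_mem hJf hn).1 hv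
  refine ⟨⟨j, σ, hε, hj, ⟨hi.1, by omega⟩, ⟨hjI.1, by omega⟩, by rwa [ePi], fun k hk => hσ k (by omega),
    ?_, by rwa [ePj, esj], by omega, fun k => ?_, fun k => ?_, fun k => ?_,
    ⟨lowExt (2 * A.N) o, ?_, fun u hu => ?_⟩, ?_⟩, ?_⟩
  · rintro x ⟨hx, hxi⟩ y ⟨hy, hyi⟩ hxy
    by_cases h2 : y ≤ 2 * A.N
    · exact hmono ⟨⟨hx.1, by omega⟩, hxi⟩ ⟨⟨hy.1, h2⟩, hyi⟩ hxy
    · rw [hσhigh y (by omega)]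
      by_cases h1 : x ≤ 2 * A.N
      · have := hσlow x h1
        omega
      · rwa [hσhigh x (by omega)]
  · by_cases hk : k ≤ 2 * A.N
    · rw [hJP', hJP, if_pos hk, if_pos (by rw [hN]; exact hσlow k hk), hP]
    · rw [hσhigh k (by omega), hσhigh _ (juxt_P_high hJ (by omega)), hJP, hJP', hN, if_neg hk,
        if_neg hk]
  · by_cases hk : k ≤ 2 * A.N
    · rw [hJs', hJs, if_pos hk, if_pos (by rw [hN]; exact hσlow k hk), hs, ePi, esj]
    · rw [hσhigh k (by omega), hJs', hJs, hN, if_neg hk, if_neg hk, if_neg (by omega), add_zero]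
  · by_cases hk : k ≤ 2 * A.N
    · rw [hJf', hJf, if_pos hk, if_pos (by rw [hN]; exact hσlow k hk), hf, ePj, efi]
    · rw [hσhigh k (by omega), hJf', hJf, hN, if_neg hk, if_neg hk, if_neg (by omega), add_zero]
  · rw [ePj, efi, efj]
    refine ho.lowExt (by omega) (fun v hv hlt => tr.top v hv ?_) tr.low
      (fun v hv => juxt_low_mem hJf hv) (fun v hv => ?_) (fun v hv => ?_)
    · have := Frame.site_le hv
      omega
    · rw [Set.mem_sdiff, Set.mem_sdiff, juxt_low_mem hJf' (by omega)]
    · rw [Set.mem_sdiff, ← juxt_high_mem hN hJf hJf' hv, and_iff_left]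
      intro h
      have := hnv v h
      omega
  · have hE := Datum.E_mem hu
    refine E_of_arcS (fun e => (J.E_ne u).2 hu ?_) ?_
    · exact (tr.lowExt_injOn (hlowV u hu) (hlowV _ hE) e).symm
    · rw [tr.arcS_juxt hN (juxt_arcS hc' hJ') (hlowV u hu) (hlowV _ hE)]
      have : arcS J u (J.E u) := Or.inr rfl
      rwa [juxt_arcS hc hJ, Setoid.comap_rel] at this
  · intro b hb1 hb2
    rw [efi] at hb2
    rw [ePj, efi, efj, ← hnew b hb1 hb2]
    refine juxt_E_low hc' hJ' (by rw [hN]; exact hσlow i hi.2) ?_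
    rw [hnew b hb1 hb2, hN]
    unfold newArc
    split_ifs <;> exact hσlow _ hPj.2
  · have := linking_of_transport (B := B) (X := ∅) tr hN htopf Set.finite_empty
      (fun v hv => hv.elim) (fun v w hv hw => ?_) (fun v hv w hw => ?_)
    · rw [loops_empty, zero_add, Set.empty_union] at this
      rw [this, linking_eq]
    · rw [Set.union_empty] at hv ⊢
      rcases hw with rfl | rfl
      · exact hv
      · exact Datum.E_mem hv
    · rcases hw with rfl | rfl
      · exact ⟨v, hv, rfl⟩
      · exact ⟨A.E v, Datum.E_mem hv, (hoE v hv).symm⟩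

/-! ### Deletions in the lower square -/

section Component

variable {Γ : Set (ℕ × ℕ)} (hΓ : A.IsInternalComponent Γ)

include hΓ

/-- A closed curve of the lower square has no vertex on the glued edge, so gluing changes none of
its arcs. -/
theorem Datum.IsInternalComponent.juxt (hc : Composable A B) (hJ : IsJuxtaposition A B J) :
    J.IsInternalComponent Γ := by
  have hi : ∀ u ∈ Γ, u.1 ≤ 2 * A.N := fun u hu => (hΓ.2 u hu).2
  have hJN := hJ.1
  have hI : ∀ u ∈ Γ, J.Internal u := fun u hu => ⟨(hΓ.2 u hu).1, by have := hi u hu; omega⟩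
  refine ⟨?_, hI⟩
  have := hΓ.1.map (Θ' := J) id (fun u hu => (juxt_low_mem hJ.2.2.2.1 (hi u hu)).2 (hΓ.1.subset hu))
    (fun u hu => juxt_E_low hc hJ (hi u hu) (hi _ (hΓ.1.E_mem hu)))
    (fun u hu => iff_of_true (hI u hu) (hΓ.2 u hu)) (fun u hu _ => juxt_iota_low hJ (hi u hu))
  rwa [Set.image_id] at this

theorem Datum.twist_juxt (hJ : IsJuxtaposition A B J) : J.twist Γ = A.twist Γ := by
  unfold twist
  congr 2
  ext v
  refine and_congr_right fun hv => ?_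
  have := (hΓ.2 v hv).2
  rw [hJ.2.1, hJ.2.2.1, if_pos this, if_pos this]

/-- The deleted curve is closed and lies below the glued edge, so paths crossing that edge never
meet it. -/
theorem IsDeletion.juxt (hc : Composable A B) (hc' : Composable A' B)
    (hJ : IsJuxtaposition A B J) (hJ' : IsJuxtaposition A' B J') (h : IsDeletion A Γ A') :
    IsDeletion J Γ J' ∧ linking A' B = linking A B := by
  obtain ⟨hch, hf, o, ho, hoE⟩ := h
  have hN : A'.N = A.N := congrArg ChordDatum.N hch
  have htopf : A'.f (2 * A.N + 1) = A.f (2 * A.N + 1) := by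
    rw [Composable, hN] at hc'
    exact hc'.trans hc.symm
  have hΓi : ∀ u ∈ Γ, u.1 ≤ 2 * A.N := fun u hu => (hΓ.2 u hu).2
  have hWE : ∀ u ∈ A.V \ Γ, A.E u ∈ A.V \ Γ := fun u hu =>
    ⟨Datum.E_mem hu.1, fun h => hu.2 (hΓ.1.E_mem_iff.1 h)⟩
  have tr : Transport (2 * A.N) (A.V \ Γ) o (arcS A) (arcS A') := by
    refine ho.transport hN htopf (fun v hv => hv.1) subset_rfl (fun v hv e => ⟨hv, fun h => ?_⟩)
      (fun v hv e => hv) (supp_arcS A).le (fun u hu w hw => ?_)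
    · have := hΓi v h
      omega
    · rw [arcS_iff, arcS_iff, hoE u hu, ho.1.injOn.eq_iff hu hw,
        ho.1.injOn.eq_iff (hWE u hu) hw]
  have hJN := hJ.1
  have hJN' := hJ'.1
  have hJf := hJ.2.2.2.1
  have hJf' := hJ'.2.2.2.1
  have hΓJ := hΓ.juxt hc hJ
  have hlowV : ∀ v ∈ J.V \ Γ, v ∈ lowSet (2 * A.N) (A.V \ Γ) := fun v hv hn =>
    ⟨(juxt_low_mem hJf hn).1 hv.1, hv.2⟩
  refine ⟨⟨?_, fun i => ?_, lowExt (2 * A.N) o, ?_, fun u hu => ?_⟩, ?_⟩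
  · refine ChordDatum.ext' (by rw [hJN, hJN', hN]) (fun i => ?_) (fun i => ?_)
    · rw [hJ.2.1, hJ'.2.1, hN, hch]
    · rw [hJ.2.2.1, hJ'.2.2.1, hN, hch]
  · rw [hJf']
    by_cases hi : i ≤ 2 * A.N
    · rw [if_pos (by rwa [hN]), hf]
      congr 1
      ext v
      refine and_congr_left ?_
      rintro rfl
      rw [Set.mem_sdiff, Set.mem_sdiff, juxt_low_mem hJf hi]
    · rw [if_neg (by rwa [hN]), hN, ← (show J.f i = B.f (i - 2 * A.N) by rw [hJf, if_neg hi]),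
        ← ncard_site]
      congr 1
      ext v
      refine and_congr_left ?_
      rintro rfl
      rw [Set.mem_sdiff, and_iff_left]
      exact fun h => hi (hΓi v h)
  · refine ho.lowExt (by omega) (fun v hv hlt => tr.top v hv ?_) tr.low
      (fun v hv => ?_) (fun v hv => juxt_low_mem hJf' (by omega)) (fun v hv => ?_)
    · have := Frame.site_le hv.1
      omega
    · rw [Set.mem_sdiff, Set.mem_sdiff, juxt_low_mem hJf hv]
    · rw [Set.mem_sdiff, ← juxt_high_mem hN hJf hJf' hv, and_iff_left]
      intro h
      have := hΓi v h
      omega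
  · have hE : J.E u ∈ J.V \ Γ := ⟨Datum.E_mem hu.1, fun h => hu.2 (hΓJ.1.E_mem_iff.1 h)⟩
    refine E_of_arcS (fun e => (J.E_ne u).2 hu.1 ?_) ?_
    · exact (tr.lowExt_injOn (hlowV u hu) (hlowV _ hE) e).symm
    · rw [tr.arcS_juxt hN (juxt_arcS hc' hJ') (hlowV u hu) (hlowV _ hE)]
      have : arcS J u (J.E u) := Or.inr rfl
      rwa [juxt_arcS hc hJ, Setoid.comap_rel] at this
  · have := linking_of_transport (B := B) (X := ∅) tr hN htopf Set.finite_empty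
      (fun v hv => hv.elim) (fun v w hv hw => ?_) (fun v hv w hw => ?_)
    · rw [loops_empty, zero_add, Set.empty_union] at this
      rw [this, linking_eq]
    · rw [Set.union_empty] at hv ⊢
      rcases hw with rfl | rfl
      · exact hv
      · exact hWE v hv
    · rcases hw with rfl | rfl
      · exact ⟨v, hv, rfl⟩
      · exact ⟨A.E v, hWE v hv, (hoE v hv).symm⟩

end Component

end Juxtaposition

end SWB

namespace SWB

/-! ### Separating components in juxtapositions -/

/-- Whether chords cross is determined by the comparisons of the ends of the one with those of the
other. -/
theorem crosses_congr {L L' : Type*} [LinearOrder L] [LinearOrder L'] {a b c d : L}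
    {a' b' c' d' : L'} (hac : a < c ↔ a' < c') (hca : c < a ↔ c' < a') (had : a < d ↔ a' < d')
    (hda : d < a ↔ d' < a') (hbc : b < c ↔ b' < c') (hcb : c < b ↔ c' < b') (hbd : b < d ↔ b' < d')
    (hdb : d < b ↔ d' < b') (n1 : a ≠ c) (n2 : a ≠ d) (n3 : b ≠ c) (n4 : b ≠ d) :
    Crosses a b c d ↔ Crosses a' b' c' d' := by
  rw [← not_iff_not, not_crosses_iff n1 n2 n3 n4, not_crosses_iff, hca, hda, hcb, hdb]
  all_goals
    intro e
    subst e
    simp only [lt_irrefl, iff_false, not_lt] at *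
    first
    | exact n1 (le_antisymm hca hac)
    | exact n2 (le_antisymm hda had)
    | exact n3 (le_antisymm hcb hbc)
    | exact n4 (le_antisymm hdb hbd)

theorem not_crosses_self {L : Type*} [LinearOrder L] (a c d : L) : ¬ Crosses a a c d := by
  unfold Crosses
  rw [min_self, max_self]
  rintro (⟨h1, h2, h3⟩ | ⟨h1, h2, h3⟩)
  · exact lt_asymm h1 h2
  · exact lt_asymm h2 h3

/-- The collapse of the regions at the sites `> n` to a single one. -/
def collapse (n : ℕ) (x : ℕ × ℕ) : ℕ × ℕ := if x.1 ≤ n then x else (n + 1, 0)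

/-- Condition for two regions to be adjacent in the square. -/
def Datum.SquareAdj (Θ : Datum) (x y : ℕ × ℕ) : Prop :=
  x ∈ Θ.regions ∧ y ∈ Θ.regions ∧ ∀ v ∈ Θ.V,
    ¬ Crosses (key Θ.N (x.1, 2 * x.2 + 1)) (key Θ.N (y.1, 2 * y.2 + 1))
      (key Θ.N (v.1, 2 * v.2)) (key Θ.N ((Θ.E v).1, 2 * (Θ.E v).2))

/-- Condition for two regions to be the ends of the same region of a band. -/
def Datum.BandAdj (Θ : Datum) (x y : ℕ × ℕ) : Prop :=
  x ∈ Θ.regions ∧ Θ.Internal x ∧ y = (Θ.P x.1, if Θ.s x.1 = 0 then Θ.f x.1 - x.2 else x.2)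

theorem Datum.complement_adj {Θ : Datum} {x y : ℕ × ℕ} : Θ.complementGraph.Adj x y ↔
    x ≠ y ∧ ((Θ.BandAdj x y ∨ Θ.SquareAdj x y) ∨ (Θ.BandAdj y x ∨ Θ.SquareAdj y x)) := by
  rw [complementGraph, SimpleGraph.fromRel_adj]
  rfl

theorem Datum.SquareAdj.reachable {Θ : Datum} {x y : ℕ × ℕ} (h : Θ.SquareAdj x y) :
    Θ.complementGraph.Reachable x y := by
  by_cases e : x = y
  · rw [e]
  · exact SimpleGraph.Adj.reachable (complement_adj.2 ⟨e, Or.inl (Or.inr h)⟩)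

theorem Datum.BandAdj.reachable {Θ : Datum} {x y : ℕ × ℕ} (h : Θ.BandAdj x y) :
    Θ.complementGraph.Reachable x y := by
  by_cases e : x = y
  · rw [e]
  · exact SimpleGraph.Adj.reachable (complement_adj.2 ⟨e, Or.inl (Or.inl h)⟩)

theorem Datum.complement_induction {Θ : Datum} {x y : ℕ × ℕ} {Q : ℕ × ℕ → ℕ × ℕ → Prop}
    (h : Θ.complementGraph.Reachable x y) (hrefl : ∀ x, Q x x) (hsymm : ∀ x y, Q x y → Q y x)
    (htrans : ∀ x y z, Q x y → Q y z → Q x z) (hB : ∀ x y, Θ.BandAdj x y → Q x y)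
    (hS : ∀ x y, Θ.SquareAdj x y → Q x y) : Q x y := by
  rw [SimpleGraph.reachable_iff_reflTransGen] at h
  induction h with
  | refl => exact hrefl _
  | tail _ hadj ih =>
    refine htrans _ _ _ ih ?_
    rcases (complement_adj.1 hadj).2 with (h | h) | (h | h)
    · exact hB _ _ h
    · exact hS _ _ h
    · exact hsymm _ _ (hB _ _ h)
    · exact hsymm _ _ (hS _ _ h)

section Extend

variable {Θ Ξ : Datum} (hN : Θ.N ≤ Ξ.N) (hP : ∀ k, k ≤ 2 * Θ.N → Ξ.P k = Θ.P k)
  (hP' : ∀ k, 2 * Θ.N < k → 2 * Θ.N < Ξ.P k) (hs : ∀ k, k ≤ 2 * Θ.N → Ξ.s k = Θ.s k)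
  (hf : ∀ k, k ≤ 2 * Θ.N → Ξ.f k = Θ.f k) (hf0 : Θ.f (2 * Θ.N + 1) = 0) (hE : ∀ v, Ξ.E v = Θ.E v)

-- All chord ends lie at the sites of the smaller rank, since nothing ends on the top edge of `Θ`.
-- Every region at a higher site is therefore above all chord ends and is indistinguishable from the
-- single region on the top edge of `Θ`.
include hN hf hf0 hE in
theorem Datum.squareAdj_extend {x y : ℕ × ℕ} (hx : x ∈ Ξ.regions) (hy : y ∈ Ξ.regions) :
    Θ.SquareAdj (collapse (2 * Θ.N) x) (collapse (2 * Θ.N) y) ↔ Ξ.SquareAdj x y := by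
  have hV : Ξ.V = Θ.V := by
    ext v
    rw [← Ξ.E_ne, ← Θ.E_ne, hE]
  have hlow : ∀ v ∈ Θ.V, v.1 ≤ 2 * Θ.N := by
    intro v hv
    have h1 := Frame.site_le hv
    by_contra h2
    have h3 : v.1 = 2 * Θ.N + 1 := by omega
    have h4 := hv
    rw [Frame.mem_V, h3, hf0] at h4
    omega
  have hreg : ∀ x ∈ Ξ.regions, collapse (2 * Θ.N) x ∈ Θ.regions := by
    intro x hx
    have := hx.2
    unfold collapse
    split_ifs with h
    · rw [hf _ h] at this
      exact ⟨by omega, this⟩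
    · exact ⟨le_rfl, Nat.zero_le _⟩
  have cmp : ∀ x ∈ Ξ.regions, ∀ v ∈ Θ.V,
      (key Θ.N ((collapse (2 * Θ.N) x).1, 2 * (collapse (2 * Θ.N) x).2 + 1) <
        key Θ.N (v.1, 2 * v.2) ↔ key Ξ.N (x.1, 2 * x.2 + 1) < key Ξ.N (v.1, 2 * v.2)) ∧
      (key Θ.N (v.1, 2 * v.2) < key Θ.N ((collapse (2 * Θ.N) x).1,
        2 * (collapse (2 * Θ.N) x).2 + 1) ↔
        key Ξ.N (v.1, 2 * v.2) < key Ξ.N (x.1, 2 * x.2 + 1)) ∧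
      key Θ.N ((collapse (2 * Θ.N) x).1, 2 * (collapse (2 * Θ.N) x).2 + 1) ≠
        key Θ.N (v.1, 2 * v.2) := by
    intro x hx v hv
    have h1 := hlow v hv
    refine ⟨?_, ?_, fun e => ?_⟩
    · rw [key_lt_iff, key_lt_iff]
      unfold collapse
      split_ifs <;> dsimp only at * <;> omega
    · rw [key_lt_iff, key_lt_iff]
      unfold collapse
      split_ifs <;> dsimp only at * <;> omega
    · have := congrArg Prod.snd (key_injective _ e)
      dsimp only at this
      omega
  refine and_congr (iff_of_true (hreg x hx) hx) (and_congr (iff_of_true (hreg y hy) hy) ?_)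
  rw [hV]
  refine forall₂_congr fun v hv => not_congr ?_
  have hv' := E_mem hv
  rw [hE]
  exact crosses_congr (cmp x hx v hv).1 (cmp x hx v hv).2.1 (cmp x hx _ hv').1 (cmp x hx _ hv').2.1
    (cmp y hy v hv).1 (cmp y hy v hv).2.1 (cmp y hy _ hv').1 (cmp y hy _ hv').2.1
    (cmp x hx v hv).2.2 (cmp x hx _ hv').2.2 (cmp y hy v hv).2.2 (cmp y hy _ hv').2.2

include hN hP hP' hs hf hf0 hE in
/-- Adding bands not traversed by curves preserves the number of complementary components. -/
theorem Datum.numComponents_extend :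
    numComponents Ξ.complementGraph Ξ.regions = numComponents Θ.complementGraph Θ.regions := by
  have hsq := fun {x y} => Datum.squareAdj_extend (x := x) (y := y) hN hf hf0 hE
  have hreg : ∀ x ∈ Ξ.regions, collapse (2 * Θ.N) x ∈ Θ.regions := fun x hx =>
    ((hsq hx hx).2 ⟨hx, hx, fun v _ => not_crosses_self _ _ _⟩).1
  have hreg' : ∀ x ∈ Θ.regions, x ∈ Ξ.regions ∧ collapse (2 * Θ.N) x = x := by
    intro x hx
    have h1 := hx.1
    have h2 := hx.2
    by_cases h : x.1 ≤ 2 * Θ.N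
    · refine ⟨⟨by omega, by rwa [hf _ h]⟩, if_pos h⟩
    · have h3 : x.1 = 2 * Θ.N + 1 := by omega
      rw [h3, hf0] at h2
      refine ⟨⟨by omega, by omega⟩, ?_⟩
      rw [collapse, if_neg h]
      exact Prod.ext h3.symm (by omega)
  -- A region and its collapse have the same collapse, and a degenerate chord crosses nothing.
  have hcol : ∀ x ∈ Ξ.regions, Ξ.complementGraph.Reachable x (collapse (2 * Θ.N) x) := by
    intro x hx
    refine Datum.SquareAdj.reachable ?_
    have h1 := hreg' _ (hreg x hx)
    rw [← hsq hx h1.1, h1.2]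
    exact ⟨hreg x hx, hreg x hx, fun v _ => not_crosses_self _ _ _⟩
  refine numComponents_congr (collapse (2 * Θ.N)) hreg (fun x hx y hy => ⟨fun h => ?_, fun h => ?_⟩)
    (fun y hy => ⟨y, (hreg' y hy).1, by rw [(hreg' y hy).2]⟩)
  · refine complement_induction (Q := fun x y => Θ.complementGraph.Reachable
      (collapse (2 * Θ.N) x) (collapse (2 * Θ.N) y)) h (fun _ => SimpleGraph.Reachable.refl _)
      (fun _ _ h => h.symm) (fun _ _ _ h h' => h.trans h') ?_ ?_
    · intro x y hxy
      by_cases hx : x.1 ≤ 2 * Θ.N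
      · refine Datum.BandAdj.reachable ?_
        have h1 := hreg x hxy.1
        obtain ⟨h2, h3, rfl⟩ := hxy
        have h4 : 1 ≤ x.1 ∧ x.1 ≤ 2 * Θ.N := ⟨h3.1, hx⟩
        have h5 := Θ.P_mem h4
        rw [hP _ hx, hs _ hx, hf _ hx]
        have e1 : collapse (2 * Θ.N) x = x := if_pos hx
        rw [e1] at h1 ⊢
        refine ⟨h1, h4, ?_⟩
        rw [collapse, if_pos h5.2]
      -- An added band has both ends above, and both collapse to the same region.
      · have h1 : ¬ y.1 ≤ 2 * Θ.N := by
          rw [hxy.2.2]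
          have := hP' x.1 (by omega)
          dsimp only
          omega
        rw [collapse, collapse, if_neg hx, if_neg h1]
    · intro x y hxy
      exact ((hsq hxy.1 hxy.2.1).2 hxy).reachable
  · refine (hcol x hx).trans (SimpleGraph.Reachable.trans ?_ (hcol y hy).symm)
    refine complement_induction (Q := fun x y => Ξ.complementGraph.Reachable x y)
      h (fun _ => SimpleGraph.Reachable.refl _)
      (fun _ _ h => h.symm) (fun _ _ _ h h' => h.trans h') ?_ ?_
    · rintro x y ⟨h1, h2, rfl⟩
      refine Datum.BandAdj.reachable ⟨(hreg' x h1).1, ⟨h2.1, ?_⟩, ?_⟩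
      · have := h2.2
        omega
      · rw [hP _ h2.2, hs _ h2.2, hf _ h2.2]
    · intro x y hxy
      obtain ⟨h1, e1⟩ := hreg' x hxy.1
      obtain ⟨h2, e2⟩ := hreg' y hxy.2.1
      refine ((hsq h1 h2).1 ?_).reachable
      rwa [e1, e2]

end Extend

section Juxtaposition

variable {A B J : Datum} {Γ : Set (ℕ × ℕ)}

/-- The restrictions of a juxtaposition and of its lower square to an internal component of the
latter have the same complementary components. -/
theorem exists_restriction_juxt (hΓ : A.IsInternalComponent Γ) (hc : Composable A B)
    (hJ : IsJuxtaposition A B J)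
    {Θ : Datum} (h : IsRestriction A Γ Θ) :
    ∃ Ξ, IsRestriction J Γ Ξ ∧
      numComponents Ξ.complementGraph Ξ.regions = numComponents Θ.complementGraph Θ.regions := by
  obtain ⟨hch, hf, o, ho, hoE⟩ := h
  have hJE : ∀ v ∈ Γ, J.E v = A.E v := fun v hv =>
    juxt_E_low hc hJ (hΓ.2 v hv).2 (hΓ.2 _ (hΓ.1.E_mem hv)).2
  obtain ⟨hJN, hJP, hJs, hJf, -⟩ := hJ
  have hN : Θ.N = A.N := congrArg ChordDatum.N hch
  have hlow : ∀ v ∈ Γ, v.1 ≤ 2 * A.N := fun v hv => (hΓ.2 v hv).2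
  have hΘf : ∀ i, ¬ (1 ≤ i ∧ i ≤ 2 * A.N) → Θ.f i = 0 := by
    intro i hi
    rw [hf]
    have : {v | v ∈ Γ ∧ v.1 = i} = ∅ := by
      rw [Set.eq_empty_iff_forall_notMem]
      rintro v ⟨hv, rfl⟩
      exact hi (hΓ.2 v hv)
    rw [this, Set.ncard_empty]
  have hΘV : ∀ v ∈ Θ.V, 1 ≤ v.1 ∧ v.1 ≤ 2 * A.N := by
    intro v hv
    by_contra h
    rw [Frame.mem_V, hΘf _ h] at hv
    omega
  have hkey : ∀ v : ℕ × ℕ, v.1 ≤ 2 * A.N → key J.N v = key A.N v := fun v hv =>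
    key_eq_of_le (by omega) hv
  have hPhigh : ∀ k, 2 * A.N < k → 2 * A.N < J.P k := by
    intro k hk
    rw [hJP, if_neg (by omega)]
    by_cases h : 1 ≤ k - 2 * A.N ∧ k - 2 * A.N ≤ 2 * B.N
    · have := B.P_mem h
      omega
    · rw [B.P_out h]
      omega
  -- The curves of `Θ` drawn in the frame of the juxtaposition, with no points on the bands of the
  -- upper square.
  let Ξ : Datum :=
    { J.toFrame with
      f := Θ.f
      f_P := fun i => by
        by_cases hi : i ≤ 2 * A.N
        · have : J.P i = Θ.P i := by rw [hJP, if_pos hi, hch]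
          change Θ.f (J.P i) = Θ.f i
          rw [this, Θ.f_P]
        · have := hPhigh i (by omega)
          change Θ.f (J.P i) = Θ.f i
          rw [hΘf _ (by omega), hΘf _ (by omega)]
      f_out := fun i hi => hΘf i (by omega)
      E := Θ.E
      E_E := Θ.E_E
      E_ne := Θ.E_ne
      noncrossing := fun u hu v hv => by
        have hu' : u ∈ Θ.V := hu
        have hv' : v ∈ Θ.V := hv
        have := Θ.noncrossing u hu' v hv'
        rw [hN] at this
        rwa [hkey _ (hΘV _ hu').2, hkey _ (hΘV _ hv').2, hkey _ (hΘV _ (Datum.E_mem hu')).2,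
          hkey _ (hΘV _ (Datum.E_mem hv')).2] }
  refine ⟨Ξ, ⟨rfl, hf, o, ⟨ho.1, fun u hu v hv hlt => ?_⟩, fun v hv => ?_⟩, ?_⟩
  · rw [hkey _ (hlow u hu), hkey _ (hlow v hv)] at hlt
    rw [hkey _ (hΘV _ (ho.1.mapsTo hu)).2, hkey _ (hΘV _ (ho.1.mapsTo hv)).2]
    exact ho.2 u hu v hv hlt
  · rw [hJE v hv]
    exact hoE v hv
  · refine Datum.numComponents_extend (Θ := Θ) (Ξ := Ξ) ?_ ?_ ?_ ?_ ?_ ?_ ?_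
    · change Θ.N ≤ J.N
      omega
    · intro k hk
      change J.P k = Θ.P k
      rw [hJP, if_pos (by omega), hch]
    · intro k hk
      change 2 * Θ.N < J.P k
      rw [hN] at hk ⊢
      exact hPhigh k hk
    · intro k hk
      change J.s k = Θ.s k
      rw [hJs, if_pos (by omega), hch]
    · intro k hk
      rfl
    · exact hΘf _ (by omega)
    · intro v
      rfl

theorem Datum.IsSeparating.juxt (hΓ : A.IsInternalComponent Γ) (hc : Composable A B)
    (hJ : IsJuxtaposition A B J)
    (h : A.IsSeparating Γ) : J.IsSeparating Γ := by
  obtain ⟨Θ, hr, hn⟩ := h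
  obtain ⟨Ξ, hr', hn'⟩ := exists_restriction_juxt hΓ hc hJ hr
  exact ⟨Ξ, hr', hn'.trans hn⟩

theorem Datum.IsNonSeparating.juxt (hΓ : A.IsInternalComponent Γ) (hc : Composable A B)
    (hJ : IsJuxtaposition A B J)
    (h : A.IsNonSeparating Γ) : J.IsNonSeparating Γ := by
  obtain ⟨Θ, hr, hn⟩ := h
  obtain ⟨Ξ, hr', hn'⟩ := exists_restriction_juxt hΓ hc hJ hr
  exact ⟨Ξ, hr', hn'.trans hn⟩

end Juxtaposition

end SWB

namespace SWB

/-! ### Components bounding an annulus -/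

section Parallel

variable {Θ : Datum} {i a b : ℕ}

/-- The pairing `(k, 1) ↔ (k, 2)` at the sites `i` and `j`. -/
def swapOneTwo (i j : ℕ) (v : ℕ × ℕ) : ℕ × ℕ :=
  if v.1 = i ∨ v.1 = j then (v.1, if v.2 = 1 then 2 else if v.2 = 2 then 1 else v.2) else v

/-- The datum with the bands of `Θ` and two arcs joining the ends of two parallel arcs running
through the band at the site `i`. -/
def Datum.annulus (Θ : Datum) {i : ℕ} (hi : 1 ≤ i ∧ i ≤ 2 * Θ.N) : Datum where
  toChordDatum := Θ.toChordDatum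
  f k := if k = i ∨ k = Θ.P i then 2 else 0
  f_P k := by
    have h1 : Θ.P k = i ↔ k = Θ.P i := ⟨fun h => by rw [← h, Θ.P_P], fun h => by rw [h, Θ.P_P]⟩
    simp only [h1, Θ.P_inj, or_comm]
  f_out k hk := by
    have := Θ.P_mem hi
    exact if_neg (by omega)
  oneBoundary := Θ.oneBoundary
  E := swapOneTwo i (Θ.P i)
  E_E v := by
    obtain ⟨k, c⟩ := v
    unfold swapOneTwo
    split_ifs <;> simp_all
  E_ne v := by
    obtain ⟨k, c⟩ := v
    rw [Frame.mem_V]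
    unfold swapOneTwo
    dsimp only
    by_cases hk : k = i ∨ k = Θ.P i
    · rw [if_pos hk, if_pos hk, Ne, Prod.mk.injEq]
      split_ifs <;> omega
    · rw [if_neg hk, if_neg hk]
      refine iff_of_false (fun h => h rfl) ?_
      omega
  noncrossing u hu v hv := by
    have hP := Θ.P_mem hi
    have cases : ∀ w : ℕ × ℕ, (1 ≤ w.2 ∧ w.2 ≤ if w.1 = i ∨ w.1 = Θ.P i then 2 else 0) →
        (w.1 = i ∨ w.1 = Θ.P i) ∧ (w.2 = 1 ∨ w.2 = 2) := by
      intro w hw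
      split_ifs at hw <;> omega
    obtain ⟨hu1, hu2⟩ := cases u hu
    obtain ⟨hv1, hv2⟩ := cases v hv
    have mm : ∀ w : ℕ × ℕ, (w.1 = i ∨ w.1 = Θ.P i) → (w.2 = 1 ∨ w.2 = 2) →
        min (key Θ.N w) (key Θ.N (swapOneTwo i (Θ.P i) w)) = key Θ.N (w.1, 1) ∧
        max (key Θ.N w) (key Θ.N (swapOneTwo i (Θ.P i) w)) = key Θ.N (w.1, 2) := by
      rintro ⟨k, c⟩ h1 h2
      have hk : k ≤ 2 * Θ.N := by
        dsimp only at h1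
        omega
      have hlt : key Θ.N (k, 1) < key Θ.N (k, 2) := by
        rw [key_lt_iff]
        simp [hk]
      rw [swapOneTwo, if_pos h1]
      dsimp only at h2 ⊢
      rcases h2 with rfl | rfl
      · exact ⟨min_eq_left hlt.le, max_eq_right hlt.le⟩
      · exact ⟨min_eq_right hlt.le, max_eq_left hlt.le⟩
    unfold Crosses
    rw [(mm u hu1 hu2).1, (mm u hu1 hu2).2, (mm v hv1 hv2).1, (mm v hv1 hv2).2]
    have hul : u.1 ≤ 2 * Θ.N := by omega
    have hvl : v.1 ≤ 2 * Θ.N := by omega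
    simp only [key_lt_iff, if_pos hul, if_pos hvl]
    omega

variable (hi : 1 ≤ i ∧ i ≤ 2 * Θ.N)

theorem Datum.annulus_f (k : ℕ) : (Θ.annulus hi).f k = if k = i ∨ k = Θ.P i then 2 else 0 := rfl

theorem Datum.annulus_mem {v : ℕ × ℕ} :
    v ∈ (Θ.annulus hi).V ↔ (v.1 = i ∨ v.1 = Θ.P i) ∧ (v.2 = 1 ∨ v.2 = 2) := by
  rw [Frame.mem_V, annulus_f]
  split_ifs <;> omega

/-- The two regions inside the annulus. -/
def core (i j : ℕ) : Set (ℕ × ℕ) := {(i, 1), (j, 1)}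

theorem mem_core {i j : ℕ} {x : ℕ × ℕ} : x ∈ core i j ↔ (x.1 = i ∨ x.1 = j) ∧ x.2 = 1 := by
  simp only [core, Set.mem_insert_iff, Set.mem_singleton_iff, Prod.ext_iff]
  tauto

/-- Each chord joins the two consecutive points `(k, 1)` and `(k, 2)`, so the only region it cuts
off is the one between them, `(k, 1)` in region coordinates. -/
theorem Datum.annulus_squareAdj {x y : ℕ × ℕ} (hx : x ∈ (Θ.annulus hi).regions)
    (hy : y ∈ (Θ.annulus hi).regions) :
    (Θ.annulus hi).SquareAdj x y ↔
      x = y ∨ (x ∉ core i (Θ.P i) ∧ y ∉ core i (Θ.P i)) := by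
  have hP := Θ.P_mem hi
  have hxs : x.2 ≤ if x.1 = i ∨ x.1 = Θ.P i then 2 else 0 := hx.2
  have hys : y.2 ≤ if y.1 = i ∨ y.1 = Θ.P i then 2 else 0 := hy.2
  have main : ∀ v ∈ (Θ.annulus hi).V,
      (Crosses (key Θ.N (x.1, 2 * x.2 + 1)) (key Θ.N (y.1, 2 * y.2 + 1)) (key Θ.N (v.1, 2 * v.2))
        (key Θ.N (((Θ.annulus hi).E v).1, 2 * ((Θ.annulus hi).E v).2)) ↔
        ¬(x = (v.1, 1) ↔ y = (v.1, 1))) := by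
    rintro ⟨k, c⟩ hv
    rw [annulus_mem] at hv
    have hk : k ≤ 2 * Θ.N := by
      dsimp only at hv
      omega
    have hE : (Θ.annulus hi).E (k, c) = (k, 3 - c) := by
      change swapOneTwo i (Θ.P i) (k, c) = _
      rw [swapOneTwo, if_pos hv.1]
      dsimp only at hv ⊢
      rcases hv.2 with rfl | rfl <;> rfl
    have ne : ∀ (x : ℕ × ℕ) (d : ℕ), key Θ.N (x.1, 2 * x.2 + 1) ≠ key Θ.N (k, 2 * d) := by
      intro x d e
      have := congrArg Prod.snd (key_injective _ e)
      dsimp only at this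
      omega
    have val : ∀ x : ℕ × ℕ, (x.2 ≤ if x.1 = i ∨ x.1 = Θ.P i then 2 else 0) →
        chi (key Θ.N (k, 2 * c) < key Θ.N (x.1, 2 * x.2 + 1)) +
        chi (key Θ.N (k, 2 * (3 - c)) < key Θ.N (x.1, 2 * x.2 + 1)) = chi (x = (k, 1)) := by
      intro x hxs
      unfold chi
      simp only [key_lt_iff, Prod.ext_iff]
      have h2 : (1 + 1 : ZMod 2) = 0 := by decide
      obtain ⟨hk1, rfl | rfl⟩ := hv <;> split_ifs at * <;> first
        | rfl
        | exact h2
        | (exfalso; omega)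
    rw [hE, ← not_iff_not, not_crosses_iff (ne _ _) (ne _ _) (ne _ _) (ne _ _), val x hxs,
      val y hys, not_not]
    have h10 : ¬ (1 : ZMod 2) = 0 := by decide
    have h2 : (1 + 1 : ZMod 2) = 0 := by decide
    unfold chi
    dsimp only
    split_ifs with h1 h3 h3 <;> simp [h1, h3, h2]
  have hmem : ∀ k, (k = i ∨ k = Θ.P i) → (k, 1) ∈ (Θ.annulus hi).V := fun k hk =>
    (annulus_mem hi).2 ⟨hk, Or.inl rfl⟩
  constructor
  · rintro ⟨-, -, h⟩
    by_contra hne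
    push Not at hne
    by_cases hxc : x ∈ core i (Θ.P i)
    · have hxc' := mem_core.1 hxc
      have e : x = (x.1, 1) := Prod.ext rfl hxc'.2
      refine h _ (hmem x.1 hxc'.1) ((main _ (hmem x.1 hxc'.1)).2 fun hiff => ?_)
      exact hne.1 (e.trans (hiff.1 e).symm)
    · have hyc := hne.2 hxc
      have hyc' := mem_core.1 hyc
      have e : y = (y.1, 1) := Prod.ext rfl hyc'.2
      refine h _ (hmem y.1 hyc'.1) ((main _ (hmem y.1 hyc'.1)).2 fun hiff => ?_)
      exact hne.1 ((hiff.2 e).trans e.symm)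
  · intro h
    refine ⟨hx, hy, fun v hv hcr => ?_⟩
    have hv' := (annulus_mem hi).1 hv
    refine (main v hv).1 hcr ?_
    rcases h with rfl | ⟨h1, h2⟩
    · rfl
    · refine iff_of_false (fun e => h1 ?_) (fun e => h2 ?_)
      · rw [e, mem_core]
        exact ⟨hv'.1, rfl⟩
      · rw [e, mem_core]
        exact ⟨hv'.1, rfl⟩

/-- The two core regions are the ends of the middle strip of the band, whether or not it is twisted,
and no edge leaves them. All other regions are adjacent to the region at the lower end of the bottom
edge. -/
theorem Datum.annulus_numComponents :
    numComponents (Θ.annulus hi).complementGraph (Θ.annulus hi).regions = 2 := by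
  have hP := Θ.P_mem hi
  have hne := (Θ.P_ne i).2 hi
  set Ξ := Θ.annulus hi with hΞ
  have hcore : ∀ j, (j = i ∨ j = Θ.P i) → (j, 1) ∈ Ξ.regions := by
    intro j hj
    refine ⟨?_, ?_⟩
    · change j ≤ 2 * Θ.N + 1
      omega
    · change 1 ≤ if j = i ∨ j = Θ.P i then 2 else 0
      rw [if_pos hj]
      omega
  have h00 : (0, 0) ∈ Ξ.regions := ⟨Nat.zero_le _, Nat.zero_le _⟩
  have h00' : ((0, 0) : ℕ × ℕ) ∉ core i (Θ.P i) := by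
    rw [mem_core]
    simp
  have band : ∀ x y, Ξ.BandAdj x y → (x ∈ core i (Θ.P i) ↔ y ∈ core i (Θ.P i)) := by
    rintro ⟨k, c⟩ y ⟨h1, h2, rfl⟩
    have h3 : c ≤ if k = i ∨ k = Θ.P i then 2 else 0 := h1.2
    have e1 : Θ.P k = i ↔ k = Θ.P i := ⟨fun h => by rw [← h, Θ.P_P], fun h => by rw [h, Θ.P_P]⟩
    have e2 : Θ.P k = Θ.P i ↔ k = i := Θ.P_inj
    rw [mem_core, mem_core]
    change _ ↔ (Θ.P k = i ∨ Θ.P k = Θ.P i) ∧ (if Θ.s k = 0 then (if k = i ∨ k = Θ.P i then 2 else 0) - c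
      else c) = 1
    rw [e1, e2, or_comm (a := k = Θ.P i)]
    dsimp only
    refine and_congr_right fun hk => ?_
    rw [if_pos hk] at h3 ⊢
    split_ifs <;> omega
  have inv : ∀ x y, Ξ.complementGraph.Reachable x y →
      (x ∈ core i (Θ.P i) ↔ y ∈ core i (Θ.P i)) := by
    intro x y h
    refine Datum.complement_induction (Q := fun x y => x ∈ core i (Θ.P i) ↔ y ∈ core i (Θ.P i)) h
      (fun _ => Iff.rfl) (fun _ _ h => h.symm) (fun _ _ _ h h' => h.trans h') band
      (fun x y hxy => ?_)
    rcases (annulus_squareAdj hi hxy.1 hxy.2.1).1 hxy with rfl | ⟨h1, h2⟩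
    · rfl
    · exact iff_of_false h1 h2
  have hin : Ξ.complementGraph.Reachable (i, 1) (Θ.P i, 1) := by
    refine Datum.BandAdj.reachable ⟨hcore i (Or.inl rfl), hi, ?_⟩
    change _ = (Θ.P i, if Θ.s i = 0 then (if i = i ∨ i = Θ.P i then 2 else 0) - 1 else 1)
    rw [if_pos (Or.inl rfl)]
    split_ifs <;> rfl
  have himage : Ξ.complementGraph.connectedComponentMk '' Ξ.regions =
      {Ξ.complementGraph.connectedComponentMk (0, 0),
        Ξ.complementGraph.connectedComponentMk (i, 1)} := by
    ext C
    constructor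
    · rintro ⟨x, hx, rfl⟩
      by_cases hc : x ∈ core i (Θ.P i)
      · refine Or.inr (SimpleGraph.ConnectedComponent.eq.2 ?_)
        rcases hc with rfl | hc
        · exact SimpleGraph.Reachable.refl _
        · rw [Set.mem_singleton_iff] at hc
          rw [hc]
          exact hin.symm
      · exact Or.inl (SimpleGraph.ConnectedComponent.eq.2
          ((annulus_squareAdj hi hx h00).2 (Or.inr ⟨hc, h00'⟩)).reachable)
    · rintro (rfl | rfl)
      · exact ⟨_, h00, rfl⟩
      · exact ⟨_, hcore i (Or.inl rfl), rfl⟩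
  rw [numComponents, himage, Set.ncard_pair]
  intro e
  exact h00' ((inv _ _ (SimpleGraph.ConnectedComponent.eq.1 e)).2 (Or.inl rfl))

theorem mem_parallel {i j a b : ℕ} (v : ℕ × ℕ) :
    v ∈ ({(i, a), (i, a + 1), (j, b), (j, b + 1)} : Set (ℕ × ℕ)) ↔
      (v.1 = i ∧ (v.2 = a ∨ v.2 = a + 1)) ∨ (v.1 = j ∧ (v.2 = b ∨ v.2 = b + 1)) := by
  simp only [Set.mem_insert_iff, Set.mem_singleton_iff, Prod.ext_iff]
  tauto

theorem ncard_parallel {i j a b : ℕ} (hne : j ≠ i) (k : ℕ) :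
    {v | v ∈ ({(i, a), (i, a + 1), (j, b), (j, b + 1)} : Set (ℕ × ℕ)) ∧ v.1 = k}.ncard =
      if k = i ∨ k = j then 2 else 0 := by
  have pair : ∀ k c, (∀ v, (v ∈ ({(i, a), (i, a + 1), (j, b), (j, b + 1)} : Set (ℕ × ℕ)) ∧
      v.1 = k) ↔ v = (k, c) ∨ v = (k, c + 1)) →
      {v | v ∈ ({(i, a), (i, a + 1), (j, b), (j, b + 1)} : Set (ℕ × ℕ)) ∧ v.1 = k}.ncard = 2 := by
    intro k c h
    rw [(Set.ext h : {v | v ∈ ({(i, a), (i, a + 1), (j, b), (j, b + 1)} : Set (ℕ × ℕ)) ∧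
      v.1 = k} = {(k, c), (k, c + 1)}), Set.ncard_pair (by simp)]
  split_ifs with h
  · rcases h with rfl | rfl
    · refine pair k a fun v => ?_
      rw [mem_parallel, Prod.ext_iff, Prod.ext_iff]
      dsimp only
      omega
    · refine pair k b fun v => ?_
      rw [mem_parallel, Prod.ext_iff, Prod.ext_iff]
      dsimp only
      omega
  · rw [Set.ncard_eq_zero ((Set.toFinite _).subset fun v hv => hv.1),
      Set.eq_empty_iff_forall_notMem]
    rintro v ⟨hv, rfl⟩
    rw [mem_parallel] at hv
    omega

/-- A component with two arcs, joining the ends of two adjacent parallel arcs in a band, is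
separating. -/
theorem Datum.isSeparating_parallel (hi : 1 ≤ i ∧ i ≤ 2 * Θ.N) (ha : 1 ≤ a) (hb : 1 ≤ b)
    (hE : Θ.E (i, a) = (i, a + 1))
    (hE' : Θ.E (Θ.P i, b) = (Θ.P i, b + 1)) :
    Θ.IsSeparating {(i, a), (i, a + 1), (Θ.P i, b), (Θ.P i, b + 1)} := by
  have hP := Θ.P_mem hi
  have hne := (Θ.P_ne i).2 hi
  have hΓ := mem_parallel (i := i) (j := Θ.P i) (a := a) (b := b)
  have hcard := ncard_parallel (a := a) (b := b) hne
  generalize ({(i, a), (i, a + 1), (Θ.P i, b), (Θ.P i, b + 1)} : Set (ℕ × ℕ)) = Γ at hΓ hcard ⊢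
  refine ⟨Θ.annulus hi, ⟨rfl, fun k => ?_,
    -- The relabelling sends the lower height, `a` or `b` according to the site, to `1` and the
    -- other one to `2`.
    fun v => (v.1, if v.2 = (if v.1 = i then a else b) then 1 else 2),
    ⟨⟨?_, ?_, ?_⟩, ?_⟩, ?_⟩, annulus_numComponents hi⟩
  · rw [annulus_f, hcard]
  · intro v hv
    rw [hΓ] at hv
    rw [annulus_mem]
    dsimp only
    refine ⟨by omega, ?_⟩
    split_ifs <;> simp
  · intro u hu v hv e
    rw [hΓ] at hu hv
    rw [Prod.ext_iff] at e ⊢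
    dsimp only at e
    refine ⟨e.1, ?_⟩
    split_ifs at e <;> omega
  · rintro ⟨j, c⟩ hv
    rw [annulus_mem] at hv
    dsimp only at hv
    refine ⟨(j, (if j = i then a else b) + (c - 1)), ?_, ?_⟩
    · rw [hΓ]
      dsimp only
      split_ifs <;> omega
    · rw [Prod.mk.injEq]
      refine ⟨rfl, ?_⟩
      dsimp only
      split_ifs <;> omega
  · intro u hu v hv hlt
    rw [hΓ] at hu hv
    have h1 : u.1 ≤ 2 * Θ.N := by omega
    rw [key_lt_iff, if_pos h1] at hlt
    rw [key_lt_iff, if_pos h1]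
    dsimp only
    refine hlt.imp_right fun ⟨e, hlt⟩ => ⟨e, ?_⟩
    split_ifs <;> omega
  · have hsw : ∀ v, (Θ.annulus hi).E v = swapOneTwo i (Θ.P i) v := fun _ => rfl
    have hE2 := Datum.E_eq_comm.1 hE
    have hE2' := Datum.E_eq_comm.1 hE'
    rintro ⟨j, c⟩ hv
    rw [hΓ] at hv
    rw [hsw]
    rcases hv with ⟨rfl, rfl | rfl⟩ | ⟨h, rfl | rfl⟩
    · rw [hE]
      simp [swapOneTwo]
    · rw [hE2]
      simp [swapOneTwo]
    · dsimp only at h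
      rw [h, hE']
      simp [swapOneTwo, hne]
    · dsimp only at h
      rw [h, hE2']
      simp [swapOneTwo, hne]

end Parallel

end SWB

namespace SWB

/-! ### Merging a set in an equivalence relation -/

/-- The equivalence relation whose only possibly nontrivial class is `X`. -/
@[reducible] def mergeS {α : Type*} (X : Set α) : Setoid α where
  r u w := u = w ∨ (u ∈ X ∧ w ∈ X)
  iseqv := ⟨fun _ => Or.inl rfl, by
    rintro u w (rfl | ⟨h1, h2⟩)
    · exact Or.inl rfl
    · exact Or.inr ⟨h2, h1⟩, by
    rintro u v w (rfl | ⟨h1, h2⟩) (rfl | ⟨h3, h4⟩)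
    · exact Or.inl rfl
    · exact Or.inr ⟨h3, h4⟩
    · exact Or.inr ⟨h1, h2⟩
    · exact Or.inr ⟨h1, h4⟩⟩

/-- Since all of `X` is identified, a chain can be shortened between its first and last visit to
`X`. -/
theorem sup_merge_iff {α : Type*} {S : Setoid α} {X : Set α} {u w : α} :
    (S ⊔ mergeS X) u w ↔ S u w ∨ ((∃ x ∈ X, S u x) ∧ ∃ y ∈ X, S y w) := by
  constructor
  · intro h
    refine sup_rel_induction (P := fun w => S u w ∨ ((∃ x ∈ X, S u x) ∧ ∃ y ∈ X, S y w)) h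
      (Or.inl (S.refl' u)) ?_ ?_
    · rintro y z hyz (hy | ⟨hx, p, hp, hy⟩)
      · exact Or.inl (S.trans' hy hyz)
      · exact Or.inr ⟨hx, p, hp, S.trans' hy hyz⟩
    · rintro y z (rfl | ⟨h1, h2⟩) hy
      · exact hy
      · refine Or.inr ⟨?_, z, h2, S.refl' z⟩
        rcases hy with hy | hy
        · exact ⟨y, h1, hy⟩
        · exact hy.1
  · rintro (h | ⟨⟨x, hx, hux⟩, y, hy, hyw⟩)
    · exact sup_left h
    · exact Setoid.trans' _ (sup_left hux) (Setoid.trans' _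
        (sup_right (Or.inr ⟨hx, hy⟩ : mergeS X x y)) (sup_left hyw))

/-- The number of classes inside `X ∪ M` after merging the classes which meet `X`, if the class of
`X` is not contained in `X ∪ M`. -/
theorem loops_merge_of_not {α : Type*} {S : Setoid α} {X M : Set α} (hd : Disjoint X M)
    (h : ∃ x ∈ X, ∃ w, S x w ∧ w ∉ X ∪ M) :
    loops (S ⊔ mergeS X) (X ∪ M) = loops S M := by
  obtain ⟨x, hx, w, hxw, hw⟩ := h
  have same : ∀ v, (∀ p ∈ X, ¬ S v p) → {z | (S ⊔ mergeS X) v z} = {z | S v z} := by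
    intro v hv
    ext z
    refine sup_merge_iff.trans (or_iff_left ?_)
    rintro ⟨⟨p, hp, hvp⟩, -⟩
    exact hv p hp hvp
  unfold loops
  congr 1
  ext C
  constructor
  · rintro ⟨v, hv, rfl, hC⟩
    have hv' : ∀ p ∈ X, ¬ S v p := fun p hp hvp =>
      hw (hC (sup_merge_iff.2 (Or.inr ⟨⟨p, hp, hvp⟩, x, hx, hxw⟩)))
    have hC' := hC
    rw [same v hv'] at hC' ⊢
    have hM : {z | S v z} ⊆ M := fun z hz => (hC' hz).resolve_left fun hz' => hv' z hz' hz
    exact ⟨v, hM (S.refl' v), rfl, hM⟩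
  · rintro ⟨v, hv, rfl, hC⟩
    have hv' : ∀ p ∈ X, ¬ S v p := fun p hp hvp => Set.disjoint_left.1 hd hp (hC hvp)
    exact ⟨v, Or.inr hv, (same v hv').symm, hC.trans Set.subset_union_right⟩

/-- The number of classes inside `X ∪ M` after merging the classes which meet `X`, if the class of
`X` is contained in `X ∪ M`. -/
theorem loops_merge_of_subset {α : Type*} {S : Setoid α} {X M : Set α} (hd : Disjoint X M)
    (hM : M.Finite) (hne : X.Nonempty) (h : ∀ x ∈ X, ∀ w, S x w → w ∈ X ∪ M) :
    loops (S ⊔ mergeS X) (X ∪ M) = loops S M + 1 := by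
  obtain ⟨x, hx⟩ := hne
  have same : ∀ v, (∀ p ∈ X, ¬ S v p) → {z | (S ⊔ mergeS X) v z} = {z | S v z} := by
    intro v hv
    ext z
    refine sup_merge_iff.trans (or_iff_left ?_)
    rintro ⟨⟨p, hp, hvp⟩, -⟩
    exact hv p hp hvp
  have e : {C : Set α | ∃ v ∈ X ∪ M, C = {z | (S ⊔ mergeS X) v z} ∧ C ⊆ X ∪ M} =
      insert {z | (S ⊔ mergeS X) x z} {C : Set α | ∃ v ∈ M, C = {z | S v z} ∧ C ⊆ M} := by
    ext C
    constructor
    · rintro ⟨v, hv, rfl, hC⟩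
      by_cases hv' : ∀ p ∈ X, ¬ S v p
      · have hC' := hC
        rw [same v hv'] at hC' ⊢
        have hM : {z | S v z} ⊆ M := fun z hz => (hC' hz).resolve_left fun hz' => hv' z hz' hz
        exact Or.inr ⟨v, hM (S.refl' v), rfl, hM⟩
      · push Not at hv'
        exact Or.inl (class_eq (sup_merge_iff.2 (Or.inr ⟨hv', x, hx, S.refl' x⟩)))
    · rintro (rfl | ⟨v, hv, rfl, hC⟩)
      · refine ⟨x, Or.inl hx, rfl, fun z hz => ?_⟩
        rcases sup_merge_iff.1 hz with hz | ⟨-, y, hy, hz⟩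
        · exact h x hx z hz
        · exact h y hy z hz
      · have hv' : ∀ p ∈ X, ¬ S v p := fun p hp hvp => Set.disjoint_left.1 hd hp (hC hvp)
        exact ⟨v, Or.inr hv, (same v hv').symm, hC.trans Set.subset_union_right⟩
  unfold loops
  rw [e, Set.ncard_insert_of_notMem _ (finite_classes S hM)]
  rintro ⟨v, -, hv, hC⟩
  exact Set.disjoint_left.1 hd hx (hC (Setoid.refl' (S ⊔ mergeS X) x))

theorem loops_merge_self {α : Type*} {S : Setoid α} {X : Set α}
    (h : ∃ x ∈ X, ∃ w, S x w ∧ w ∉ X) : loops (S ⊔ mergeS X) X = 0 := by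
  have := loops_merge_of_not (S := S) (X := X) (M := ∅) (Set.disjoint_empty _)
    (by simpa using h)
  rwa [Set.union_empty, loops_empty] at this

/-! ### Pull-throughs of the lower square -/

section Pull

variable {Θ Θ' : Datum} {i a : ℕ} (hi : 1 ≤ i ∧ i ≤ 2 * Θ.N) (ha : (i, a) ∈ Θ.V)
  (hE : Θ.E (i, a) = (i, a + 1))

include ha hE in
theorem pull_mem : (i, a + 1) ∈ Θ.V := hE ▸ Datum.E_mem ha

include ha hE in
theorem pullSet_subset : Θ.pullSet i a ⊆ Θ.V := by
  have hb := pull_mem ha hE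
  rintro v (rfl | rfl | rfl | rfl)
  · exact ha
  · exact hb
  · exact Frame.iota_mem ha
  · exact Frame.iota_mem hb

theorem pullSet_site (F : Frame) {v : ℕ × ℕ} (hv : v ∈ F.pullSet i a) : v.1 = i ∨ v.1 = F.P i := by
  rcases hv with rfl | rfl | rfl | rfl
  · exact Or.inl rfl
  · exact Or.inl rfl
  · exact Or.inr rfl
  · exact Or.inr rfl

include ha hE in
/-- The pulled set in coordinates. -/
theorem pullSet_eq : ∃ b, 1 ≤ b ∧
    Θ.pullSet i a = {(i, a), (i, a + 1), (Θ.P i, b), (Θ.P i, b + 1)} ∧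
    (Θ.E (Θ.iota (i, a)) = Θ.iota (i, a + 1) → Θ.E (Θ.P i, b) = (Θ.P i, b + 1)) := by
  have hb := pull_mem ha hE
  have h1 := ha.1
  have h2 := hb.2
  dsimp only at h1 h2
  unfold Frame.pullSet Frame.iota
  dsimp only
  by_cases hs : Θ.s i = 0
  -- An untwisted band reverses heights, so the image pair starts at `f i - a`; a twisted band keeps
  -- them.
  · rw [if_pos hs, if_pos hs]
    have e1 : Θ.f i + 1 - a = Θ.f i - a + 1 := by omega
    have e2 : Θ.f i + 1 - (a + 1) = Θ.f i - a := by omega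
    refine ⟨Θ.f i - a, by omega, ?_, fun h => ?_⟩
    · rw [e1, e2]
      congr 2
      exact Set.pair_comm _ _
    · rw [e1, e2] at h
      exact Datum.E_eq_comm.1 h
  · rw [if_neg hs, if_neg hs]
    exact ⟨a, h1, rfl, fun h => h⟩

include hi ha hE in
theorem pull_partner_notMem (hne : Θ.E (Θ.iota (i, a)) ≠ Θ.iota (i, a + 1)) :
    Θ.E (Θ.iota (i, a)) ∉ Θ.pullSet i a ∧ Θ.E (Θ.iota (i, a + 1)) ∉ Θ.pullSet i a := by
  have hb := pull_mem ha hE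
  have hE' := Datum.E_eq_comm.1 hE
  have hs : ∀ c d, Θ.iota (i, c) ≠ (i, d) := fun c d e =>
    (Θ.P_ne i).2 hi (congrArg Prod.fst e)
  have hx := (Θ.E_ne _).2 (Frame.iota_mem ha)
  have hy := (Θ.E_ne _).2 (Frame.iota_mem hb)
  constructor
  · rintro (e | e | e | e)
    · rw [Datum.E_eq_comm, hE] at e
      exact hs _ _ e.symm
    · rw [Datum.E_eq_comm, hE'] at e
      exact hs _ _ e.symm
    · exact hx e
    · exact hne e
  · rintro (e | e | e | e)
    · rw [Datum.E_eq_comm, hE] at e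
      exact hs _ _ e.symm
    · rw [Datum.E_eq_comm, hE'] at e
      exact hs _ _ e.symm
    · exact hne (Datum.E_eq_comm.1 e)
    · exact hy e

include hi ha hE in
/-- The arcs of a pull-through are obtained by merging the vertices removed. -/
theorem pull_arcs_iff (hne : Θ.E (Θ.iota (i, a)) ≠ Θ.iota (i, a + 1)) {o : ℕ × ℕ → ℕ × ℕ}
    (ho : Set.InjOn o (Θ.V \ Θ.pullSet i a)) :
    ((∀ v ∈ Θ.V \ Θ.pullSet i a, Θ.E v ∉ Θ.pullSet i a → Θ'.E (o v) = o (Θ.E v)) ∧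
      Θ'.E (o (Θ.E (Θ.iota (i, a)))) = o (Θ.E (Θ.iota (i, a + 1)))) ↔
    ∀ u ∈ Θ.V \ Θ.pullSet i a, ∀ w ∈ Θ.V \ Θ.pullSet i a,
      (arcS Θ' (o u) (o w) ↔ (arcS Θ ⊔ mergeS (Θ.pullSet i a)) u w) := by
  have hb := pull_mem ha hE
  have hE' := Datum.E_eq_comm.1 hE
  obtain ⟨hx, hy⟩ := pull_partner_notMem hi ha hE hne
  have mx : Θ.E (Θ.iota (i, a)) ∈ Θ.V \ Θ.pullSet i a := ⟨Datum.E_mem (Frame.iota_mem ha), hx⟩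
  have my : Θ.E (Θ.iota (i, a + 1)) ∈ Θ.V \ Θ.pullSet i a :=
    ⟨Datum.E_mem (Frame.iota_mem hb), hy⟩
  have px : Θ.iota (i, a) ∈ Θ.pullSet i a := Or.inr (Or.inr (Or.inl rfl))
  have py : Θ.iota (i, a + 1) ∈ Θ.pullSet i a := Or.inr (Or.inr (Or.inr rfl))
  have ends : ∀ u ∈ Θ.V \ Θ.pullSet i a, Θ.E u ∈ Θ.pullSet i a →
      u = Θ.E (Θ.iota (i, a)) ∨ u = Θ.E (Θ.iota (i, a + 1)) := by
    rintro u hu (e | e | e | e)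
    · rw [Datum.E_eq_comm, hE] at e
      exact absurd (e ▸ Or.inr (Or.inl rfl)) hu.2
    · rw [Datum.E_eq_comm, hE'] at e
      exact absurd (e ▸ Or.inl rfl) hu.2
    · exact Or.inl (Datum.E_eq_comm.1 e).symm
    · exact Or.inr (Datum.E_eq_comm.1 e).symm
  have meets : ∀ u ∈ Θ.V \ Θ.pullSet i a, (∃ p ∈ Θ.pullSet i a, arcS Θ u p) ↔
      Θ.E u ∈ Θ.pullSet i a := by
    intro u hu
    constructor
    · rintro ⟨p, hp, rfl | rfl⟩
      · exact absurd hp hu.2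
      · exact hp
    · exact fun h => ⟨_, h, Or.inr rfl⟩
  constructor
  · rintro ⟨h1, h2⟩ u hu w hw
    have meets' : (∃ p ∈ Θ.pullSet i a, arcS Θ p w) ↔ Θ.E w ∈ Θ.pullSet i a := by
      rw [← meets w hw]
      exact exists_congr fun p => and_congr_right fun _ => Setoid.comm' _
    rw [sup_merge_iff, meets u hu, meets']
    by_cases hu' : Θ.E u ∈ Θ.pullSet i a
    · by_cases hw' : Θ.E w ∈ Θ.pullSet i a
      · refine iff_of_true ?_ (Or.inr ⟨hu', hw'⟩)
        rcases ends u hu hu' with rfl | rfl <;> rcases ends w hw hw' with rfl | rfl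
        · exact Or.inl rfl
        · exact Or.inr h2
        · exact Or.inr (Datum.E_eq_comm.1 h2)
        · exact Or.inl rfl
      · simp only [hw', and_false, or_false]
        rw [Setoid.comm', Setoid.comm' (arcS Θ), arcS_iff, arcS_iff, h1 w hw hw',
          ho.eq_iff hw hu, ho.eq_iff ⟨Datum.E_mem hw.1, hw'⟩ hu]
    · simp only [hu', false_and, or_false]
      rw [arcS_iff, arcS_iff, h1 u hu hu', ho.eq_iff hu hw, ho.eq_iff ⟨Datum.E_mem hu.1, hu'⟩ hw]
  · intro h
    refine ⟨fun v hv hv' => ?_, ?_⟩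
    · have hm : Θ.E v ∈ Θ.V \ Θ.pullSet i a := ⟨Datum.E_mem hv.1, hv'⟩
      refine ((h v hv _ hm).2 (sup_left (Or.inr rfl))).resolve_left fun e => ?_
      exact (Θ.E_ne v).2 hv.1 (ho hv hm e).symm
    · refine ((h _ mx _ my).2 (sup_merge_iff.2 (Or.inr ⟨(meets _ mx).2 ?_, _, py, Or.inr rfl⟩))).resolve_left
        fun e => ?_
      · rwa [Θ.E_E]
      · have h3 := congrArg Prod.snd (Frame.iota_iota ha)
        have e' := Datum.E_inj.1 (ho mx my e)
        rw [e', Frame.iota_iota hb] at h3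
        dsimp only at h3
        omega

-- When the image of the turn-back is also an arc, the two arcs and two band edges close up to a
-- four-cycle.
include hi ha hE in
theorem isInternalComponent_pullSet (h : Θ.E (Θ.iota (i, a)) = Θ.iota (i, a + 1)) :
    Θ.IsInternalComponent (Θ.pullSet i a) := by
  have hb := pull_mem ha hE
  have h' := Datum.E_eq_comm.1 h
  have hE' := Datum.E_eq_comm.1 hE
  have hP := Θ.P_mem hi
  refine ⟨⟨(i, a), ha, ?_⟩, fun v hv => ?_⟩
  · ext w
    constructor
    · have r1 : Θ.curveGraph.Reachable (i, a) (i, a + 1) := hE ▸ curve_reachable_E Θ (i, a)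
      rintro (rfl | rfl | rfl | rfl)
      · exact SimpleGraph.Reachable.refl _
      · exact r1
      · exact curve_reachable_iota ha hi
      · exact r1.trans (curve_reachable_iota hb hi)
    · intro hw
      refine curve_induction (P := fun w => w ∈ Θ.pullSet i a) hw (Or.inl rfl) ?_ ?_
      · rintro u (rfl | rfl | rfl | rfl)
        · rw [hE]
          exact Or.inr (Or.inl rfl)
        · rw [hE']
          exact Or.inl rfl
        · rw [h]
          exact Or.inr (Or.inr (Or.inr rfl))
        · rw [h']
          exact Or.inr (Or.inr (Or.inl rfl))
      · rintro u (rfl | rfl | rfl | rfl) -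
        · exact Or.inr (Or.inr (Or.inl rfl))
        · exact Or.inr (Or.inr (Or.inr rfl))
        · rw [Frame.iota_iota ha]
          exact Or.inl rfl
        · rw [Frame.iota_iota hb]
          exact Or.inr (Or.inl rfl)
  · have := pullSet_site _ hv
    refine ⟨?_, ?_⟩ <;> rcases this with e | e <;> rw [e] <;> omega

end Pull

section Juxtaposition

variable {A A' B J J' : Datum}

/-- Only the condition that the image of the turn-back is not an arc can fail after gluing, since
its ends may be joined through the upper square. If it holds, the move persists. If it fails, the
turn-back and its image bound an annulus; the move deletes this curve, and what remains of it is a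
closed curve consisting of glued vertices. -/
theorem IsPullThrough.juxt {i a : ℕ} (hc : Composable A B) (hc' : Composable A' B)
    (hJ : IsJuxtaposition A B J) (hJ' : IsJuxtaposition A' B J') (h : IsPullThrough A i a A') :
    (IsPullThrough J i a J' ∧ linking A' B = linking A B) ∨
    (J.IsInternalComponent (J.pullSet i a) ∧ J.IsSeparating (J.pullSet i a) ∧
      IsDeletion J (J.pullSet i a) J' ∧ linking A' B = linking A B + 1) := by
  obtain ⟨hi, ha, hE, hne, hch, hf, o, ho, hoE⟩ := h
  have hN : A'.N = A.N := congrArg ChordDatum.N hch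
  have hb := pull_mem ha hE
  have hPi := A.P_mem hi
  have htopf : A'.f (2 * A.N + 1) = A.f (2 * A.N + 1) := by
    rw [Composable, hN] at hc'
    exact hc'.trans hc.symm
  rw [pull_arcs_iff hi ha hE hne ho.1.injOn] at hoE
  have hJN := hJ.1
  have hJN' := hJ'.1
  have hJf := hJ.2.2.2.1
  have hJf' := hJ'.2.2.2.1
  have hJA := juxt_arcS hc hJ
  have hiJ : 1 ≤ i ∧ i ≤ 2 * J.N := ⟨hi.1, by omega⟩
  have haJ : (i, a) ∈ J.V := (juxt_low_mem hJf hi.2).2 ha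
  have hEJ : J.E (i, a) = (i, a + 1) := by
    rw [juxt_E_low hc hJ hi.2 (by rw [hE]; exact hi.2), hE]
  have ePi : J.P i = A.P i := by rw [hJ.2.1, if_pos hi.2]
  have epull : A.pullSet i a = J.pullSet i a := by
    unfold Frame.pullSet
    rw [juxt_iota_low hJ hi.2, juxt_iota_low hJ hi.2]
  have hmx : A.E (A.iota (i, a)) ∉ J.pullSet i a :=
    epull ▸ (pull_partner_notMem hi ha hE hne).1
  have px : A.iota (i, a) ∈ J.pullSet i a := epull ▸ Or.inr (Or.inr (Or.inl rfl))
  have hVp : J.pullSet i a ⊆ A.V := epull ▸ pullSet_subset ha hE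
  rw [epull] at ho hoE
  have hpl : ∀ v ∈ J.pullSet i a, v.1 ≤ 2 * A.N := by
    intro v hv
    rw [← epull] at hv
    rcases pullSet_site _ hv with e | e <;> omega
  set X := J.pullSet i a with hX
  set W := A.V \ X with hW
  have hsuppQ : supp (arcS A ⊔ mergeS X) ⊆ A.V := by
    refine (supp_sup_subset _ _).trans (Set.union_subset (supp_arcS A).le ?_)
    rintro v ⟨w, rfl | ⟨h, -⟩, hne⟩
    · exact absurd rfl hne
    · exact hVp h
  have tr : Transport (2 * A.N) W o (arcS A ⊔ mergeS X) (arcS A') := by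
    refine ho.transport hN htopf (fun v hv => hv.1) subset_rfl (fun v hv e => ⟨hv, fun h => ?_⟩)
      (fun v hv e => hv) hsuppQ hoE
    have := hpl v h
    omega
  -- Merging the removed vertices commutes with stacking, so both alternatives are governed by one
  -- relation on the old stack.
  have eS : arcS A ⊔ mergeS X ⊔ shS (2 * A.N + 1) (arcS B) = stackS A B ⊔ mergeS X :=
    sup_right_comm _ _ _
  have hlowV : ∀ v ∈ J.V \ X, v ∈ lowSet (2 * A.N) W := fun v hv hn =>
    ⟨(juxt_low_mem hJf hn).1 hv.1, hv.2⟩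
  have arcs : ∀ u ∈ J.V \ X, ∀ w ∈ J.V \ X,
      (arcS J' (lowExt (2 * A.N) o u) (lowExt (2 * A.N) o w) ↔ (arcS J ⊔ mergeS X) u w) := by
    intro u hu w hw
    rw [tr.arcS_juxt hN (juxt_arcS hc' hJ') (hlowV u hu) (hlowV w hw), eS, sup_merge_iff,
      sup_merge_iff, hJA]
    simp only [Setoid.comap_rel]
    refine or_congr_right (and_congr ?_ ?_) <;>
    · refine exists_congr fun p => and_congr_right fun hp => ?_
      rw [re_low (hpl p hp)]
  have hop : IsOP J.N (J.V \ X) J'.V (lowExt (2 * A.N) o) := by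
    refine ho.lowExt (by omega) (fun v hv hlt => tr.top v hv ?_) tr.low
      (fun v hv => ?_) (fun v hv => juxt_low_mem hJf' (by omega)) (fun v hv => ?_)
    · have := Frame.site_le hv.1
      omega
    · rw [Set.mem_sdiff, Set.mem_sdiff, juxt_low_mem hJf hv]
    · rw [Set.mem_sdiff, ← juxt_high_mem hN hJf hJf' hv, and_iff_left]
      intro h
      have := hpl v h
      omega
  have hchJ : J'.toChordDatum = J.toChordDatum := by
    refine ChordDatum.ext' (by rw [hJN, hJN', hN]) (fun i => ?_) (fun i => ?_)
    · rw [hJ.2.1, hJ'.2.1, hN, hch]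
    · rw [hJ.2.2.1, hJ'.2.2.1, hN, hch]
  have hfJ : ∀ j, J'.f j = if j = i ∨ j = J.P i then J.f j - 2 else J.f j := by
    intro j
    rw [ePi, hJf, hJf', hN]
    by_cases hj : j ≤ 2 * A.N
    · rw [if_pos hj, if_pos hj, hf]
    · rw [if_neg hj, if_neg hj, if_neg (by omega)]
  -- Inside the lower square the merged class contains the partner of an image vertex, which is not
  -- removed. Hence no class is contained in `X` alone, and the first term of `linking_of_transport`
  -- is zero.
  have hlink : linking A' B = loops (stackS A B ⊔ mergeS X) (X ∪ stackMid A B) := by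
    have := linking_of_transport (B := B) (X := X) tr hN htopf (A.V_finite.subset hVp)
      (fun v hv => ⟨hpl v hv, fun h => h.2 hv⟩) (fun v w hv hw => ?_) (fun v hv w hw => ?_)
    · rw [eS, loops_merge_self, zero_add] at this
      · exact this
      · exact ⟨_, px, _, sup_left (Or.inr rfl), hmx⟩
    · have e : W ∪ X = A.V := Set.sdiff_union_of_subset hVp
      rw [e] at hv ⊢
      by_cases e : v = w
      · exact e ▸ hv
      · exact hsuppQ (mem_supp_right hw e)
    · rcases hw with rfl | rfl
      · exact ⟨v, hv, rfl⟩
      · exact ho.1.surjOn (Datum.E_mem (ho.1.mapsTo hv))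
  have hdisj : Disjoint X (stackMid A B) := by
    rw [Set.disjoint_left]
    intro v hv hm
    have h1 := hpl v hv
    have h2 := hm.2
    omega
  have exx : J.iota (i, a) = A.iota (i, a) := juxt_iota_low hJ hi.2
  by_cases hloop : J.E (J.iota (i, a)) = J.iota (i, a + 1)
  · right
    have hΓ := isInternalComponent_pullSet hiJ haJ hEJ hloop
    refine ⟨hΓ, ?_, ⟨hchJ, fun k => ?_, lowExt (2 * A.N) o, hop, fun u hu => ?_⟩, ?_⟩
    · obtain ⟨b, hb1, hb2, hb3⟩ := pullSet_eq haJ hEJ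
      rw [hX, hb2]
      exact Datum.isSeparating_parallel hiJ haJ.1 hb1 hEJ (hb3 hloop)
    · obtain ⟨b, -, hb2, -⟩ := pullSet_eq haJ hEJ
      have := ncard_parallel (a := a) (b := b) ((J.P_ne i).2 hiJ) k
      rw [← hb2] at this
      have e : {v | v ∈ J.V \ X ∧ v.1 = k} =
          {v | v ∈ J.V ∧ v.1 = k} \ {v | v ∈ X ∧ v.1 = k} := by
        ext v
        simp only [Set.mem_ofPred_eq, Set.mem_sdiff]
        tauto
      have hsub : {v | v ∈ X ∧ v.1 = k} ⊆ {v | v ∈ J.V ∧ v.1 = k} := fun v hv =>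
        ⟨hΓ.1.subset hv.1, hv.2⟩
      have hfin : {v | v ∈ X ∧ v.1 = k}.Finite :=
        (J.V_finite.subset hΓ.1.subset).subset fun v hv => hv.1
      rw [hfJ, e, Set.ncard_sdiff hsub hfin, ncard_site, this]
      split_ifs <;> rfl
    · have hm : J.E u ∈ J.V \ X :=
        ⟨Datum.E_mem hu.1, fun h => hu.2 (hΓ.1.E_mem_iff.1 h)⟩
      refine E_of_arcS (fun e => (J.E_ne u).2 hu.1 ?_)
        ((arcs u hu _ hm).2 (sup_left (Or.inr rfl)))
      exact (hop.1.injOn hu hm e).symm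
    -- The removed vertices form a component of the juxtaposition, so in the stack their classes
    -- contain besides them only glued vertices. Merging them yields one extra closed class.
    · rw [hlink, loops_merge_of_subset hdisj (stackMid_finite _ _) ⟨_, px⟩, linking_eq]
      intro x hx w hxw
      by_cases hw : w.1 = 2 * A.N + 1
      · refine Or.inr ⟨supp_stackS A B (mem_supp_right hxw ?_), hw⟩
        rintro rfl
        have := hpl x hx
        omega
      · obtain ⟨w', rfl⟩ := mem_range_re.2 hw
        have h1 : arcS J x w' := by
          rw [hJA, Setoid.comap_rel, re_low (hpl x hx)]
          exact hxw
        have h2 : w' ∈ X := by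
          rcases h1 with rfl | rfl
          · exact hx
          · exact hΓ.1.E_mem hx
        rw [re_low (hpl _ h2)]
        exact Or.inl h2
  · left
    refine ⟨⟨hiJ, haJ, hEJ, hloop, hchJ, hfJ, lowExt (2 * A.N) o, hop,
      (pull_arcs_iff hiJ haJ hEJ hloop hop.1.injOn).2 arcs⟩, ?_⟩
    rw [hlink, loops_merge_of_not hdisj, linking_eq]
    -- The other end of the path from an image vertex is neither removed nor glued, so the merged
    -- class is not closed.
    have hm := (pull_partner_notMem hiJ haJ hEJ hloop).1
    refine ⟨_, px, re (2 * A.N + 1) (J.E (J.iota (i, a))), ?_, ?_⟩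
    · have h1 : arcS J (J.iota (i, a)) (J.E (J.iota (i, a))) := Or.inr rfl
      rw [hJA, Setoid.comap_rel, exx, re_low (hpl _ px), ← exx] at h1
      rwa [← exx]
    · rintro (h | h)
      · have hlow := hpl _ h
        refine hm ?_
        have e : (J.E (J.iota (i, a))).1 ≤ 2 * A.N := by
          by_contra hgt
          rw [re, if_neg (by omega)] at hlow
          dsimp only at hlow
          omega
        rwa [re_low e] at h
      · exact re_fst_ne _ _ h.2

end Juxtaposition

end SWB

namespace SWB

/-! ### Associativity -/

/-- The cosimplicial identity for coface maps: two sites may be skipped in either order after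
renumbering. -/
theorem re_re {c d : ℕ} (h : c ≤ d) (v : ℕ × ℕ) : re c (re d v) = re (d + 1) (re c v) := by
  unfold re
  split_ifs <;> first | rfl | (exfalso; (try dsimp only at *); omega)

theorem comap_re_shS {c k : ℕ} (h : c ≤ k) (R : Setoid (ℕ × ℕ)) :
    Setoid.comap (re c) (shS (k + 1) R) = shS k R := by
  ext u w
  rw [Setoid.comap_rel, shS_iff, shS_iff, (re_injective c).eq_iff]
  have e : ∀ v : ℕ × ℕ, k ≤ v.1 → re c v = (v.1 + 1, v.2) := fun v hv => by
    rw [re, if_neg (by omega)]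
  have e' : ∀ v : ℕ × ℕ, k + 1 ≤ (re c v).1 ↔ k ≤ v.1 := fun v => by
    unfold re
    split_ifs <;> (try dsimp only) <;> omega
  rw [e', e']
  refine or_congr_right (and_congr_right fun hu => and_congr_right fun hw => ?_)
  rw [e u hu, e w hw, Nat.add_sub_add_right, Nat.add_sub_add_right]

theorem shS_comap_re (c d : ℕ) (R : Setoid (ℕ × ℕ)) :
    shS c (Setoid.comap (re d) R) = Setoid.comap (re (c + d)) (shS c R) := by
  ext u w
  rw [Setoid.comap_rel, shS_iff, shS_iff, (re_injective _).eq_iff]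
  have e' : ∀ v : ℕ × ℕ, c ≤ (re (c + d) v).1 ↔ c ≤ v.1 := fun v => by
    unfold re
    split_ifs <;> (try dsimp only) <;> omega
  have e : ∀ v : ℕ × ℕ, c ≤ v.1 → re d (v.1 - c, v.2) = ((re (c + d) v).1 - c, (re (c + d) v).2) :=
    fun v hv => by
      unfold re
      dsimp only
      by_cases h : v.1 < c + d
      · rw [if_pos h, if_pos (by omega)]
      · rw [if_neg h, if_neg (by omega)]
        exact Prod.ext (by dsimp only; omega) rfl
  rw [e', e']
  refine or_congr_right (and_congr_right fun hu => and_congr_right fun hw => ?_)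
  rw [Setoid.comap_rel, e u hu, e w hw]

theorem shS_shS (c d : ℕ) (R : Setoid (ℕ × ℕ)) : shS c (shS d R) = shS (c + d) R := by
  ext u w
  rw [shS_iff, shS_iff, shS_iff]
  dsimp only
  rw [Nat.sub_sub, Nat.sub_sub]
  constructor
  · rintro (h | ⟨h1, h2, h | ⟨h3, h4, h⟩⟩)
    · exact Or.inl h
    · exact Or.inl ((unshift_eq h1 h2).1 h)
    · exact Or.inr ⟨by omega, by omega, h⟩
  · rintro (h | ⟨h1, h2, h⟩)
    · exact Or.inl h
    · exact Or.inr ⟨by omega, by omega, Or.inr ⟨by omega, by omega, h⟩⟩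

theorem comap_re_of_supp {c : ℕ} {R : Setoid (ℕ × ℕ)} (h : ∀ v ∈ supp R, v.1 < c) :
    Setoid.comap (re c) R = R := by
  ext u w
  rw [Setoid.comap_rel]
  by_cases e : u = w
  · rw [e]
    exact iff_of_true (Setoid.refl' _ _) (Setoid.refl' _ _)
  have e2 : ∀ v : ℕ × ℕ, re c v ∈ supp R → re c v = v := fun v hv => by
    have := h _ hv
    unfold re at this ⊢
    split_ifs at this ⊢
    · rfl
    · dsimp only at this
      omega
  constructor
  · intro hr
    have hne := (re_injective c).ne e
    have h1 := e2 u (mem_supp_left hr hne)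
    have h2 := e2 w (mem_supp_right hr hne)
    rwa [h1, h2] at hr
  · intro hr
    have h1 := h _ (mem_supp_left hr e)
    have h2 := h _ (mem_supp_right hr e)
    rwa [re, if_pos h1, re, if_pos h2]

theorem mem_mid {A B : Datum} (hc : Composable A B) {v : ℕ × ℕ} :
    v ∈ stackMid A B ↔ v.1 = 2 * A.N + 1 ∧ 1 ≤ v.2 ∧ v.2 ≤ A.f (2 * A.N + 1) := by
  constructor
  · rintro ⟨h, h1⟩
    refine ⟨h1, ?_⟩
    rw [mem_stackV, Frame.mem_V, Frame.mem_V, h1, Nat.sub_self, ← hc] at h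
    tauto
  · rintro ⟨h1, h2⟩
    refine ⟨Or.inl ?_, h1⟩
    rwa [Frame.mem_V, h1]

section Assoc

variable {A B C AB BC J : Datum}

/-- The relation generated by the arcs of three stacked squares. -/
def tripleS (A B C : Datum) : Setoid (ℕ × ℕ) :=
  stackS A B ⊔ shS (2 * A.N + 2 * B.N + 2) (arcS C)

theorem tripleS_eq (A B C : Datum) :
    tripleS A B C = arcS A ⊔ shS (2 * A.N + 1) (stackS B C) := by
  rw [tripleS, stackS, stackS, shS_sup, shS_shS, sup_assoc,
    show 2 * A.N + 1 + (2 * B.N + 1) = 2 * A.N + 2 * B.N + 2 by omega]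

/-- The lower glued site is skipped first; the pullback distributes because the third square lies
entirely above it. -/
theorem stackS_left (hAB : Composable A B) (h : IsJuxtaposition A B AB) :
    stackS AB C = Setoid.comap (re (2 * A.N + 1)) (tripleS A B C) := by
  have hN := h.1
  rw [tripleS, comap_sup, ← juxt_arcS hAB h, stackS, hN]
  · congr 1
    rw [comap_re_shS (by omega)]
    congr 1
    omega
  · rintro v ⟨-, hv⟩
    rw [mem_supp_shS] at hv
    rw [mem_range_re]
    omega

/-- Here the upper glued site is skipped, and the lowest square lies entirely below it. -/
theorem stackS_right (hBC : Composable B C) (h : IsJuxtaposition B C BC) :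
    stackS A BC = Setoid.comap (re (2 * A.N + 2 * B.N + 2)) (tripleS A B C) := by
  have hA : ∀ v ∈ supp (arcS A), v.1 ≤ 2 * A.N + 1 := fun v hv => by
    rw [supp_arcS] at hv
    exact Frame.site_le hv
  rw [tripleS_eq, comap_sup, stackS, juxt_arcS hBC h, shS_comap_re,
    comap_re_of_supp (R := arcS A) fun v hv => by have := hA v hv; omega,
    show 2 * A.N + 1 + (2 * B.N + 1) = 2 * A.N + 2 * B.N + 2 by omega]
  · rintro v ⟨hv, -⟩
    have := hA v hv
    rw [mem_range_re]
    omega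

theorem Composable.juxt_left (hBC : Composable B C) (h : IsJuxtaposition A B AB) :
    Composable AB C := by
  rw [Composable, ← hBC, h.2.2.2.1, h.1, if_neg (by omega)]
  congr 1
  omega

theorem Composable.juxt_right (hAB : Composable A B) (h : IsJuxtaposition B C BC) :
    Composable A BC := by
  rw [Composable, hAB, h.2.2.2.1, if_pos (by omega)]

/-- Both bracketings pull the relation of the triple stack back along the map skipping both glued
sites, and the two factorizations of that map agree by `re_re`. -/
theorem IsJuxtaposition.assoc (hAB : Composable A B) (hBC : Composable B C)
    (h₁ : IsJuxtaposition A B AB) (h₂ : IsJuxtaposition B C BC) (h : IsJuxtaposition AB C J) :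
    IsJuxtaposition A BC J := by
  have e1 := stackS_left (C := C) hAB h₁
  have e2 := stackS_right (A := A) hBC h₂
  rw [isJuxtaposition_iff (hBC.juxt_left h₁)] at h
  rw [isJuxtaposition_iff (hAB.juxt_right h₂)]
  obtain ⟨hN, hP, hs, hf, hE⟩ := h
  obtain ⟨hN₁, hP₁, hs₁, hf₁, -⟩ := h₁
  obtain ⟨hN₂, hP₂, hs₂, hf₂, -⟩ := h₂
  refine ⟨by omega, fun i => ?_, fun i => ?_, fun i => ?_, ?_⟩
  · rw [hP, hP₁, hP₂, hN₁, show i - 2 * A.N - 2 * B.N = i - 2 * (A.N + B.N) by omega]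
    split_ifs <;> omega
  · rw [hs, hs₁, hs₂, hN₁, show i - 2 * A.N - 2 * B.N = i - 2 * (A.N + B.N) by omega]
    split_ifs <;> first | rfl | (exfalso; omega)
  · rw [hf, hf₁, hf₂, hN₁, show i - 2 * A.N - 2 * B.N = i - 2 * (A.N + B.N) by omega]
    split_ifs <;> omega
  · rw [hE, e1, e2, hN₁]
    ext u w
    change tripleS A B C (re (2 * A.N + 1) (re (2 * (A.N + B.N) + 1) u))
        (re (2 * A.N + 1) (re (2 * (A.N + B.N) + 1) w)) ↔
      tripleS A B C (re (2 * A.N + 2 * B.N + 2) (re (2 * A.N + 1) u))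
        (re (2 * A.N + 2 * B.N + 2) (re (2 * A.N + 1) w))
    rw [re_re (c := 2 * A.N + 1) (d := 2 * (A.N + B.N) + 1) (by omega),
      re_re (c := 2 * A.N + 1) (d := 2 * (A.N + B.N) + 1) (by omega),
      show 2 * (A.N + B.N) + 1 + 1 = 2 * A.N + 2 * B.N + 2 by omega]

/-- Either side counts the classes of the triple stack contained in the union of the two glued
sites: the first gluing accounts for those inside one site, and the second for those meeting the
other. -/
theorem linking_assoc (hAB : Composable A B) (hBC : Composable B C)
    (h₁ : IsJuxtaposition A B AB) (h₂ : IsJuxtaposition B C BC) :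
    linking A B + linking AB C = linking B C + linking A BC := by
  have hcl := hBC.juxt_left h₁
  have hcr := hAB.juxt_right h₂
  have hN₁ := h₁.1
  have hf₁ := h₁.2.2.2.1
  have ht : ∀ v ∈ supp (tripleS A B C), v ∈ stackV A B ∨
      (2 * A.N + 2 * B.N + 2 ≤ v.1 ∧ (v.1 - (2 * A.N + 2 * B.N + 2), v.2) ∈ C.V) := by
    intro v hv
    refine (supp_sup_subset _ _ hv).imp (fun h => supp_stackS A B h) fun h => ?_
    rwa [mem_supp_shS, supp_arcS] at h
  set c := 2 * A.N + 2 * B.N + 2 with hcdef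
  have left : linking A B + linking AB C =
      loops (tripleS A B C) (stackMid A B ∪ re (2 * A.N + 1) '' stackMid AB C) := by
    have e0 : loops (tripleS A B C) (stackMid A B) = loops (stackS A B) (stackMid A B) := by
      refine loops_sup _ _ _ (Set.disjoint_left.2 fun v hv hm => ?_)
      rw [mem_supp_shS] at hv
      have := hm.2
      omega
    rw [linking_eq, linking_eq, stackS_left hAB h₁, ← loops_add _ (re_injective _) _ _ _
      (stackMid_finite _ _) (stackMid_finite _ _), e0]
    · rw [Set.disjoint_left]
      rintro v hv hr
      exact mem_range_re.1 hr hv.2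
    · intro v hv w hw
      by_cases hw1 : w.1 = 2 * A.N + 1
      · refine Or.inl ⟨(ht w (mem_supp_right hw ?_)).resolve_right (by omega), hw1⟩
        rintro rfl
        exact re_fst_ne _ _ hw1
      · exact Or.inr (mem_range_re.2 hw1)
  have right : linking B C + linking A BC =
      loops (tripleS A B C) (shift (2 * A.N + 1) '' stackMid B C ∪ re c '' stackMid A BC) := by
    have e : stackS B C = Setoid.comap (shift (2 * A.N + 1)) (shS (2 * A.N + 1) (stackS B C)) := by
      ext u w
      change stackS B C u w ↔ shS (2 * A.N + 1) (stackS B C) (shift (2 * A.N + 1) u)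
        (shift (2 * A.N + 1) w)
      rw [shS_iff (c := 2 * A.N + 1), (shift (2 * A.N + 1)).injective.eq_iff]
      simp only [shift_fst, shift_snd, Nat.le_add_left, true_and, Nat.add_sub_cancel]
      constructor
      · exact Or.inr
      · rintro (rfl | h)
        · exact Setoid.refl' _ _
        · exact h
    have e2 : linking B C = loops (tripleS A B C) (shift (2 * A.N + 1) '' stackMid B C) := by
      rw [linking_eq, e, loops_comap _ (shift (2 * A.N + 1)).injective _ _ (stackMid_finite _ _),
        tripleS_eq, sup_comm, loops_sup]
      · rw [Set.disjoint_left]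
        rintro v hv ⟨u, hu, rfl⟩
        rw [supp_arcS] at hv
        have h1 := Frame.site_le hv
        have h2 := hu.2
        rw [shift_fst] at h1
        omega
      · rintro v - w (rfl | ⟨-, h, -⟩)
        · exact ⟨v, rfl⟩
        · exact ⟨(w.1 - (2 * A.N + 1), w.2), Prod.ext (Nat.sub_add_cancel h) rfl⟩
    rw [e2, linking_eq A BC, stackS_right hBC h₂, ← loops_add _ (re_injective _) _ _ _
      ((stackMid_finite _ _).image _) (stackMid_finite _ _)]
    · rw [Set.disjoint_left]
      rintro _ ⟨u, hu, rfl⟩ hr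
      rw [mem_range_re, shift_fst, hu.2] at hr
      omega
    · intro v hv w hw
      by_cases hw1 : w.1 = c
      · refine Or.inl ⟨(2 * B.N + 1, w.2), ?_, Prod.ext ?_ rfl⟩
        · have hws : w ∈ supp (tripleS A B C) := mem_supp_right hw (by
            rintro rfl
            exact re_fst_ne _ _ hw1)
          rw [mem_mid hBC, hBC]
          refine ⟨rfl, ?_⟩
          rcases ht w hws with h | h
          · rw [mem_stackV] at h
            rcases h with h | h
            · have := Frame.site_le h
              omega
            · have h3 := h.2
              rw [Frame.mem_V, hw1, show c - (2 * A.N + 1) = 2 * B.N + 1 by omega, hBC] at h3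
              exact h3
          · have h3 := h.2
            rw [Frame.mem_V, hw1, Nat.sub_self] at h3
            exact h3
        · rw [shift_fst, hw1]
          dsimp only
          omega
      · exact Or.inr (mem_range_re.2 hw1)
  -- It remains to match the glued vertices, named differently in the two bracketings.
  have m1 : re c '' stackMid A BC = stackMid A B := by
    have hf : ∀ v ∈ stackMid A BC, re c v = v := fun v hv => by
      have := hv.2
      rw [re, if_pos (by omega)]
    rw [Set.image_congr hf, Set.image_id']
    ext v
    rw [mem_mid hcr, mem_mid hAB]
  have m2 : shift (2 * A.N + 1) '' stackMid B C = re (2 * A.N + 1) '' stackMid AB C := by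
    have hft : AB.f (2 * AB.N + 1) = B.f (2 * B.N + 1) := by
      rw [hf₁, hN₁, if_neg (by omega)]
      congr 1
      omega
    ext v
    constructor
    · rintro ⟨u, hu, rfl⟩
      rw [mem_mid hBC] at hu
      refine ⟨(2 * AB.N + 1, u.2), (mem_mid hcl).2 ⟨rfl, by rw [hft]; exact hu.2⟩, ?_⟩
      rw [re, if_neg (by dsimp only; omega)]
      refine Prod.ext ?_ rfl
      rw [shift_fst, hu.1, hN₁]
      dsimp only
      omega
    · rintro ⟨u, hu, rfl⟩
      rw [mem_mid hcl, hft] at hu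
      refine ⟨(2 * B.N + 1, u.2), (mem_mid hBC).2 ⟨rfl, hu.2⟩, ?_⟩
      rw [re, if_neg (by omega)]
      refine Prod.ext ?_ rfl
      rw [shift_fst, hu.1, hN₁]
      dsimp only
      omega
  rw [left, right, m1, m2, Set.union_comm]

end Assoc

/-! ### Identities -/

/-- The arcs of the identity. -/
def idE (n : ℕ) (v : ℕ × ℕ) : ℕ × ℕ :=
  if v.1 ≤ 1 ∧ 1 ≤ v.2 ∧ v.2 ≤ n then (1 - v.1, v.2) else v

/-- The identity datum: `n` parallel arcs in a square without bands. -/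
def idDatum (n : ℕ) : Datum where
  N := 0
  P i := i
  s _ := 0
  P_P _ := rfl
  P_ne i := by
    simp only [ne_eq, not_true_eq_false, false_iff]
    omega
  s_P _ := rfl
  s_out _ _ := rfl
  f k := if k ≤ 1 then n else 0
  f_P _ := rfl
  f_out k hk := if_neg (by omega)
  oneBoundary := fun x => by
    have := x.2
    omega
  E := idE n
  E_E v := by
    obtain ⟨k, x⟩ := v
    unfold idE
    dsimp only
    split_ifs <;> rw [Prod.mk.injEq] <;> omega
  E_ne v := by
    rw [Frame.mem_V]
    unfold idE
    rw [Ne, Prod.ext_iff]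
    dsimp only
    split_ifs <;> (try dsimp only) <;> omega
  noncrossing u hu v hv := by
    have cases : ∀ w : ℕ × ℕ, (1 ≤ w.2 ∧ w.2 ≤ if w.1 ≤ 1 then n else 0) →
        min (key 0 w) (key 0 (idE n w)) = key 0 (0, w.2) ∧
        max (key 0 w) (key 0 (idE n w)) = key 0 (1, w.2) := by
      rintro ⟨k, x⟩ hw
      dsimp only at hw ⊢
      have hk : k ≤ 1 := by
        by_contra h
        rw [if_neg h] at hw
        omega
      rw [if_pos hk] at hw
      have hlt : key 0 (0, x) < key 0 (1, x) := key_lt_iff.2 (Or.inl Nat.zero_lt_one)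
      rw [idE, if_pos ⟨hk, hw⟩]
      dsimp only
      interval_cases k
      · exact ⟨min_eq_left hlt.le, max_eq_right hlt.le⟩
      · exact ⟨min_eq_right hlt.le, max_eq_left hlt.le⟩
    unfold Crosses
    rw [(cases u hu).1, (cases u hu).2, (cases v hv).1, (cases v hv).2]
    simp only [key_lt_iff]
    norm_num
    omega

/-- The identity datum, with its type. -/
def idSq (n : ℕ) : Sq n n := ⟨idDatum n, rfl, rfl⟩

section Identity

variable {n : ℕ} {Θ : Datum}

theorem composable_id (h : Θ.f 0 = n) : Composable (idDatum n) Θ := h.symm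

theorem idDatum_rel {x : ℕ} (hx : 1 ≤ x ∧ x ≤ n) : arcS (idDatum n) (0, x) (1, x) := by
  refine Or.inr ?_
  change idE n (0, x) = (1, x)
  rw [idE, if_pos ⟨Nat.zero_le _, hx⟩]
  rfl

/-- The strands of the identity merely extend the arcs of `Θ` from its bottom edge. -/
theorem isJuxtaposition_id (h : Θ.f 0 = n) : IsJuxtaposition (idDatum n) Θ Θ := by
  rw [isJuxtaposition_iff (composable_id h)]
  have hN : (idDatum n).N = 0 := rfl
  refine ⟨by rw [hN, Nat.zero_add], fun i => ?_, fun i => ?_, fun i => ?_, ?_⟩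
  · rw [hN]
    split_ifs with hi
    · exact Θ.P_out (by omega)
    · rfl
  · rw [hN]
    split_ifs with hi
    · exact Θ.s_out _ (by omega)
    · rfl
  · rw [hN]
    split_ifs with hi
    · obtain rfl : i = 0 := by omega
      exact h
    · rfl
  · apply le_antisymm
    -- Skipping site `1` leaves a bottom point at site `0`, so it must follow its strand to its
    -- glued copy at site `1`; the other points are already in place.
    · have lift : ∀ v ∈ Θ.V, stackS (idDatum n) Θ (re 1 v) (v.1 + 1, v.2) := by
        rintro ⟨k, x⟩ hv
        rcases Nat.eq_zero_or_pos k with rfl | hk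
        · rw [Frame.mem_V, h] at hv
          exact sup_left (idDatum_rel hv)
        · rw [re, if_neg (by dsimp only; omega)]
      intro u w huw
      rw [Setoid.comap_rel]
      by_cases e : u = w
      · rw [e]
      · have hu := mem_supp_left huw e
        have hw := mem_supp_right huw e
        rw [supp_arcS] at hu hw
        refine Setoid.trans' _ (lift u hu) (Setoid.trans' _ (sup_right ?_)
          (Setoid.symm' _ (lift w hw)))
        exact Or.inr ⟨Nat.le_add_left _ _, Nat.le_add_left _ _, by simpa [hN] using huw⟩
    -- Contracting the strands: truncated subtraction sends the sites `0` and `1` both to `0`.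
    · have collapse : stackS (idDatum n) Θ ≤
          Setoid.comap (fun v : ℕ × ℕ => (v.1 - 1, v.2)) (arcS Θ) := by
        refine sup_le ?_ ?_
        · rintro u w (rfl | huw)
          · exact Setoid.refl' _ _
          · change idE n u = w at huw
            rw [Setoid.comap_rel, ← huw]
            unfold idE
            split_ifs with h1
            · have : u.1 - 1 = 1 - u.1 - 1 := by omega
              dsimp only
              rw [this]
            · exact Setoid.refl' _ _
        · rintro u w (rfl | ⟨-, -, huw⟩)
          · exact Setoid.refl' _ _
          · exact huw
      intro u w huw
      have := collapse huw
      rw [Setoid.comap_rel] at this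
      have e : ∀ v : ℕ × ℕ, ((re 1 v).1 - 1, (re 1 v).2) = v := by
        intro v
        unfold re
        split_ifs
        · exact Prod.ext (by dsimp only; omega) rfl
        · rfl
      rwa [hN, e, e] at this

/-- Every glued vertex is joined by a strand to the bottom edge, so no class is closed. -/
theorem linking_id (h : Θ.f 0 = n) : linking (idDatum n) Θ = 0 := by
  have hN : (idDatum n).N = 0 := rfl
  rw [linking_eq, loops, Set.ncard_eq_zero (finite_classes _ (stackMid_finite _ _)),
    Set.eq_empty_iff_forall_notMem]
  rintro C ⟨⟨k, x⟩, hv, rfl, hC⟩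
  rw [mem_mid (composable_id h)] at hv
  have hx : 1 ≤ x ∧ x ≤ n := hv.2
  obtain rfl : k = 1 := hv.1
  have := (hC (sup_left (Setoid.symm' _ (idDatum_rel hx)))).2
  rw [hN] at this
  exact absurd this (by simp)

theorem idDatum_dual (n : ℕ) : (idDatum n).dual = idDatum n := by
  have hN : (idDatum n).N = 0 := rfl
  have hdm : ∀ v, (idDatum n).dm v = (flip 0 v.1, v.2) := fun v => by
    unfold Frame.dm
    rw [if_neg]
    · rfl
    · rintro ⟨h, -⟩
      rw [show (idDatum n).toFrame.N = 0 from rfl] at h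
      omega
  have hf : ∀ i, flip 0 i ≤ 1 ↔ i ≤ 1 := fun i => by
    unfold flip
    split_ifs <;> omega
  refine Datum.ext' rfl (fun i => ?_) (fun i => rfl) (fun i => ?_) (fun v => ?_)
  · exact flip_flip 0 i
  · change (if flip 0 i ≤ 1 then n else 0) = if i ≤ 1 then n else 0
    simp only [hf]
  · obtain ⟨u, rfl⟩ : ∃ u, (idDatum n).dm u = v := ⟨_, Datum.dm_dual_dm _ v⟩
    rw [Datum.dual_E_dm, hdm, hdm]
    change _ = idE n _
    change (flip 0 (idE n u).1, (idE n u).2) = _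
    unfold idE
    dsimp only
    simp only [hf]
    split_ifs with h1
    · refine Prod.ext ?_ rfl
      dsimp only
      unfold flip
      split_ifs <;> omega
    · rfl

end Identity

end SWB

namespace SWB

/-! ### Linear maps on the modules of morphisms -/

section Invariant

variable {K : Type u} [CommRing K] {α β γ : K} {n m l k : ℕ}
  {M : Type*} [AddCommGroup M] [Module K M]

/-- A function on square with bands data which descends to the module of morphisms. -/
structure Invariant (α β γ : K) {n m : ℕ} (g : Sq n m → M) : Prop where
  pull : ∀ (Θ Θ' : Sq n m) (i a : ℕ), IsPullThrough Θ.1 i a Θ'.1 → g Θ = g Θ'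
  slide : ∀ (Θ Θ' : Sq n m) (i : ℕ) (ε : ℤ), IsHandleSlide Θ.1 i ε Θ'.1 → g Θ = g Θ'
  separating : ∀ (Θ Θ' : Sq n m) (Γ : Set (ℕ × ℕ)), Θ.1.IsInternalComponent Γ →
    Θ.1.IsSeparating Γ → IsDeletion Θ.1 Γ Θ'.1 → g Θ = α • g Θ'
  twisted : ∀ (Θ Θ' : Sq n m) (Γ : Set (ℕ × ℕ)), Θ.1.IsInternalComponent Γ →
    Θ.1.twist Γ = 1 → IsDeletion Θ.1 Γ Θ'.1 → g Θ = β • g Θ'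
  nonSeparating : ∀ (Θ Θ' : Sq n m) (Γ : Set (ℕ × ℕ)), Θ.1.IsInternalComponent Γ →
    Θ.1.IsNonSeparating Γ → Θ.1.twist Γ = 0 → IsDeletion Θ.1 Γ Θ'.1 → g Θ = γ • g Θ'

theorem bar_invariant (α β γ : K) (n m : ℕ) :
    Invariant α β γ (bar α β γ : Sq n m → Hom α β γ n m) where
  pull Θ Θ' i a h := by
    have : (Quot.mk _ Θ : SqHS n m) = Quot.mk _ Θ' :=
      Quot.sound ⟨Θ', Relation.ReflTransGen.refl, Relation.EqvGen.rel _ _ ⟨i, a, h⟩⟩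
    rw [bar, bar, cls, cls, this]
  slide Θ Θ' i ε h := by
    -- In `HandleSlideEquiv` the slides are applied to the second argument, hence the reversed
    -- equality.
    have : (Quot.mk _ Θ' : SqHS n m) = Quot.mk _ Θ :=
      Quot.sound ⟨Θ', Relation.ReflTransGen.single ⟨i, ε, h⟩, Relation.EqvGen.refl _⟩
    rw [bar, bar, cls, cls, this]
  separating Θ Θ' Γ h1 h2 h3 := by
    refine (Submodule.Quotient.eq _).2 (Submodule.mem_sup_left (Submodule.mem_sup_left ?_))
    exact Submodule.subset_span ⟨Θ, Θ', Γ, h1, h2, h3, rfl⟩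
  twisted Θ Θ' Γ h1 h2 h3 := by
    refine (Submodule.Quotient.eq _).2 (Submodule.mem_sup_left (Submodule.mem_sup_right ?_))
    exact Submodule.subset_span ⟨Θ, Θ', Γ, h1, h2, h3, rfl⟩
  nonSeparating Θ Θ' Γ h1 h2 h3 h4 := by
    refine (Submodule.Quotient.eq _).2 (Submodule.mem_sup_right ?_)
    exact Submodule.subset_span ⟨Θ, Θ', Γ, h1, h2, h3, h4, rfl⟩

theorem Invariant.map {M' : Type*} [AddCommGroup M'] [Module K M'] {g : Sq n m → M}
    (h : Invariant α β γ g) (φ : M →ₗ[K] M') : Invariant α β γ fun Θ => φ (g Θ) where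
  pull Θ Θ' i a h' := by rw [h.pull Θ Θ' i a h']
  slide Θ Θ' i ε h' := by rw [h.slide Θ Θ' i ε h']
  separating Θ Θ' Γ h1 h2 h3 := by rw [h.separating Θ Θ' Γ h1 h2 h3, map_smul]
  twisted Θ Θ' Γ h1 h2 h3 := by rw [h.twisted Θ Θ' Γ h1 h2 h3, map_smul]
  nonSeparating Θ Θ' Γ h1 h2 h3 h4 := by rw [h.nonSeparating Θ Θ' Γ h1 h2 h3 h4, map_smul]

theorem Invariant.dual {g : Sq m n → M} (h : Invariant α β γ g) :
    Invariant α β γ fun Θ : Sq n m => g (dualSq Θ) where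
  pull _ _ _ _ h' := h.pull _ _ _ _ h'.dual
  slide _ _ _ _ h' := h.slide _ _ _ _ h'.dual
  separating _ _ _ h1 h2 h3 := h.separating _ _ _ h1.dual (h2.dual h1.1.subset) h3.dual
  twisted _ _ _ h1 h2 h3 := h.twisted _ _ _ h1.dual ((Datum.twist_dual h1).trans h2) h3.dual
  nonSeparating _ _ _ h1 h2 h3 h4 :=
    h.nonSeparating _ _ _ h1.dual (h2.dual h1.1.subset) ((Datum.twist_dual h1).trans h3) h4.dual

/-- Agreement along slides and pull-throughs is enough: the quotient uses `HandleSlideEquiv` only as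
a generating relation, so its symmetry and transitivity are never required. -/
theorem Invariant.handleSlideEquiv {g : Sq n m → M} (h : Invariant α β γ g) (Θ Θ' : Sq n m)
    (hΘ : HandleSlideEquiv Θ Θ') : g Θ = g Θ' := by
  have slides : ∀ A B : Sq n m, Relation.ReflTransGen
      (fun A B : Sq n m => ∃ i ε, IsHandleSlide A.1 i ε B.1) A B → g A = g B := by
    intro A B hAB
    induction hAB with
    | refl => rfl
    | tail _ hs ih =>
      obtain ⟨i, ε, hs⟩ := hs
      exact ih.trans (h.slide _ _ i ε hs)
  have pulls : ∀ A B : Sq n m, Isotopic A B → g A = g B := by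
    intro A B hAB
    induction hAB with
    | rel _ _ hp =>
      obtain ⟨i, a, hp⟩ := hp
      exact h.pull _ _ i a hp
    | refl => rfl
    | symm _ _ _ ih => exact ih.symm
    | trans _ _ _ _ _ ih1 ih2 => exact ih1.trans ih2
  obtain ⟨Θ'', h1, h2⟩ := hΘ
  exact (pulls _ _ h2).trans (slides _ _ h1).symm

/-- The function on handle slide equivalence classes given by an invariant function. -/
def Invariant.quotLift {g : Sq n m → M} (h : Invariant α β γ g) : SqHS n m → M :=
  Quot.lift g h.handleSlideEquiv

/-- The linear map on the free module given by an invariant function. -/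
noncomputable def Invariant.freeLift {g : Sq n m → M} (h : Invariant α β γ g) :
    (SqHS n m →₀ K) →ₗ[K] M :=
  Finsupp.linearCombination K h.quotLift

theorem Invariant.freeLift_cls {g : Sq n m → M} (h : Invariant α β γ g) (Θ : Sq n m) :
    h.freeLift (cls K Θ) = g Θ :=
  (Finsupp.linearCombination_single K 1 _).trans (one_smul K _)

theorem Invariant.rel_le_ker {g : Sq n m → M} (h : Invariant α β γ g) :
    relA α n m ⊔ relB β n m ⊔ relC γ n m ≤ LinearMap.ker h.freeLift := by
  refine sup_le (sup_le ?_ ?_) ?_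
  · refine Submodule.span_le.2 ?_
    rintro _ ⟨Θ, Θ', Γ, h1, h2, h3, rfl⟩
    rw [SetLike.mem_coe, LinearMap.mem_ker, map_sub, map_smul, h.freeLift_cls, h.freeLift_cls,
      h.separating Θ Θ' Γ h1 h2 h3, sub_self]
  · refine Submodule.span_le.2 ?_
    rintro _ ⟨Θ, Θ', Γ, h1, h2, h3, rfl⟩
    rw [SetLike.mem_coe, LinearMap.mem_ker, map_sub, map_smul, h.freeLift_cls, h.freeLift_cls,
      h.twisted Θ Θ' Γ h1 h2 h3, sub_self]
  · refine Submodule.span_le.2 ?_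
    rintro _ ⟨Θ, Θ', Γ, h1, h2, h3, h4, rfl⟩
    rw [SetLike.mem_coe, LinearMap.mem_ker, map_sub, map_smul, h.freeLift_cls, h.freeLift_cls,
      h.nonSeparating Θ Θ' Γ h1 h2 h3 h4, sub_self]

/-- The linear map on the module of morphisms given by an invariant function on data. -/
noncomputable def Invariant.lift {g : Sq n m → M} (h : Invariant α β γ g) :
    Hom α β γ n m →ₗ[K] M :=
  Submodule.liftQ _ h.freeLift h.rel_le_ker

theorem Invariant.lift_bar {g : Sq n m → M} (h : Invariant α β γ g) (Θ : Sq n m) :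
    h.lift (bar α β γ Θ) = g Θ :=
  h.freeLift_cls Θ

theorem hom_induction {p : Hom α β γ n m → Prop} (x : Hom α β γ n m) (hzero : p 0)
    (hbar : ∀ Θ, p (bar α β γ Θ)) (hadd : ∀ x y, p x → p y → p (x + y))
    (hsmul : ∀ (r : K) x, p x → p (r • x)) : p x := by
  obtain ⟨x, rfl⟩ := Submodule.Quotient.mk_surjective _ x
  induction x using Finsupp.induction_linear with
  | zero => exact hzero
  | add x y hx hy => exact hadd _ _ hx hy
  | single q r =>
    induction q using Quot.ind with
    | mk Θ =>
      have h := hsmul r _ (hbar Θ)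
      have e : r • cls K Θ = Finsupp.single (Quot.mk _ Θ : SqHS n m) r :=
        (Finsupp.smul_single _ _ _).trans (by rw [smul_eq_mul, mul_one]; rfl)
      change p (Submodule.Quotient.mk (r • cls K Θ)) at h
      rw [e] at h
      exact h

theorem hom_ext {φ ψ : Hom α β γ n m →ₗ[K] M} (h : ∀ Θ, φ (bar α β γ Θ) = ψ (bar α β γ Θ)) :
    φ = ψ := by
  ext1
  refine LinearMap.ext fun x => ?_
  exact hom_induction (p := fun x => φ x = ψ x) (Submodule.Quotient.mk x)
    (by rw [map_zero, map_zero]) h (fun x y hx hy => by rw [map_add, map_add, hx, hy])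
    (fun r x hx => by rw [map_smul, map_smul, hx])

/-! ### Duality and composition -/

/-- The duality on morphisms. -/
noncomputable def star (α β γ : K) (n m : ℕ) : Hom α β γ n m →ₗ[K] Hom α β γ m n :=
  (bar_invariant α β γ m n).dual.lift

theorem star_bar (Θ : Sq n m) : star α β γ n m (bar α β γ Θ) = bar α β γ (dualSq Θ) :=
  Invariant.lift_bar _ Θ

theorem star_star (x : Hom α β γ n m) : star α β γ m n (star α β γ n m x) = x := by
  have : star α β γ m n ∘ₗ star α β γ n m = LinearMap.id := hom_ext fun Θ => by
    rw [LinearMap.comp_apply, star_bar, star_bar, dualSq_dualSq, LinearMap.id_apply]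
  exact LinearMap.congr_fun this x

/-- The composition of the morphisms given by two data. -/
noncomputable def barComp (α β γ : K) (Θ₁ : Sq n m) (Θ₂ : Sq m l) : Hom α β γ n l :=
  α ^ linking Θ₁.1 Θ₂.1 • bar α β γ (juxt Θ₁ Θ₂)

/-- Each move in the lower square is matched by a relation between the juxtapositions. -/
theorem barComp_invariant_left (Θ₂ : Sq m l) :
    Invariant α β γ fun Θ₁ : Sq n m => barComp α β γ Θ₁ Θ₂ where
  pull Θ Θ' i a h := by
    have hb := bar_invariant α β γ n l
    dsimp only [barComp]
    rcases h.juxt (Sq.composable Θ Θ₂) (Sq.composable Θ' Θ₂) (juxt_spec Θ Θ₂) (juxt_spec Θ' Θ₂) with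
      ⟨h1, h2⟩ | ⟨h1, h2, h3, h4⟩
    · rw [h2, hb.pull _ _ i a h1]
    -- The factor `α` for the deleted annulus curve equals the one for the additional glued loop.
    · rw [h4, hb.separating _ _ _ h1 h2 h3, smul_smul, pow_succ]
  slide Θ Θ' i ε h := by
    have hb := bar_invariant α β γ n l
    dsimp only [barComp]
    obtain ⟨h1, h2⟩ :=
      h.juxt (Sq.composable Θ Θ₂) (Sq.composable Θ' Θ₂) (juxt_spec Θ Θ₂) (juxt_spec Θ' Θ₂)
    rw [h2, hb.slide _ _ i ε h1]
  separating Θ Θ' Γ h1 h2 h3 := by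
    have hb := bar_invariant α β γ n l
    dsimp only [barComp]
    have hc := Sq.composable Θ Θ₂
    obtain ⟨h4, h5⟩ := h3.juxt h1 hc (Sq.composable Θ' Θ₂) (juxt_spec Θ Θ₂) (juxt_spec Θ' Θ₂)
    rw [h5, hb.separating _ _ _ (h1.juxt hc (juxt_spec Θ Θ₂)) (h2.juxt h1 hc (juxt_spec Θ Θ₂)) h4,
      smul_comm]
  twisted Θ Θ' Γ h1 h2 h3 := by
    have hb := bar_invariant α β γ n l
    dsimp only [barComp]
    have hc := Sq.composable Θ Θ₂
    obtain ⟨h4, h5⟩ := h3.juxt h1 hc (Sq.composable Θ' Θ₂) (juxt_spec Θ Θ₂) (juxt_spec Θ' Θ₂)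
    rw [h5, hb.twisted _ _ _ (h1.juxt hc (juxt_spec Θ Θ₂))
      ((Datum.twist_juxt h1 (juxt_spec Θ Θ₂)).trans h2) h4, smul_comm]
  nonSeparating Θ Θ' Γ h1 h2 h3 h4 := by
    have hb := bar_invariant α β γ n l
    dsimp only [barComp]
    have hc := Sq.composable Θ Θ₂
    obtain ⟨h5, h6⟩ := h4.juxt h1 hc (Sq.composable Θ' Θ₂) (juxt_spec Θ Θ₂) (juxt_spec Θ' Θ₂)
    rw [h6, hb.nonSeparating _ _ _ (h1.juxt hc (juxt_spec Θ Θ₂))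
      (h2.juxt h1 hc (juxt_spec Θ Θ₂)) ((Datum.twist_juxt h1 (juxt_spec Θ Θ₂)).trans h3) h5,
      smul_comm]

theorem star_barComp (Θ₁ : Sq n m) (Θ₂ : Sq m l) :
    star α β γ n l (barComp α β γ Θ₁ Θ₂) = barComp α β γ (dualSq Θ₂) (dualSq Θ₁) := by
  have hc := Sq.composable Θ₁ Θ₂
  have e : juxt (dualSq Θ₂) (dualSq Θ₁) = dualSq (juxt Θ₁ Θ₂) :=
    juxt_eq ((juxt_spec Θ₁ Θ₂).dual hc)
  have e' : linking (dualSq Θ₂).1 (dualSq Θ₁).1 = linking Θ₁.1 Θ₂.1 := linking_dual _ _ hc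
  rw [barComp, barComp, map_smul, star_bar, e, e']

/-- Duality exchanges the squares, so the upper argument is handled by conjugating the statement for
the lower one with `star`. -/
theorem barComp_invariant_right (Θ₁ : Sq n m) :
    Invariant α β γ fun Θ₂ : Sq m l => barComp α β γ Θ₁ Θ₂ := by
  have h := (barComp_invariant_left (α := α) (β := β) (γ := γ) (n := l) (dualSq Θ₁)).dual.map
    (star α β γ l n)
  have e : (fun Θ₂ : Sq m l => star α β γ l n (barComp α β γ (dualSq Θ₂) (dualSq Θ₁))) =
      fun Θ₂ => barComp α β γ Θ₁ Θ₂ := by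
    funext Θ₂
    rw [← star_barComp, star_star]
  rwa [e] at h

/-- The composition with the morphism given by a datum. -/
noncomputable def compBar (α β γ : K) (n : ℕ) (Θ₂ : Sq m l) : Hom α β γ n m →ₗ[K] Hom α β γ n l :=
  (barComp_invariant_left (n := n) Θ₂).lift

theorem compBar_bar (Θ₁ : Sq n m) (Θ₂ : Sq m l) :
    compBar α β γ n Θ₂ (bar α β γ Θ₁) = barComp α β γ Θ₁ Θ₂ :=
  Invariant.lift_bar _ Θ₁

/-- The relations are now between linear maps; as the classes of data span, they may be tested on
these. -/
theorem compBar_invariant (α β γ : K) (n m l : ℕ) :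
    Invariant α β γ fun Θ₂ : Sq m l => compBar α β γ n Θ₂ where
  pull Θ Θ' i a h := hom_ext fun Θ₁ => by
    rw [compBar_bar, compBar_bar]
    exact (barComp_invariant_right Θ₁).pull Θ Θ' i a h
  slide Θ Θ' i ε h := hom_ext fun Θ₁ => by
    rw [compBar_bar, compBar_bar]
    exact (barComp_invariant_right Θ₁).slide Θ Θ' i ε h
  separating Θ Θ' Γ h1 h2 h3 := hom_ext fun Θ₁ => by
    rw [LinearMap.smul_apply, compBar_bar, compBar_bar]
    exact (barComp_invariant_right Θ₁).separating Θ Θ' Γ h1 h2 h3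
  twisted Θ Θ' Γ h1 h2 h3 := hom_ext fun Θ₁ => by
    rw [LinearMap.smul_apply, compBar_bar, compBar_bar]
    exact (barComp_invariant_right Θ₁).twisted Θ Θ' Γ h1 h2 h3
  nonSeparating Θ Θ' Γ h1 h2 h3 h4 := hom_ext fun Θ₁ => by
    rw [LinearMap.smul_apply, compBar_bar, compBar_bar]
    exact (barComp_invariant_right Θ₁).nonSeparating Θ Θ' Γ h1 h2 h3 h4

/-- The composition of morphisms. -/
noncomputable def comp (α β γ : K) (n m l : ℕ) :
    Hom α β γ n m →ₗ[K] Hom α β γ m l →ₗ[K] Hom α β γ n l :=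
  (compBar_invariant α β γ n m l).lift.flip

theorem comp_bar (x : Hom α β γ n m) (Θ₂ : Sq m l) :
    comp α β γ n m l x (bar α β γ Θ₂) = compBar α β γ n Θ₂ x := by
  rw [comp, LinearMap.flip_apply, Invariant.lift_bar]

theorem comp_bar_bar (Θ₁ : Sq n m) (Θ₂ : Sq m l) :
    comp α β γ n m l (bar α β γ Θ₁) (bar α β γ Θ₂) =
      α ^ linking Θ₁.1 Θ₂.1 • bar α β γ (juxt Θ₁ Θ₂) := by
  rw [comp_bar, compBar_bar, barComp]

theorem star_comp (x : Hom α β γ n m) (y : Hom α β γ m l) :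
    star α β γ n l (comp α β γ n m l x y) =
      comp α β γ l m n (star α β γ m l y) (star α β γ n m x) := by
  refine hom_induction (p := fun y => star α β γ n l (comp α β γ n m l x y) =
      comp α β γ l m n (star α β γ m l y) (star α β γ n m x)) y ?_ (fun Θ₂ => ?_)
    (fun y y' h h' => ?_) (fun r y h => ?_)
  · simp only [map_zero, LinearMap.zero_apply]
  · refine hom_induction (p := fun x => star α β γ n l (comp α β γ n m l x (bar α β γ Θ₂)) =
      comp α β γ l m n (star α β γ m l (bar α β γ Θ₂)) (star α β γ n m x)) x ?_ (fun Θ₁ => ?_)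
      (fun x x' h h' => ?_) (fun r x h => ?_)
    · simp only [map_zero, LinearMap.zero_apply]
    · rw [comp_bar, compBar_bar, star_barComp, star_bar, star_bar, comp_bar, compBar_bar]
    · simp only [map_add, LinearMap.add_apply, h, h']
    · simp only [map_smul, LinearMap.smul_apply, h]
  · simp only [map_add, LinearMap.add_apply, h, h']
  · simp only [map_smul, LinearMap.smul_apply, h]

theorem comp_assoc (x : Hom α β γ n m) (y : Hom α β γ m l) (z : Hom α β γ l k) :
    comp α β γ n l k (comp α β γ n m l x y) z = comp α β γ n m k x (comp α β γ m l k y z) := by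
  refine hom_induction (p := fun x => comp α β γ n l k (comp α β γ n m l x y) z =
    comp α β γ n m k x (comp α β γ m l k y z)) x ?_ (fun Θ₁ => ?_) (fun x x' h h' => ?_)
    (fun r x h => ?_)
  · simp only [map_zero, LinearMap.zero_apply]
  · refine hom_induction (p := fun y => comp α β γ n l k (comp α β γ n m l (bar α β γ Θ₁) y) z =
      comp α β γ n m k (bar α β γ Θ₁) (comp α β γ m l k y z)) y ?_ (fun Θ₂ => ?_)
      (fun x x' h h' => ?_) (fun r x h => ?_)
    · simp only [map_zero, LinearMap.zero_apply]
    · refine hom_induction (p := fun z => comp α β γ n l k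
        (comp α β γ n m l (bar α β γ Θ₁) (bar α β γ Θ₂)) z =
        comp α β γ n m k (bar α β γ Θ₁) (comp α β γ m l k (bar α β γ Θ₂) z)) z ?_ (fun Θ₃ => ?_)
        (fun x x' h h' => ?_) (fun r x h => ?_)
      · simp only [map_zero]
      · have hc := Sq.composable Θ₁ Θ₂
        have hc' := Sq.composable Θ₂ Θ₃
        have e : juxt Θ₁ (juxt Θ₂ Θ₃) = juxt (juxt Θ₁ Θ₂) Θ₃ :=
          juxt_eq ((juxt_spec Θ₁ Θ₂).assoc hc hc' (juxt_spec Θ₂ Θ₃) (juxt_spec _ Θ₃))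
        have e' := linking_assoc hc hc' (juxt_spec Θ₁ Θ₂) (juxt_spec Θ₂ Θ₃)
        simp only [comp_bar_bar, map_smul, LinearMap.smul_apply, smul_smul, ← pow_add, e, e']
      · simp only [map_add, h, h']
      · simp only [map_smul, h]
    · simp only [map_add, LinearMap.add_apply, h, h']
    · simp only [map_smul, LinearMap.smul_apply, h]
  · simp only [map_add, LinearMap.add_apply, h, h']
  · simp only [map_smul, LinearMap.smul_apply, h]

theorem id_comp (x : Hom α β γ n m) : comp α β γ n n m (bar α β γ (idSq n)) x = x := by
  have : comp α β γ n n m (bar α β γ (idSq n)) = LinearMap.id := hom_ext fun Θ => by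
    have e : juxt (idSq n) Θ = Θ := juxt_eq (isJuxtaposition_id Θ.2.1)
    have e' : linking (idSq n).1 Θ.1 = 0 := linking_id Θ.2.1
    rw [comp_bar_bar, e, e', pow_zero, one_smul, LinearMap.id_apply]
  rw [this, LinearMap.id_apply]

theorem star_id (α β γ : K) (n : ℕ) :
    star α β γ n n (bar α β γ (idSq n)) = bar α β γ (idSq n) := by
  rw [star_bar, (Subtype.ext (idDatum_dual n) : dualSq (idSq n) = idSq n)]

/-- The right unit law is the dual of the left one, since the identity is self-dual. -/
theorem comp_id (x : Hom α β γ n m) : comp α β γ n m m x (bar α β γ (idSq m)) = x := by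
  rw [← star_star (comp α β γ n m m x (bar α β γ (idSq m))), star_comp, star_id, id_comp, star_star]

end Invariant

/-- The square with bands category. -/
noncomputable def category {K : Type u} [CommRing K] (α β γ : K) :
    LinearCategoryOn K (Hom α β γ) where
  id n := bar α β γ (idSq n)
  comp := comp α β γ _ _ _
  id_comp := id_comp
  comp_id := comp_id
  assoc := comp_assoc

end SWB

/-! ### Assembly of the theorem -/

theorem theorem4p2 {K : Type u} [CommRing K] (α β γ : K) :
    -- vertical juxtaposition and duals are well defined
    (∀ {n m l : ℕ} (Θ₁ : SWB.Sq n m) (Θ₂ : SWB.Sq m l),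
      ∃! Θ : SWB.Sq n l, SWB.IsJuxtaposition Θ₁.1 Θ₂.1 Θ.1) ∧
    (∀ {n m : ℕ} (Θ : SWB.Sq n m), ∃! Θ' : SWB.Sq m n, SWB.IsDual Θ.1 Θ'.1) ∧
    -- the `K`-linear category
    ∃ C : SWB.LinearCategoryOn K (SWB.Hom α β γ),
      (∀ {n m l : ℕ} (Θ₁ : SWB.Sq n m) (Θ₂ : SWB.Sq m l) (Θ : SWB.Sq n l),
        SWB.IsJuxtaposition Θ₁.1 Θ₂.1 Θ.1 →
          C.comp (SWB.bar α β γ Θ₁) (SWB.bar α β γ Θ₂) =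
            α ^ SWB.linking Θ₁.1 Θ₂.1 • SWB.bar α β γ Θ) ∧
      -- the contravariant duality
      ∃ star : ∀ {n m : ℕ}, SWB.Hom α β γ n m →ₗ[K] SWB.Hom α β γ m n,
        (∀ {n m : ℕ} (Θ : SWB.Sq n m) (Θ' : SWB.Sq m n), SWB.IsDual Θ.1 Θ'.1 →
          star (SWB.bar α β γ Θ) = SWB.bar α β γ Θ') ∧
        (∀ n : ℕ, star (C.id n) = C.id n) ∧
        (∀ {n m l : ℕ} (x : SWB.Hom α β γ n m) (y : SWB.Hom α β γ m l),
          star (C.comp x y) = C.comp (star y) (star x)) ∧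
        (∀ {n m : ℕ} (x : SWB.Hom α β γ n m), star (star x) = x) := by
  refine ⟨fun Θ₁ Θ₂ => ⟨SWB.juxt Θ₁ Θ₂, SWB.juxt_spec Θ₁ Θ₂, fun Θ h => (SWB.juxt_eq h).symm⟩,
    fun Θ => ⟨SWB.dualSq Θ, SWB.isDual_iff.2 rfl, fun Θ' h => Subtype.ext (SWB.isDual_iff.1 h)⟩,
    SWB.category α β γ, fun Θ₁ Θ₂ Θ h => ?_, fun {n m} => SWB.star α β γ n m, fun Θ Θ' h => ?_,
    SWB.star_id α β γ, SWB.star_comp, SWB.star_star⟩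
  · rw [← SWB.juxt_eq h]
    exact SWB.comp_bar_bar Θ₁ Θ₂
  · rw [SWB.star_bar, (Subtype.ext (SWB.isDual_iff.1 h) : Θ' = SWB.dualSq Θ)]
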